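/- Let $\mathsf{RCA}_0^\omega$ be Kohlenbach's base theory of higher-order Reverse Mathematics: classical logic in the language of all finite types over the type $0$ of natural numbers (with $1 = 0\to 0$, $2 = 1\to 0$, and equality at higher types defined from equality at type $0$), with the axioms of ordered semi-rings for $0,1,+,\times,<$, the defining axioms of the combinators and of the recursor of type $0$, extensionality, quantifier-free induction, and $\mathsf{QF\text{-}AC}^{1,0}$. Here $\mathsf{QF\text{-}AC}^{\sigma,\tau}$ is the schema $(\forall x^\sigma)(\exists y^\tau)A(x,y)\to(\exists Y^{\sigma\to\tau})(\forall x^\sigma)A(x,Y(x))$ for quantifier-free $A$. Let $\mathsf{ACA}_0^\omega$ be $\mathsf{RCA}_0^\omega$ plus the axiom $(\exists^2)$: there is $\varphi^2\le 1$ such that $(\exists n)(f(n)=0)\leftrightarrow\varphi(f)=0$ for all $f^1$. Real numbers are coded by type $1$ objects, namely by sequences of (codes of) rationals with $|q_n-q_{n+i}|<2^{-n}$ for all $n,i$. Write $I=[0,1]$. A function $\psi:I\to\mathbb{R}$ is an object of type $1\to1$ that maps elements of $I$ to reals and equal ones to equal ones; put $I_y^\psi=(y-\psi(y),\,y+\psi(y))$,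 which may be empty, and say that $\psi$ covers $I$ if $(\forall x\in I)(\exists y\in I)(x\in I_y^\psi)$. "$[0,1]$ is paracompact" is the statement that for every $\psi:I\to\mathbb{R}$ that covers $I$ there is $\phi:I\to\mathbb{R}$ that covers $I$, is a refinement of $\psi$, i.e. $(\forall x\in I)(\exists y\in I)(I_x^\phi\subseteq I_y^\psi)$, and is locally finite, i.e. every $x\in I$ has a neighbourhood $(x-\varepsilon,x+\varepsilon)\cap I$, $\varepsilon>0$, that intersects only finitely many of the subsets $I_y^\phi\cap I$ ($y\in I$) of $I$. $\mathsf{HBT}$ is the Heine–Borel theorem for uncountable covers: for every $\psi:I\to\mathbb{R}$ that covers $I$ there are $y_1,\dots,y_k\in I$ with $I\subset\bigcup_{i\le k}I_{y_i}^\psi$. **Theorem.** The system $\mathsf{ACA}_0^\omega+\mathsf{QF\text{-}AC}^{1,1}+\text{"}[0,1]\text{ is paracompact"}$ proves $\mathsf{HBT}$. -/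

import Mathlib

/-!
Higher-order arithmetic in all finite types: its language, a classical natural deduction
calculus for it, Kohlenbach's base theory with the axioms used here, and the formalisation of
the reals, of covers of the unit interval, of its paracompactness and of its Heine-Borel
theorem, inside that language.
-/

namespace HORM

/-! ### Types, terms, formulas -/

/-- The finite types: the type `nat` (written `0` in the literature) and function types. -/
inductive Ty : Type
  | nat : Ty
  | arr : Ty → Ty → Ty
  deriving DecidableEq

infixr:60 " ⇒ " => Ty.arr

/-- The type `1 = 0 → 0`. -/
abbrev Ty.one : Ty := Ty.nat ⇒ Ty.nat

/-- The type `2 = 1 → 0`. -/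
abbrev Ty.two : Ty := Ty.one ⇒ Ty.nat

open Ty (nat)

/-- The constants: `0`, `1`, `+`, `×`, the combinators and the recursors. -/
inductive Const : Ty → Type
  | zero : Const nat
  | one : Const nat
  | add : Const (nat ⇒ nat ⇒ nat)
  | mul : Const (nat ⇒ nat ⇒ nat)
  | K (σ τ : Ty) : Const (σ ⇒ τ ⇒ σ)
  | S (ρ σ τ : Ty) : Const ((ρ ⇒ σ ⇒ τ) ⇒ (ρ ⇒ σ) ⇒ ρ ⇒ τ)
  | R (σ : Ty) : Const ((nat ⇒ σ ⇒ σ) ⇒ σ ⇒ nat ⇒ σ)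

/-- Terms. For every type `σ` there are countably many variables `var σ 0, var σ 1, …` . -/
inductive Tm : Ty → Type
  | var (σ : Ty) (n : ℕ) : Tm σ
  | const {σ : Ty} (c : Const σ) : Tm σ
  | app {σ τ : Ty} (f : Tm (σ ⇒ τ)) (t : Tm σ) : Tm τ

infixl:75 " ⬝ " => Tm.app

/-- Formulas of classical many-sorted predicate logic over the relations `=` and `<` of type `0`.
Binding is by de Bruijn indices, counted separately for every type: inside `all σ φ` and `ex σ φ`
the bound variable is `var σ 0`, the variable `var σ (n + 1)` is what was `var σ n` outside, and
variables of the other types are not affected. -/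
inductive Fm : Type
  | eq (s t : Tm nat) : Fm
  | lt (s t : Tm nat) : Fm
  | bot : Fm
  | imp (φ ψ : Fm) : Fm
  | and (φ ψ : Fm) : Fm
  | or (φ ψ : Fm) : Fm
  | all (σ : Ty) (φ : Fm) : Fm
  | ex (σ : Ty) (φ : Fm) : Fm

namespace Fm

def neg (φ : Fm) : Fm := imp φ bot

def iff (φ ψ : Fm) : Fm := and (imp φ ψ) (imp ψ φ)

/-- Quantifier-free formulas (with variables of arbitrary types). -/
def QF : Fm → Prop
  | eq _ _ => True
  | lt _ _ => True
  | bot => True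
  | imp φ ψ => QF φ ∧ QF ψ
  | and φ ψ => QF φ ∧ QF ψ
  | or φ ψ => QF φ ∧ QF ψ
  | all _ _ => False
  | ex _ _ => False

end Fm

/-! ### Renaming and substitution -/

/-- The renaming which makes room for one new variable of type `σ`, at index `0`. -/
def shift (σ : Ty) : Ty → ℕ → ℕ := fun τ n => if τ = σ then n + 1 else n

/-- A renaming carried under a binder of type `σ`. -/
def upRen (σ : Ty) (r : Ty → ℕ → ℕ) : Ty → ℕ → ℕ := fun τ n =>
  if τ = σ then
    match n with
    | 0 => 0
    | m + 1 => r τ m + 1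
  else r τ n

def Tm.rename (r : Ty → ℕ → ℕ) : {σ : Ty} → Tm σ → Tm σ
  | _, .var σ n => .var σ (r σ n)
  | _, .const c => .const c
  | _, .app f t => .app (f.rename r) (t.rename r)

def Tm.subst (s : (σ : Ty) → ℕ → Tm σ) : {σ : Ty} → Tm σ → Tm σ
  | _, .var σ n => s σ n
  | _, .const c => .const c
  | _, .app f t => .app (f.subst s) (t.subst s)

/-- The term `t`, placed under a binder of type `σ`. -/
def Tm.wk (σ : Ty) {τ : Ty} (t : Tm τ) : Tm τ := t.rename (shift σ)

/-- The term `t`, placed under `k` binders of type `0`. -/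
def Tm.lift (k : ℕ) {τ : Ty} (t : Tm τ) : Tm τ :=
  t.rename fun σ n => if σ = nat then n + k else n

/-- A substitution carried under a binder of type `σ`. -/
def upSubst (σ : Ty) (s : (σ : Ty) → ℕ → Tm σ) : (τ : Ty) → ℕ → Tm τ := fun τ n =>
  if τ = σ then
    match n with
    | 0 => .var τ 0
    | m + 1 => (s τ m).wk σ
  else (s τ n).wk σ

/-- The substitution which replaces the outermost variable `var σ 0` by `t` and lowers the other
variables of type `σ`. -/
def single {σ : Ty} (t : Tm σ) : (τ : Ty) → ℕ → Tm τ := fun τ n =>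
  if h : τ = σ then
    match n with
    | 0 => h ▸ t
    | m + 1 => .var τ m
  else .var τ n

namespace Fm

def rename : (Ty → ℕ → ℕ) → Fm → Fm
  | r, eq s t => eq (s.rename r) (t.rename r)
  | r, lt s t => lt (s.rename r) (t.rename r)
  | _, bot => bot
  | r, imp φ ψ => imp (rename r φ) (rename r ψ)
  | r, and φ ψ => and (rename r φ) (rename r ψ)
  | r, or φ ψ => or (rename r φ) (rename r ψ)
  | r, all σ φ => all σ (rename (upRen σ r) φ)
  | r, ex σ φ => ex σ (rename (upRen σ r) φ)

def subst : ((σ : Ty) → ℕ → Tm σ) → Fm → Fm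
  | s, eq t u => eq (t.subst s) (u.subst s)
  | s, lt t u => lt (t.subst s) (u.subst s)
  | _, bot => bot
  | s, imp φ ψ => imp (subst s φ) (subst s ψ)
  | s, and φ ψ => and (subst s φ) (subst s ψ)
  | s, or φ ψ => or (subst s φ) (subst s ψ)
  | s, all σ φ => all σ (subst (upSubst σ s) φ)
  | s, ex σ φ => ex σ (subst (upSubst σ s) φ)

/-- The formula `φ`, placed under a new binder of type `σ`. -/
def wk (σ : Ty) (φ : Fm) : Fm := φ.rename (shift σ)

/-- `φ` with `t` for the variable that a quantifier in front of `φ` would bind. -/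
def inst {σ : Ty} (φ : Fm) (t : Tm σ) : Fm := φ.subst (single t)

end Fm

/-! ### Provability -/

/-- `Prf T Γ φ`: the formula `φ` is derivable from the non-logical axioms `T` and the open
assumptions `Γ`, in classical natural deduction with equality at type `0`. As usual, a formula of
`T` with free variables stands for its universal closure. -/
inductive Prf (T : Set Fm) : List Fm → Fm → Prop
  | ax {Γ : List Fm} {φ : Fm} : φ ∈ T → Prf T Γ φ
  | hyp {Γ : List Fm} {φ : Fm} : φ ∈ Γ → Prf T Γ φ
  | impI {Γ : List Fm} {φ ψ : Fm} : Prf T (φ :: Γ) ψ → Prf T Γ (.imp φ ψ)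
  | impE {Γ : List Fm} {φ ψ : Fm} : Prf T Γ (.imp φ ψ) → Prf T Γ φ → Prf T Γ ψ
  | andI {Γ : List Fm} {φ ψ : Fm} : Prf T Γ φ → Prf T Γ ψ → Prf T Γ (.and φ ψ)
  | andE₁ {Γ : List Fm} {φ ψ : Fm} : Prf T Γ (.and φ ψ) → Prf T Γ φ
  | andE₂ {Γ : List Fm} {φ ψ : Fm} : Prf T Γ (.and φ ψ) → Prf T Γ ψ
  | orI₁ {Γ : List Fm} {φ ψ : Fm} : Prf T Γ φ → Prf T Γ (.or φ ψ)
  | orI₂ {Γ : List Fm} {φ ψ : Fm} : Prf T Γ ψ → Prf T Γ (.or φ ψ)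
  | orE {Γ : List Fm} {φ ψ χ : Fm} :
      Prf T Γ (.or φ ψ) → Prf T (φ :: Γ) χ → Prf T (ψ :: Γ) χ → Prf T Γ χ
  | raa {Γ : List Fm} {φ : Fm} : Prf T (φ.neg :: Γ) .bot → Prf T Γ φ
  | allI {Γ : List Fm} {σ : Ty} {φ : Fm} : Prf T (Γ.map (Fm.wk σ)) φ → Prf T Γ (.all σ φ)
  | allE {Γ : List Fm} {σ : Ty} {φ : Fm} (t : Tm σ) : Prf T Γ (.all σ φ) → Prf T Γ (φ.inst t)
  | exI {Γ : List Fm} {σ : Ty} {φ : Fm} (t : Tm σ) : Prf T Γ (φ.inst t) → Prf T Γ (.ex σ φ)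
  | exE {Γ : List Fm} {σ : Ty} {φ χ : Fm} :
      Prf T Γ (.ex σ φ) → Prf T (φ :: Γ.map (Fm.wk σ)) (χ.wk σ) → Prf T Γ χ
  | eqRefl {Γ : List Fm} (t : Tm nat) : Prf T Γ (.eq t t)
  | eqSubst {Γ : List Fm} {φ : Fm} {s t : Tm nat} :
      Prf T Γ (.eq s t) → Prf T Γ (φ.inst s) → Prf T Γ (φ.inst t)

/-- The system `T` proves `φ`. -/
def Proves (T : Set Fm) (φ : Fm) : Prop := Prf T [] φ

/-! ### Arithmetical terms and defined relations -/

abbrev v (σ : Ty) (n : ℕ) : Tm σ := .var σ n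

def zero : Tm nat := .const .zero

def one : Tm nat := .const .one

def add (s t : Tm nat) : Tm nat := .const .add ⬝ s ⬝ t

def mul (s t : Tm nat) : Tm nat := .const .mul ⬝ s ⬝ t

def num : ℕ → Tm nat
  | 0 => zero
  | n + 1 => add (num n) one

/-- The identity combinator. -/
def idTm (σ : Ty) : Tm (σ ⇒ σ) :=
  .const (.S σ (σ ⇒ σ) σ) ⬝ .const (.K σ (σ ⇒ σ)) ⬝ .const (.K σ σ)

/-- `2 ^ t`, by recursion with the step `(n, p) ↦ p + p`. -/
def twoPow (t : Tm nat) : Tm nat :=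
  .const (.R nat) ⬝
    (.const (.K (nat ⇒ nat) nat) ⬝ (.const (.S nat nat nat) ⬝ .const .add ⬝ idTm nat)) ⬝
    one ⬝ t

def le (s t : Tm nat) : Fm := .or (.lt s t) (.eq s t)

/-- Equality at an arbitrary type, defined from equality at type `0`. -/
def eqAt : (σ : Ty) → Tm σ → Tm σ → Fm
  | .nat, s, t => .eq s t
  | .arr σ τ, s, t => .all σ (eqAt τ (s.wk σ ⬝ v σ 0) (t.wk σ ⬝ v σ 0))

/-! ### The axioms -/

/-- `0, 1, +, ×, <` form an ordered semi-ring: commutative, linearly and discretely ordered, with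
least element `0`. -/
inductive BasicAx : Fm → Prop
  | add_assoc : BasicAx (.eq (add (add (v nat 0) (v nat 1)) (v nat 2))
      (add (v nat 0) (add (v nat 1) (v nat 2))))
  | add_comm : BasicAx (.eq (add (v nat 0) (v nat 1)) (add (v nat 1) (v nat 0)))
  | add_zero : BasicAx (.eq (add (v nat 0) zero) (v nat 0))
  | mul_assoc : BasicAx (.eq (mul (mul (v nat 0) (v nat 1)) (v nat 2))
      (mul (v nat 0) (mul (v nat 1) (v nat 2))))
  | mul_comm : BasicAx (.eq (mul (v nat 0) (v nat 1)) (mul (v nat 1) (v nat 0)))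
  | mul_one : BasicAx (.eq (mul (v nat 0) one) (v nat 0))
  | mul_zero : BasicAx (.eq (mul (v nat 0) zero) zero)
  | mul_add : BasicAx (.eq (mul (v nat 0) (add (v nat 1) (v nat 2)))
      (add (mul (v nat 0) (v nat 1)) (mul (v nat 0) (v nat 2))))
  | lt_irrefl : BasicAx (.neg (.lt (v nat 0) (v nat 0)))
  | lt_trans : BasicAx (.imp (.lt (v nat 0) (v nat 1))
      (.imp (.lt (v nat 1) (v nat 2)) (.lt (v nat 0) (v nat 2))))
  | lt_total : BasicAx (.or (.lt (v nat 0) (v nat 1))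
      (.or (.eq (v nat 0) (v nat 1)) (.lt (v nat 1) (v nat 0))))
  | add_lt_add : BasicAx (.imp (.lt (v nat 0) (v nat 1))
      (.lt (add (v nat 0) (v nat 2)) (add (v nat 1) (v nat 2))))
  | mul_lt_mul : BasicAx (.imp (.lt zero (v nat 2)) (.imp (.lt (v nat 0) (v nat 1))
      (.lt (mul (v nat 0) (v nat 2)) (mul (v nat 1) (v nat 2)))))
  | zero_lt_one : BasicAx (.lt zero one)
  | zero_le : BasicAx (le zero (v nat 0))
  | lt_succ : BasicAx (.imp (.lt (v nat 0) (add (v nat 1) one)) (le (v nat 0) (v nat 1)))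

/-- The defining axioms of the combinators. -/
inductive CombinatorAx : Fm → Prop
  | K (σ τ : Ty) : CombinatorAx (eqAt σ (.const (.K σ τ) ⬝ v σ 0 ⬝ v τ 1) (v σ 0))
  | S (ρ σ τ : Ty) : CombinatorAx
      (eqAt τ (.const (.S ρ σ τ) ⬝ v (ρ ⇒ σ ⇒ τ) 0 ⬝ v (ρ ⇒ σ) 1 ⬝ v ρ 2)
        (v (ρ ⇒ σ ⇒ τ) 0 ⬝ v ρ 2 ⬝ (v (ρ ⇒ σ) 1 ⬝ v ρ 2)))

/-- The defining axioms of the recursor of type `0`: with `f = var (0 → 0 → 0) 0`,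
`m = var 0 0` and `n = var 0 1`. -/
inductive RecursorAx : Fm → Prop
  | zero : RecursorAx
      (.eq (.const (.R nat) ⬝ v (nat ⇒ nat ⇒ nat) 0 ⬝ v nat 0 ⬝ zero) (v nat 0))
  | succ : RecursorAx
      (.eq (.const (.R nat) ⬝ v (nat ⇒ nat ⇒ nat) 0 ⬝ v nat 0 ⬝ add (v nat 1) one)
        (v (nat ⇒ nat ⇒ nat) 0 ⬝ v nat 1 ⬝
          (.const (.R nat) ⬝ v (nat ⇒ nat ⇒ nat) 0 ⬝ v nat 0 ⬝ v nat 1)))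

/-- The axiom of extensionality, at all types. -/
inductive ExtAx : Fm → Prop
  | ext (ρ τ : Ty) : ExtAx (.imp (eqAt ρ (v ρ 0) (v ρ 1))
      (eqAt τ (v (ρ ⇒ τ) 0 ⬝ v ρ 0) (v (ρ ⇒ τ) 0 ⬝ v ρ 1)))

/-- Induction for quantifier-free formulas `A`, in the variable `var 0 0`:
`A(0) ∧ ∀ n (A(n) → A(n + 1)) → ∀ n A(n)`. In the induction step the parameters of `A` are first
moved past the new quantifier. -/
inductive QFInd : Fm → Prop
  | ind (A : Fm) (hA : A.QF) : QFInd
      (.imp (.and (A.inst zero)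
          (.all nat (.imp A ((A.rename (upRen nat (shift nat))).inst (add (v nat 0) one)))))
        (.all nat A))

/-- The quantifier-free axiom of choice for the types `σ, τ`:
`∀ x ∃ y A(x, y) → ∃ Y ∀ x A(x, Y(x))`. On the right, the parameters of `A` are moved past the
quantifier over `Y`, and then `Y(x)` is substituted for `y`. -/
inductive QFAC (σ τ : Ty) : Fm → Prop
  | choice (A : Fm) (hA : A.QF) : QFAC σ τ
      (.imp (.all σ (.ex τ A))
        (.ex (σ ⇒ τ) (.all σ
          ((A.rename (upRen τ (upRen σ (shift (σ ⇒ τ))))).inst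
            (v (σ ⇒ τ) 0 ⬝ v σ 0)))))

/-- The base theory of higher-order Reverse Mathematics. -/
def RCA0omega : Set Fm :=
  {A | BasicAx A ∨ CombinatorAx A ∨ RecursorAx A ∨ ExtAx A ∨ QFInd A ∨ QFAC Ty.one nat A}

/-- The existence of the functional `∃²`: there is `E ≤ 1` of type `2` such that, for all `f` of
type `1`, `∃ n (f(n) = 0)` if and only if `E(f) = 0`. -/
def existsTwo : Fm :=
  .ex Ty.two (.and
    (.all Ty.one (le (v Ty.two 0 ⬝ v Ty.one 0) one))
    (.all Ty.one (.iff
      (.ex nat (.eq (v Ty.one 0 ⬝ v nat 0) zero))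
      (.eq (v Ty.two 0 ⬝ v Ty.one 0) zero))))

def ACA0omega : Set Fm := RCA0omega ∪ {existsTwo}

def QFAC11 : Set Fm := {A | QFAC Ty.one Ty.one A}

/-! ### Rational numbers -/

/-- The fraction `(pos - neg) / den`, as three terms of type `0`. -/
structure Frac where
  pos : Tm nat
  neg : Tm nat
  den : Tm nat

namespace Frac

def lift (k : ℕ) (p : Frac) : Frac := ⟨p.pos.lift k, p.neg.lift k, p.den.lift k⟩

/-- `k / 2 ^ n`. -/
def dyadic (k : ℕ) (n : Tm nat) : Frac := ⟨num k, zero, twoPow n⟩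

def plus (p q : Frac) : Frac :=
  ⟨add (mul p.pos q.den) (mul q.pos p.den), add (mul p.neg q.den) (mul q.neg p.den),
    mul p.den q.den⟩

/-- `p < q`, for fractions with positive denominators. -/
def lt (p q : Frac) : Fm :=
  .lt (add (mul p.pos q.den) (mul q.neg p.den)) (add (mul q.pos p.den) (mul p.neg q.den))

/-- `p ≤ q`, for fractions with positive denominators. -/
def le (p q : Frac) : Fm := .neg (lt q p)

/-- `|p - q| < e` -/
def distLt (p q e : Frac) : Fm := .and (lt p (plus q e)) (lt q (plus p e))

/-- `|p - q| ≤ e` -/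
def distLe (p q e : Frac) : Fm := .and (le p (plus q e)) (le q (plus p e))

end Frac

/-- `c` is the Cantor code of the pair `(s, t)`: `2 c = (s + t) (s + t + 1) + 2 t`. -/
def isPair (c s t : Tm nat) : Fm :=
  .eq (mul (num 2) c) (add (mul (add s t) (add (add s t) one)) (mul (num 2) t))

/-- `c` codes the rational `(p.pos - p.neg) / p.den`, where a code is a pair `(s, t)` which stands
for `(s / 2) / (t + 1)` if `s` is even and for `- ((s + 1) / 2) / (t + 1)` if `s` is odd. -/
def isCode (c : Tm nat) (p : Frac) : Fm :=
  .ex nat (.ex nat (.and (isPair (c.lift 2) (v nat 1) (v nat 0))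
    (.and (.eq (p.den.lift 2) (add (v nat 0) one))
      (.or
        (.and (.eq (v nat 1) (mul (num 2) (p.pos.lift 2))) (.eq (p.neg.lift 2) zero))
        (.and (.eq (add (v nat 1) one) (mul (num 2) (p.neg.lift 2)))
          (.eq (p.pos.lift 2) zero))))))

/-- `F p` holds of the rational `p` with code `c`. The formula `F p` stands under three more
quantifiers of type `0` than `c` does. -/
def withRat (c : Tm nat) (F : Frac → Fm) : Fm :=
  .ex nat (.ex nat (.ex nat
    (.and (isCode (c.lift 3) ⟨v nat 2, v nat 1, v nat 0⟩) (F ⟨v nat 2, v nat 1, v nat 0⟩))))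

/-! ### Real numbers

A real is a term `x` of type `1`, whose value `x(n)` is the code of its `n`-th approximation. -/

/-- `x` is a fast-converging Cauchy sequence: `|x(n) - x(n + i)| < 2 ^ (-n)` for all `n, i`. -/
def isReal (x : Tm Ty.one) : Fm :=
  .all nat (.all nat
    (withRat (x.lift 2 ⬝ v nat 1) fun p =>
      withRat ((x.lift 2 ⬝ add (v nat 1) (v nat 0)).lift 3) fun q =>
        Frac.distLt (p.lift 3) q (.dyadic 1 ((v nat 1).lift 6))))

/-- `x = y`: `|x(n) - y(n)| ≤ 2 ^ (- n + 1)` for all `n`. -/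
def realEq (x y : Tm Ty.one) : Fm :=
  .all nat
    (withRat (x.lift 1 ⬝ v nat 0) fun p =>
      withRat ((y.lift 1 ⬝ v nat 0).lift 3) fun q =>
        Frac.distLe (p.lift 3) q (.dyadic 2 ((v nat 0).lift 6)))

/-- `x < y`: `x(n) + 2 ^ (- n + 1) < y(n)` for some `n`. -/
def realLt (x y : Tm Ty.one) : Fm :=
  .ex nat
    (withRat (x.lift 1 ⬝ v nat 0) fun p =>
      withRat ((y.lift 1 ⬝ v nat 0).lift 3) fun q =>
        Frac.lt (.plus (p.lift 3) (.dyadic 2 ((v nat 0).lift 6))) q)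

def realLe (x y : Tm Ty.one) : Fm := .neg (realLt y x)

/-- `x < y + z`: `x(n) + 3 · 2 ^ (-n) < y(n) + z(n)` for some `n` (each of the three approximations
is off by at most `2 ^ (-n)`). -/
def realLtAdd (x y z : Tm Ty.one) : Fm :=
  .ex nat
    (withRat (x.lift 1 ⬝ v nat 0) fun p =>
      withRat ((y.lift 1 ⬝ v nat 0).lift 3) fun q =>
        withRat ((z.lift 1 ⬝ v nat 0).lift 6) fun r =>
          Frac.lt (.plus (p.lift 6) (.dyadic 3 ((v nat 0).lift 9))) (.plus (q.lift 3) r))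

/-- The constant sequence with value the rational with code `k`. -/
def constReal (k : ℕ) : Tm Ty.one := .const (.K nat nat) ⬝ num k

/-- The real `0`; the pair `(0, 0)` has code `0`. -/
def zeroReal : Tm Ty.one := constReal 0

/-- The real `1`; the pair `(2, 0)` has code `3`. -/
def oneReal : Tm Ty.one := constReal 3

/-- `x ∈ I`, where `I = [0,1]`. -/
def inUnit (x : Tm Ty.one) : Fm :=
  .and (isReal x) (.and (realLe zeroReal x) (realLe x oneReal))

/-- `(∀ x ∈ I) φ`, where `x` is the variable `var 1 0` of `φ`. -/
def allUnit (φ : Fm) : Fm := .all Ty.one (.imp (inUnit (v Ty.one 0)) φ)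

/-- `(∃ x ∈ I) φ`, where `x` is the variable `var 1 0` of `φ`. -/
def exUnit (φ : Fm) : Fm := .ex Ty.one (.and (inUnit (v Ty.one 0)) φ)

/-! ### Covers of the unit interval -/

/-- The type `1 → 1` of functions from reals to reals. -/
abbrev Ty.fn : Ty := Ty.one ⇒ Ty.one

/-- The term `t`, placed under `k` binders of type `1`. -/
def up (k : ℕ) {τ : Ty} (t : Tm τ) : Tm τ :=
  t.rename fun σ n => if σ = Ty.one then n + k else n

/-- `f` is a function from `I` to `ℝ`: it maps elements of `I` to reals, and equal ones to equal
ones. -/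
def isFun (f : Tm Ty.fn) : Fm :=
  .and
    (allUnit (isReal (up 1 f ⬝ v Ty.one 0)))
    (allUnit (allUnit (.imp (realEq (v Ty.one 1) (v Ty.one 0))
      (realEq (up 2 f ⬝ v Ty.one 1) (up 2 f ⬝ v Ty.one 0)))))

/-- `z` is in the open interval `(c - r, c + r)`. -/
def inBall (z c r : Tm Ty.one) : Fm := .and (realLtAdd c z r) (realLtAdd z c r)

/-- `z` is in the interval `I_y^f = (y - f(y), y + f(y))`, which may be empty. -/
def inIvl (f : Tm Ty.fn) (y z : Tm Ty.one) : Fm := inBall z y (f ⬝ y)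

/-- The intervals `I_y^f`, for `y ∈ I`, cover `I`: `(∀ x ∈ I)(∃ y ∈ I)(x ∈ I_y^f)`. -/
def covers (f : Tm Ty.fn) : Fm :=
  allUnit (exUnit (inIvl (up 2 f) (v Ty.one 0) (v Ty.one 1)))

/-- `g` is a refinement of `f`: `(∀ x ∈ I)(∃ y ∈ I)(I_x^g ⊆ I_y^f)`. -/
def refines (g f : Tm Ty.fn) : Fm :=
  allUnit (exUnit (.all Ty.one (.imp (isReal (v Ty.one 0))
    (.imp (inIvl (up 3 g) (v Ty.one 2) (v Ty.one 0))
      (inIvl (up 3 f) (v Ty.one 1) (v Ty.one 0))))))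

/-- `φ` holds for some finite sequence `Y(0), …, Y(k - 1)` in `I`, where `k = var 0 0` and
`Y = var (0 → 1) 0` in `φ`. -/
def exFinSeq (φ : Fm) : Fm :=
  .ex nat (.ex (nat ⇒ Ty.one) (.and
    (.all nat (.imp (.lt (v nat 0) (v nat 1)) (inUnit (v (nat ⇒ Ty.one) 0 ⬝ v nat 0))))
    φ))

/-- The collection of the sets `I_y^f ∩ I`, for `y ∈ I`, of subsets of `I` is locally finite: for
every `x ∈ I` there are a real `e > 0` and `Y(0), …, Y(k - 1) ∈ I` such that, for all `y ∈ I`, if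
the set `I_y^f` meets the neighbourhood `(x - e, x + e)` of `x` in `I`, then it is, as a subset of
`I`, one of the sets `I_{Y(i)}^f`. -/
def locallyFinite (f : Tm Ty.fn) : Fm :=
  -- the variables of type 1, outermost first: `x`, `e`, `y`, `z`
  allUnit (.ex Ty.one (.and (.and (isReal (v Ty.one 0)) (realLt zeroReal (v Ty.one 0)))
    (exFinSeq (allUnit (.imp
      (exUnit (.and
        (inBall (v Ty.one 0) (v Ty.one 3) (v Ty.one 2))
        (inIvl ((up 4 f).lift 1 |>.wk (nat ⇒ Ty.one)) (v Ty.one 1) (v Ty.one 0))))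
      (.ex nat (.and (.lt (v nat 0) (v nat 1))
        (allUnit (.iff
          (inIvl ((up 4 f).lift 2 |>.wk (nat ⇒ Ty.one)) (v Ty.one 1) (v Ty.one 0))
          (inIvl ((up 4 f).lift 2 |>.wk (nat ⇒ Ty.one))
            (v (nat ⇒ Ty.one) 0 ⬝ v nat 0) (v Ty.one 0)))))))))))

/-- `[0,1]` is paracompact: for every `f : I → ℝ` whose intervals cover `I` there is `g : I → ℝ`
which is a refinement of `f`, whose intervals cover `I`, and which is locally finite. -/
def paracompactUnit : Fm :=
  .all Ty.fn (.imp (isFun (v Ty.fn 0)) (.imp (covers (v Ty.fn 0))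
    (.ex Ty.fn (.and (isFun (v Ty.fn 0)) (.and (refines (v Ty.fn 0) (v Ty.fn 1))
      (.and (covers (v Ty.fn 0)) (locallyFinite (v Ty.fn 0))))))))

/-- The Heine-Borel theorem for uncountable covers: for every `f : I → ℝ` whose intervals cover `I`
there are `Y(0), …, Y(k - 1) ∈ I` such that `(∀ x ∈ I)(∃ i < k)(x ∈ I_{Y(i)}^f)`. -/
def HBT : Fm :=
  .all Ty.fn (.imp (isFun (v Ty.fn 0)) (.imp (covers (v Ty.fn 0))
    (exFinSeq (allUnit (.ex nat (.and (.lt (v nat 0) (v nat 1))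
      (inIvl (v Ty.fn 0) (v (nat ⇒ Ty.one) 0 ⬝ v nat 0) (v Ty.one 0))))))))

end HORM

/-!
The proof is semantic: by the completeness theorem for the calculus, with respect to extensional
structures in which equality of type `0` is true equality (`prf_of_forall_sat`, by Henkin's
construction), it suffices to show that every structure `I` which satisfies the axioms satisfies the
Heine-Borel theorem. The objects of type `0` of `I` may be nonstandard, so all inductions and choices
in `I` are restricted to conditions which are represented by objects of `I`. Since `∃²` is among the
axioms, these are all conditions which are built from equations between applicative terms by the
connectives and by quantifiers of type `0`. The class `Interp.Dec` of these conditions is closed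
under these operations by instance search, and `Interp.induction` and `Interp.choice_one_one` are
induction and choice for them.

The argument in `I` is that a locally finite cover of `[0, 1]` by intervals has a Lebesgue number
(`exists_lebesgue`): for some `m`, any two adjacent points of the grid of the `i / 2 ^ m` are in a
common interval. Otherwise there is for every `m` a cell without this property. By choice there are
an interval which contains the left end point of the cell, and an interval which contains the right
endpoint of this first interval; so each of the two has an endpoint in the cell, and these endpoints
are different (`exists_near_endpoints`). Hence close to a cluster point `x` of the cells, which
arithmetical comprehension provides, there are different endpoints at arbitrarily small distances.
But the endpoints in `[0, 1]` of a nonempty interval can be read off its trace on `[0, 1]`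
(`endpoint_near`), so that, by local finiteness, only finitely many endpoints occur near `x`, and
finitely many reals have a minimal positive distance (`exists_uniform_gap`).

Given a Lebesgue number `2 ^ (-m)` of a locally finite refinement of a cover, choosing for every
cell an interval of the original cover which contains both of its end points gives a finite subcover
(`exists_finite_subcover`), as intervals are convex.

The reals of `I` are compared in an ordered field `R` with a map `lim` from the reals of `I`
(`exists_isLimitMap`); this `R` is non-archimedean over `I`, and the order of the reals of `I` is the
order of `R` up to differences which are smaller than all `2 ^ (-n)` with `n` in `I`.
-/

namespace HORM

open Ty (nat)

/-! ### Simultaneous substitution -/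

/-- The simultaneous substitutions: a term of type `σ` for each variable of type `σ`. -/
abbrev Sub : Type := (σ : Ty) → ℕ → Tm σ

/-- The substitution which replaces `var σ 0` by `t` and the remaining variables as `s` does, after
lowering those of type `σ`. -/
def Sub.cons {σ : Ty} (t : Tm σ) (s : Sub) : Sub := fun τ n =>
  if h : τ = σ then
    match n with
    | 0 => h ▸ t
    | m + 1 => s τ m
  else s τ n

@[simp] theorem Sub.cons_zero {σ : Ty} (t : Tm σ) (s : Sub) : Sub.cons t s σ 0 = t := by
  simp [Sub.cons]

@[simp] theorem Sub.cons_succ {σ : Ty} (t : Tm σ) (s : Sub) (n : ℕ) :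
    Sub.cons t s σ (n + 1) = s σ n := by
  simp [Sub.cons]

theorem Sub.cons_of_ne {σ τ : Ty} (h : τ ≠ σ) (t : Tm σ) (s : Sub) (n : ℕ) :
    Sub.cons t s τ n = s τ n := by
  simp [Sub.cons, h]

@[simp] theorem upSubst_zero (σ : Ty) (s : Sub) : upSubst σ s σ 0 = .var σ 0 := by
  simp [upSubst]

@[simp] theorem upSubst_succ (σ : Ty) (s : Sub) (n : ℕ) :
    upSubst σ s σ (n + 1) = (s σ n).wk σ := by
  simp [upSubst]

theorem upSubst_of_ne {σ τ : Ty} (h : τ ≠ σ) (s : Sub) (n : ℕ) :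
    upSubst σ s τ n = (s τ n).wk σ := by
  simp [upSubst, h]

@[simp] theorem shift_self (σ : Ty) (n : ℕ) : shift σ σ n = n + 1 := by simp [shift]

theorem shift_of_ne {σ τ : Ty} (h : τ ≠ σ) (n : ℕ) : shift σ τ n = n := by simp [shift, h]

theorem Tm.rename_eq_subst (r : Ty → ℕ → ℕ) {σ : Ty} (t : Tm σ) :
    t.rename r = t.subst fun τ n => .var τ (r τ n) := by
  induction t with
  | var => rfl
  | const => rfl
  | app f t hf ht => simp [rename, subst, hf, ht]

theorem Tm.subst_subst {σ : Ty} (t : Tm σ) (s s' : Sub) :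
    (t.subst s).subst s' = t.subst fun τ n => (s τ n).subst s' := by
  induction t with
  | var => rfl
  | const => rfl
  | app f t hf ht => simp [subst, hf, ht]

@[simp] theorem Tm.subst_var {σ : Ty} (t : Tm σ) : t.subst Tm.var = t := by
  induction t with
  | var => rfl
  | const => rfl
  | app f t hf ht => simp [subst, hf, ht]

theorem Tm.wk_subst_upSubst {σ τ : Ty} (t : Tm τ) (s : Sub) :
    (t.wk σ).subst (upSubst σ s) = (t.subst s).wk σ := by
  simp only [wk, rename_eq_subst, subst_subst]
  congr 1
  funext τ n
  by_cases h : τ = σ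
  · subst h; simp [subst, wk, rename_eq_subst]
  · simp [subst, shift_of_ne h, upSubst_of_ne h, wk, rename_eq_subst]

theorem Tm.wk_subst_cons {σ τ : Ty} (t : Tm τ) (u : Tm σ) (s : Sub) :
    (t.wk σ).subst (Sub.cons u s) = t.subst s := by
  simp only [wk, rename_eq_subst, subst_subst]
  congr 1
  funext τ n
  by_cases h : τ = σ
  · subst h; simp [subst]
  · simp [subst, shift_of_ne h, Sub.cons_of_ne h]

theorem upSubst_comp (σ : Ty) (s s' : Sub) :
    (fun τ n => (upSubst σ s τ n).subst (upSubst σ s')) =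
      upSubst σ fun τ n => (s τ n).subst s' := by
  funext τ n
  by_cases h : τ = σ
  · subst h
    cases n with
    | zero => simp [Tm.subst]
    | succ n => simp [Tm.wk_subst_upSubst]
  · simp [upSubst_of_ne h, Tm.wk_subst_upSubst]

theorem upSubst_comp_cons {σ : Ty} (t : Tm σ) (s s' : Sub) :
    (fun τ n => (upSubst σ s τ n).subst (Sub.cons t s')) =
      Sub.cons t fun τ n => (s τ n).subst s' := by
  funext τ n
  by_cases h : τ = σ
  · subst h
    cases n with
    | zero => simp [Tm.subst]
    | succ n => simp [Tm.wk_subst_cons]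
  · simp [upSubst_of_ne h, Sub.cons_of_ne h, Tm.wk_subst_cons]

@[simp] theorem upSubst_var (σ : Ty) : upSubst σ Tm.var = Tm.var := by
  funext τ n
  by_cases h : τ = σ
  · subst h
    cases n <;> simp [Tm.wk, Tm.rename]
  · simp [upSubst_of_ne h, Tm.wk, Tm.rename, shift_of_ne h]

theorem upRen_eq_upSubst (σ : Ty) (r : Ty → ℕ → ℕ) :
    (fun τ n => Tm.var τ (upRen σ r τ n)) = upSubst σ fun τ n => .var τ (r τ n) := by
  funext τ n
  by_cases h : τ = σ
  · subst h
    cases n <;> simp [upRen, Tm.wk, Tm.rename]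
  · simp [upRen, upSubst_of_ne h, h, Tm.wk, Tm.rename, shift_of_ne h]

namespace Fm

theorem rename_eq_subst (r : Ty → ℕ → ℕ) (φ : Fm) :
    φ.rename r = φ.subst fun τ n => .var τ (r τ n) := by
  induction φ generalizing r with
  | eq | lt => simp [rename, subst, Tm.rename_eq_subst]
  | bot => rfl
  | imp _ _ h h' | and _ _ h h' | or _ _ h h' => simp [rename, subst, h, h']
  | all σ _ h | ex σ _ h => simp [rename, subst, h, upRen_eq_upSubst]

theorem subst_subst (φ : Fm) (s s' : Sub) :
    (φ.subst s).subst s' = φ.subst fun τ n => (s τ n).subst s' := by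
  induction φ generalizing s s' with
  | eq | lt => simp [subst, Tm.subst_subst]
  | bot => rfl
  | imp _ _ h h' | and _ _ h h' | or _ _ h h' => simp [subst, h, h']
  | all σ _ h | ex σ _ h => simp [subst, h, upSubst_comp]

@[simp] theorem subst_var (φ : Fm) : φ.subst Tm.var = φ := by
  induction φ with
  | eq | lt => simp [subst]
  | bot => rfl
  | imp _ _ h h' | and _ _ h h' | or _ _ h h' => simp [subst, h, h']
  | all σ _ h | ex σ _ h => simp [subst, h]

theorem wk_eq_subst (σ : Ty) (φ : Fm) :
    φ.wk σ = φ.subst fun τ n => (Tm.var τ n).wk σ :=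
  rename_eq_subst _ _

theorem inst_eq_subst {σ : Ty} (φ : Fm) (t : Tm σ) : φ.inst t = φ.subst (Sub.cons t Tm.var) :=
  rfl

theorem subst_upSubst_inst {σ : Ty} (φ : Fm) (s : Sub) (t : Tm σ) :
    (φ.subst (upSubst σ s)).inst t = φ.subst (Sub.cons t s) := by
  rw [inst_eq_subst, subst_subst, upSubst_comp_cons]
  simp

theorem inst_subst {σ : Ty} (φ : Fm) (s : Sub) (t : Tm σ) :
    (φ.inst t).subst s = (φ.subst (upSubst σ s)).inst (t.subst s) := by
  rw [subst_upSubst_inst, inst_eq_subst, subst_subst]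
  congr 1
  funext τ n
  by_cases h : τ = σ
  · subst h
    cases n <;> simp [Tm.subst]
  · simp [Sub.cons_of_ne h, Tm.subst]

theorem wk_subst_upSubst (σ : Ty) (φ : Fm) (s : Sub) :
    (φ.wk σ).subst (upSubst σ s) = (φ.subst s).wk σ := by
  simp only [wk_eq_subst, subst_subst, Tm.wk_subst_upSubst, Tm.subst]
  congr 1
  funext τ n
  rw [Tm.wk, Tm.rename_eq_subst]
  rfl

end Fm

theorem eqAt_subst (σ : Ty) (t u : Tm σ) (s : Sub) :
    (eqAt σ t u).subst s = eqAt σ (t.subst s) (u.subst s) := by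
  induction σ generalizing s with
  | nat => rfl
  | arr σ τ _ h => simp [eqAt, Fm.subst, h, Tm.subst, Tm.wk_subst_upSubst]

/-! ### Finiteness of the set of free variables -/

/-- The variables outside the finite set `F` do not occur freely in `φ`; this is expressed through
the effect of substitutions on `φ`. -/
def Fm.SupportedBy (φ : Fm) (F : Finset (Ty × ℕ)) : Prop :=
  ∀ s s' : Sub, (∀ p ∈ F, s p.1 p.2 = s' p.1 p.2) → φ.subst s = φ.subst s'

theorem Tm.exists_support {σ : Ty} (t : Tm σ) : ∃ F : Finset (Ty × ℕ),
    ∀ s s' : Sub, (∀ p ∈ F, s p.1 p.2 = s' p.1 p.2) → t.subst s = t.subst s' := by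
  classical
  induction t with
  | var σ n => exact ⟨{(σ, n)}, fun s s' h => h (σ, n) (by simp)⟩
  | const => exact ⟨∅, fun _ _ _ => rfl⟩
  | app f t hf ht =>
    obtain ⟨F, hF⟩ := hf
    obtain ⟨G, hG⟩ := ht
    refine ⟨F ∪ G, fun s s' h => ?_⟩
    simp only [subst]
    rw [hF s s' fun p hp => h p (by simp [hp]), hG s s' fun p hp => h p (by simp [hp])]

theorem Fm.SupportedBy.mono {φ : Fm} {F G : Finset (Ty × ℕ)} (h : φ.SupportedBy F)
    (hFG : F ⊆ G) : φ.SupportedBy G :=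
  fun s s' hs => h s s' fun p hp => hs p (hFG hp)

/-- Only finitely many variables occur freely under a binder if only finitely many occur freely in
its scope. -/
theorem Fm.exists_support_upSubst (σ : Ty) {φ : Fm} {F : Finset (Ty × ℕ)}
    (hF : φ.SupportedBy F) : ∃ G : Finset (Ty × ℕ), ∀ s s' : Sub,
      (∀ p ∈ G, s p.1 p.2 = s' p.1 p.2) → φ.subst (upSubst σ s) = φ.subst (upSubst σ s') := by
  classical
  refine ⟨F ∪ F.image fun p => (p.1, p.2 - 1), fun s s' h => hF _ _ ?_⟩
  rintro ⟨τ, n⟩ hp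
  by_cases hτ : τ = σ
  · subst hτ
    cases n with
    | zero => simp
    | succ n =>
      have := h (τ, n) (Finset.mem_union_right _ (Finset.mem_image.2 ⟨_, hp, rfl⟩))
      simp_all
  · have := h (τ, n) (Finset.mem_union_left _ hp)
    simp_all [upSubst_of_ne hτ]

theorem Fm.exists_support (φ : Fm) : ∃ F, φ.SupportedBy F := by
  classical
  induction φ with
  | eq t u | lt t u =>
    obtain ⟨F, hF⟩ := t.exists_support
    obtain ⟨G, hG⟩ := u.exists_support
    refine ⟨F ∪ G, fun s s' h => ?_⟩
    simp only [subst]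
    rw [hF s s' fun p hp => h p (by simp [hp]), hG s s' fun p hp => h p (by simp [hp])]
  | bot => exact ⟨∅, fun _ _ _ => rfl⟩
  | imp φ ψ hf ht | and φ ψ hf ht | or φ ψ hf ht =>
    obtain ⟨F, hF⟩ := hf
    obtain ⟨G, hG⟩ := ht
    refine ⟨F ∪ G, fun s s' h => ?_⟩
    simp only [subst]
    rw [hF s s' fun p hp => h p (by simp [hp]), hG s s' fun p hp => h p (by simp [hp])]
  | all σ φ h | ex σ φ h =>
    obtain ⟨F, hF⟩ := h
    obtain ⟨G, hG⟩ := exists_support_upSubst σ hF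
    exact ⟨G, fun s s' h => by simp only [subst]; rw [hG s s' h]⟩

/-! ### Structural properties of the calculus -/

namespace Prf

variable {T : Set Fm}

theorem weaken {Γ Δ : List Fm} {φ : Fm} (h : Prf T Γ φ) (hΓ : Γ ⊆ Δ) : Prf T Δ φ := by
  induction h generalizing Δ with
  | ax h => exact .ax h
  | hyp h => exact .hyp (hΓ h)
  | impI _ ih => exact .impI (ih (List.cons_subset_cons _ hΓ))
  | impE _ _ ih ih' => exact .impE (ih hΓ) (ih' hΓ)
  | andI _ _ ih ih' => exact .andI (ih hΓ) (ih' hΓ)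
  | andE₁ _ ih => exact .andE₁ (ih hΓ)
  | andE₂ _ ih => exact .andE₂ (ih hΓ)
  | orI₁ _ ih => exact .orI₁ (ih hΓ)
  | orI₂ _ ih => exact .orI₂ (ih hΓ)
  | orE _ _ _ ih ih₁ ih₂ =>
    exact .orE (ih hΓ) (ih₁ (List.cons_subset_cons _ hΓ)) (ih₂ (List.cons_subset_cons _ hΓ))
  | raa _ ih => exact .raa (ih (List.cons_subset_cons _ hΓ))
  | allI _ ih => exact .allI (ih (List.map_subset _ hΓ))
  | allE t _ ih => exact .allE t (ih hΓ)
  | exI t _ ih => exact .exI t (ih hΓ)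
  | exE _ _ ih ih' =>
    exact .exE (ih hΓ) (ih' (List.cons_subset_cons _ (List.map_subset _ hΓ)))
  | eqRefl t => exact .eqRefl t
  | eqSubst _ _ ih ih' => exact .eqSubst (ih hΓ) (ih' hΓ)

/-- The substitution which replaces the first variables by the terms on a list. -/
def consList : List (Σ σ : Ty, Tm σ) → Sub
  | [] => Tm.var
  | p :: L => Sub.cons p.2 (consList L)

theorem consList_range_append (s : Sub) (σ : Ty) (k : ℕ) (L : List (Σ σ : Ty, Tm σ)) (τ : Ty)
    (n : ℕ) :
    consList ((List.range k).map (fun i => ⟨σ, s σ i⟩) ++ L) τ n =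
      if τ = σ then (if n < k then s τ n else consList L τ (n - k)) else consList L τ n := by
  induction k generalizing L with
  | zero => simp
  | succ k ih =>
    rw [List.range_succ, List.map_append, List.append_assoc, ih]
    by_cases h : τ = σ
    · subst h
      rcases lt_trichotomy n k with hn | rfl | hn
      · simp [hn, hn.trans (Nat.lt_succ_self k)]
      · simp [consList]
      · obtain ⟨m, rfl⟩ := Nat.exists_eq_add_of_lt hn
        have h1 : k + m + 1 - k = m + 1 := by omega
        have h2 : k + m + 1 - (k + 1) = m := by omega
        have h3 : ¬ k + m + 1 < k := by omega
        have h4 : ¬ k + m + 1 < k + 1 := by omega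
        simp [consList, h1, h2, h3]
    · simp [h, consList, Sub.cons_of_ne h]

/-- Every substitution agrees with a finite iteration of `Sub.cons` on finitely many variables. -/
theorem exists_consList (s : Sub) (F : Finset (Ty × ℕ)) :
    ∃ L, ∀ p ∈ F, consList L p.1 p.2 = s p.1 p.2 := by
  classical
  obtain ⟨k, hk⟩ : ∃ k, ∀ p ∈ F, p.2 < k :=
    ⟨F.sup Prod.snd + 1, fun p hp => Nat.lt_succ_of_le (Finset.le_sup (f := Prod.snd) hp)⟩
  have key : ∀ l : List Ty, ∃ L, ∀ σ ∈ l, ∀ n < k, consList L σ n = s σ n := by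
    intro l
    induction l with
    | nil => exact ⟨[], by simp⟩
    | cons σ l ih =>
      obtain ⟨L, hL⟩ := ih
      refine ⟨(List.range k).map (fun i => ⟨σ, s σ i⟩) ++ L, fun τ hτ n hn => ?_⟩
      rw [consList_range_append]
      by_cases h : τ = σ
      · simp [h, hn]
      · simp only [h, if_false]
        exact hL τ (by simpa [h] using hτ) n hn
  obtain ⟨L, hL⟩ := key (F.image Prod.fst).toList
  refine ⟨L, fun p hp => hL _ ?_ _ (hk p hp)⟩
  rw [Finset.mem_toList]
  exact Finset.mem_image_of_mem Prod.fst hp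

/-- A formula which is derivable from every list of assumptions has this property for all its
substitution instances: quantify over the variables one by one, and instantiate. -/
theorem subst_of_forall {φ : Fm} (h : ∀ Γ, Prf T Γ φ) (s : Sub) (Γ : List Fm) :
    Prf T Γ (φ.subst s) := by
  obtain ⟨F, hF⟩ := φ.exists_support
  obtain ⟨L, hL⟩ := exists_consList s F
  rw [← hF _ _ hL]
  clear hL hF
  induction L generalizing φ Γ with
  | nil => simpa [consList] using h Γ
  | cons p L ih =>
    have h' := ih (φ := .all p.1 φ) (fun Γ => .allI (h _)) Γ
    have h'' := Prf.allE p.2 h'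
    rwa [Fm.subst_upSubst_inst] at h''

theorem map_wk_subst (σ : Ty) (Γ : List Fm) (s : Sub) :
    (Γ.map (Fm.wk σ)).map (Fm.subst (upSubst σ s)) = (Γ.map (Fm.subst s)).map (Fm.wk σ) := by
  simp [Fm.wk_subst_upSubst]

theorem subst {Γ : List Fm} {φ : Fm} (h : Prf T Γ φ) (s : Sub) :
    Prf T (Γ.map (Fm.subst s)) (φ.subst s) := by
  induction h generalizing s with
  | ax h => exact subst_of_forall (fun _ => .ax h) s _
  | hyp h => exact .hyp (List.mem_map_of_mem h)
  | impI _ ih => exact .impI (ih s)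
  | impE _ _ ih ih' => exact .impE (ih s) (ih' s)
  | andI _ _ ih ih' => exact .andI (ih s) (ih' s)
  | andE₁ _ ih => exact .andE₁ (ih s)
  | andE₂ _ ih => exact .andE₂ (ih s)
  | orI₁ _ ih => exact .orI₁ (ih s)
  | orI₂ _ ih => exact .orI₂ (ih s)
  | orE _ _ _ ih ih₁ ih₂ => exact .orE (ih s) (ih₁ s) (ih₂ s)
  | raa _ ih => exact .raa (ih s)
  | @allI _ σ _ _ ih =>
    have := ih (upSubst σ s)
    rw [map_wk_subst] at this
    exact .allI this
  | allE t _ ih =>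
    rw [Fm.inst_subst]
    exact .allE _ (ih s)
  | exI t _ ih =>
    have := ih s
    rw [Fm.inst_subst] at this
    exact .exI _ this
  | @exE _ σ _ _ _ _ ih ih' =>
    have := ih' (upSubst σ s)
    rw [List.map_cons, map_wk_subst, Fm.wk_subst_upSubst] at this
    exact .exE (ih s) this
  | eqRefl t => exact .eqRefl _
  | eqSubst _ _ ih ih' =>
    have := ih' s
    rw [Fm.inst_subst] at this ⊢
    exact .eqSubst (ih s) this

end Prf

/-! ### Countability of the language -/

/-- An injective numbering of the types. -/
def Ty.code : Ty → ℕ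
  | .nat => 0
  | .arr σ τ => Nat.pair σ.code τ.code + 1

theorem Ty.code_injective : Function.Injective Ty.code := by
  intro σ
  induction σ with
  | nat => rintro (_ | _) h <;> simp_all [code]
  | arr σ τ h h' =>
    rintro (_ | ⟨σ', τ'⟩) hc
    · simp [code] at hc
    · simp only [code, Nat.add_right_cancel_iff, Nat.pair_eq_pair] at hc
      rw [h hc.1, h' hc.2]

/-- An injective numbering of the constants of every type. -/
def Const.code {σ : Ty} : Const σ → ℕ
  | .zero => 0
  | .one => 1
  | .add => 2
  | .mul => 3
  | .K _ _ => 4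
  | .S _ _ _ => 5
  | .R _ => 6

theorem Const.code_injective {σ : Ty} : Function.Injective (Const.code (σ := σ)) := by
  intro c c' h
  cases c <;> cases c' <;> first | rfl | simp [code] at h

/-- An injective numbering of the terms of every type. -/
def Tm.code {σ : Ty} : Tm σ → ℕ
  | .var _ n => Nat.pair 0 n
  | .const c => Nat.pair 1 c.code
  | .app (σ := σ) f t => Nat.pair 2 (Nat.pair σ.code (Nat.pair f.code t.code))

theorem Tm.code_injective {σ : Ty} : Function.Injective (Tm.code (σ := σ)) := by
  intro t
  induction t with
  | var σ n => intro u h; cases u <;> simp_all [code, Nat.pair_eq_pair]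
  | const c =>
    intro u h
    cases u with
    | var => simp [code, Nat.pair_eq_pair] at h
    | const c' =>
      simp only [code, Nat.pair_eq_pair, true_and] at h
      rw [Const.code_injective h]
    | app => simp [code, Nat.pair_eq_pair] at h
  | app f t hf ht =>
    intro u h
    cases u with
    | var => simp [code, Nat.pair_eq_pair] at h
    | const => simp [code, Nat.pair_eq_pair] at h
    | app f' t' =>
      simp only [code, Nat.pair_eq_pair, true_and] at h
      obtain ⟨h, h', h''⟩ := h
      obtain rfl := Ty.code_injective h
      rw [hf h', ht h'']

/-- An injective numbering of the formulas. -/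
def Fm.code : Fm → ℕ
  | .eq s t => Nat.pair 0 (Nat.pair s.code t.code)
  | .lt s t => Nat.pair 1 (Nat.pair s.code t.code)
  | .bot => Nat.pair 2 0
  | .imp φ ψ => Nat.pair 3 (Nat.pair φ.code ψ.code)
  | .and φ ψ => Nat.pair 4 (Nat.pair φ.code ψ.code)
  | .or φ ψ => Nat.pair 5 (Nat.pair φ.code ψ.code)
  | .all σ φ => Nat.pair 6 (Nat.pair σ.code φ.code)
  | .ex σ φ => Nat.pair 7 (Nat.pair σ.code φ.code)

theorem Fm.code_injective : Function.Injective Fm.code := by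
  intro φ
  induction φ with
  | eq s t | lt s t =>
    intro ψ h
    cases ψ <;> simp_all [code, Nat.pair_eq_pair, Tm.code_injective.eq_iff]
  | bot => intro ψ h; cases ψ <;> simp_all [code, Nat.pair_eq_pair]
  | imp φ φ' hφ hφ' | and φ φ' hφ hφ' | or φ φ' hφ hφ' =>
    intro ψ h
    cases ψ <;> simp only [code, Nat.pair_eq_pair] at h <;> simp at h
    rw [hφ h.1, hφ' h.2]
  | all σ φ hφ | ex σ φ hφ =>
    intro ψ h
    cases ψ <;> simp only [code, Nat.pair_eq_pair] at h <;> simp at h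
    rw [hφ h.2, Ty.code_injective h.1]

instance : Countable Fm := Fm.code_injective.countable

instance : Nonempty Fm := ⟨.bot⟩

/-! ### Henkin sets -/

/-- A list of assumptions is consistent with `T` if no contradiction follows from it. -/
def Consistent (T : Set Fm) (Γ : List Fm) : Prop := ¬ Prf T Γ .bot

namespace Prf

variable {T : Set Fm}

theorem exfalso {Γ : List Fm} {φ : Fm} (h : Prf T Γ .bot) : Prf T Γ φ :=
  .raa (h.weaken (List.subset_cons_self _ _))

theorem negE {Γ : List Fm} {φ : Fm} (h : Prf T Γ φ.neg) (h' : Prf T Γ φ) : Prf T Γ .bot :=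
  .impE h h'

/-- A witness of an existential assumption may be taken to be a variable which does not occur
elsewhere. -/
theorem of_fresh_witness {Γ : List Fm} {σ : Ty} {φ : Fm} {N : ℕ} {F : Finset (Ty × ℕ)}
    (hΓ : ∀ ψ ∈ Γ, ψ.SupportedBy F) (hφ : (Fm.ex σ φ).SupportedBy F) (hN : (σ, N) ∉ F)
    (hex : Fm.ex σ φ ∈ Γ) (h : Prf T (φ.inst (.var σ N) :: Γ) .bot) : Prf T Γ .bot := by
  -- the substitution which moves the fresh variable to the place of the bound one
  let s : Sub := fun τ n => if τ = σ ∧ n = N then .var τ 0 else (Tm.var τ n).wk σ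
  have hs : ∀ p ∈ F, s p.1 p.2 = (Tm.var p.1 p.2).wk σ := by
    rintro ⟨τ, n⟩ hp
    have : ¬ (τ = σ ∧ n = N) := by rintro ⟨rfl, rfl⟩; exact hN hp
    simp [s, this]
  have h1 := h.subst s
  have h2 : Γ.map (Fm.subst s) = Γ.map (Fm.wk σ) := by
    refine List.map_congr_left fun ψ hψ => ?_
    rw [hΓ ψ hψ s (fun τ n => (Tm.var τ n).wk σ) hs, Fm.wk_eq_subst]
  have h3 : (φ.inst (.var σ N)).subst s = φ := by
    have := hφ s (fun τ n => (Tm.var τ n).wk σ) hs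
    simp only [Fm.subst, Fm.ex.injEq, true_and] at this
    rw [Fm.inst_subst, this]
    have hv : (Tm.var σ N).subst s = .var σ 0 := by simp [Tm.subst, s]
    rw [hv, Fm.subst_upSubst_inst]
    conv_rhs => rw [← Fm.subst_var φ]
    congr 1
    funext τ n
    by_cases hτ : τ = σ
    · subst hτ
      cases n <;> simp [Tm.wk, Tm.rename]
    · simp [Sub.cons_of_ne hτ, Tm.wk, Tm.rename, shift_of_ne hτ]
  rw [List.map_cons, h2, h3] at h1
  exact .exE (.hyp hex) h1

end Prf

/-- A maximal consistent set of formulas in which every existential formula has a witness. -/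
structure IsHenkin (T : Set Fm) (Δ : Set Fm) : Prop where
  consistent : ∀ Γ : List Fm, (∀ φ ∈ Γ, φ ∈ Δ) → Consistent T Γ
  mem_or_neg_mem : ∀ φ : Fm, φ ∈ Δ ∨ φ.neg ∈ Δ
  witness : ∀ σ φ, Fm.ex σ φ ∈ Δ → ∃ t : Tm σ, φ.inst t ∈ Δ

theorem Consistent.cons_or_cons_neg {T : Set Fm} {Γ : List Fm} (h : Consistent T Γ) (φ : Fm) :
    Consistent T (φ :: Γ) ∨ Consistent T (φ.neg :: Γ) := by
  by_contra! h'
  simp only [Consistent, not_not] at h'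
  exact h (.impE (.impI h'.1) (.raa h'.2))

theorem exists_forall_supportedBy (Γ : List Fm) : ∃ F, ∀ φ ∈ Γ, φ.SupportedBy F := by
  classical
  induction Γ with
  | nil => exact ⟨∅, by simp⟩
  | cons φ Γ ih =>
    obtain ⟨F, hF⟩ := ih
    obtain ⟨G, hG⟩ := φ.exists_support
    refine ⟨F ∪ G, fun ψ hψ => ?_⟩
    rcases List.mem_cons.1 hψ with rfl | hψ
    · exact hG.mono Finset.subset_union_right
    · exact (hF ψ hψ).mono Finset.subset_union_left

/-- One step of the construction of a Henkin set: a formula is decided, with a witness in case it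
is existential. -/
theorem Consistent.exists_step {T : Set Fm} {Γ : List Fm} (h : Consistent T Γ) (φ : Fm) :
    ∃ Δ, Consistent T Δ ∧ Γ ⊆ Δ ∧ (φ ∈ Δ ∨ φ.neg ∈ Δ) ∧
      ∀ σ ψ, φ = .ex σ ψ → φ ∈ Δ → ∃ t : Tm σ, ψ.inst t ∈ Δ := by
  classical
  by_cases hex : ∃ σ ψ, φ = .ex σ ψ ∧ Consistent T (φ :: Γ)
  · obtain ⟨σ, ψ, rfl, hc⟩ := hex
    obtain ⟨F, hF⟩ := exists_forall_supportedBy (.ex σ ψ :: Γ)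
    obtain ⟨N, hN⟩ : ∃ N, (σ, N) ∉ F :=
      ⟨F.sup Prod.snd + 1, fun hp => by
        have := Finset.le_sup (f := Prod.snd) hp
        exact absurd this (Nat.not_succ_le_self _)⟩
    refine ⟨ψ.inst (.var σ N) :: .ex σ ψ :: Γ, fun h' => hc ?_, ?_, ?_, ?_⟩
    · exact h'.of_fresh_witness hF (hF _ (by simp)) hN (by simp)
    · intro χ hχ; simp [hχ]
    · simp
    · rintro σ' ψ' h -
      cases h
      exact ⟨.var σ N, by simp⟩
  · push Not at hex
    rcases h.cons_or_cons_neg φ with hc | hc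
    · refine ⟨φ :: Γ, hc, List.subset_cons_self _ _, by simp, fun σ ψ h => ?_⟩
      exact absurd hc (hex σ ψ h)
    · refine ⟨φ.neg :: Γ, hc, List.subset_cons_self _ _, by simp, fun σ ψ h hm => ?_⟩
      -- a list which contains `φ` and its negation is inconsistent
      exact absurd (.negE (.hyp (by simp)) (.hyp hm)) hc

/-- Every consistent list of formulas is contained in a Henkin set. -/
theorem Consistent.exists_isHenkin {T : Set Fm} {Γ : List Fm} (h : Consistent T Γ) :
    ∃ Δ, IsHenkin T Δ ∧ ∀ φ ∈ Γ, φ ∈ Δ := by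
  obtain ⟨e, he⟩ := exists_surjective_nat Fm
  choose step hstep using fun (Γ : {Γ : List Fm // Consistent T Γ}) (φ : Fm) =>
    Γ.2.exists_step φ
  let seq : ℕ → {Γ : List Fm // Consistent T Γ} := fun n =>
    Nat.rec ⟨Γ, h⟩ (fun n Γ => ⟨step Γ (e n), (hstep Γ (e n)).1⟩) n
  have hmono : Monotone fun n => {φ | φ ∈ (seq n).1} :=
    monotone_nat_of_le_succ fun n φ hφ => (hstep (seq n) (e n)).2.1 hφ
  refine ⟨{φ | ∃ n, φ ∈ (seq n).1}, ⟨?_, ?_, ?_⟩, fun φ hφ => ⟨0, hφ⟩⟩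
  · intro Γ' hΓ'
    obtain ⟨n, hn⟩ : ∃ n, ∀ φ ∈ Γ', φ ∈ (seq n).1 := by
      induction Γ' with
      | nil => exact ⟨0, by simp⟩
      | cons φ Γ' ih =>
        obtain ⟨n, hn⟩ := ih fun ψ hψ => hΓ' ψ (by simp [hψ])
        obtain ⟨m, hm⟩ := hΓ' φ (by simp)
        refine ⟨max n m, fun ψ hψ => ?_⟩
        rcases List.mem_cons.1 hψ with rfl | hψ
        · exact hmono (le_max_right n m) hm
        · exact hmono (le_max_left n m) (hn ψ hψ)
    exact fun h' => (seq n).2 (h'.weaken hn)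
  · intro φ
    obtain ⟨n, rfl⟩ := he φ
    rcases (hstep (seq n) (e n)).2.2.1 with h' | h'
    · exact .inl ⟨n + 1, h'⟩
    · exact .inr ⟨n + 1, h'⟩
  · rintro σ φ ⟨m, hm⟩
    obtain ⟨n, hn⟩ := he (.ex σ φ)
    have hmem : e n ∈ (seq (n + 1)).1 := by
      rcases (hstep (seq n) (e n)).2.2.1 with h' | h'
      · exact h'
      · exfalso
        have h1 := hmono (le_max_left m (n + 1)) hm
        have h2 : (e n).neg ∈ (seq (max m (n + 1))).1 := hmono (le_max_right m (n + 1)) h'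
        rw [hn] at h2
        exact (seq (max m (n + 1))).2 (.impE (.hyp h2) (.hyp h1))
    obtain ⟨t, ht⟩ := (hstep (seq n) (e n)).2.2.2 σ φ hn hmem
    exact ⟨t, n + 1, ht⟩

namespace IsHenkin

variable {T Δ : Set Fm} (H : IsHenkin T Δ)

include H

theorem mem_of_prf {Γ : List Fm} {φ : Fm} (h : Prf T Γ φ) (hΓ : ∀ ψ ∈ Γ, ψ ∈ Δ) : φ ∈ Δ := by
  rcases H.mem_or_neg_mem φ with h' | h'
  · exact h'
  · refine absurd ?_ (H.consistent (φ.neg :: Γ) ?_)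
    · exact .impE (.hyp (List.mem_cons_self ..)) (h.weaken (List.subset_cons_self _ _))
    · simpa [h'] using hΓ

theorem bot_notMem : Fm.bot ∉ Δ := fun h =>
  H.consistent [.bot] (by simpa using h) (.hyp (by simp))

theorem neg_mem_iff {φ : Fm} : φ.neg ∈ Δ ↔ φ ∉ Δ := by
  refine ⟨fun h h' => H.bot_notMem ?_, (H.mem_or_neg_mem φ).resolve_left⟩
  exact H.mem_of_prf (Γ := [φ.neg, φ]) (.negE (φ := φ) (.hyp (by simp)) (.hyp (by simp)))
    (by simp [h, h'])

theorem imp_mem_iff {φ ψ : Fm} : Fm.imp φ ψ ∈ Δ ↔ (φ ∈ Δ → ψ ∈ Δ) := by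
  refine ⟨fun h h' => ?_, fun h => ?_⟩
  · exact H.mem_of_prf (Γ := [.imp φ ψ, φ]) (.impE (φ := φ) (.hyp (by simp)) (.hyp (by simp)))
      (by simp [h, h'])
  · by_cases hφ : φ ∈ Δ
    · exact H.mem_of_prf (Γ := [ψ]) (.impI (.hyp (by simp))) (by simpa using h hφ)
    · refine H.mem_of_prf (Γ := [φ.neg]) (.impI (.exfalso ?_)) (by simpa using H.neg_mem_iff.2 hφ)
      exact .negE (φ := φ) (.hyp (by simp)) (.hyp (by simp))

theorem and_mem_iff {φ ψ : Fm} : Fm.and φ ψ ∈ Δ ↔ φ ∈ Δ ∧ ψ ∈ Δ := by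
  refine ⟨fun h => ⟨?_, ?_⟩, fun h => ?_⟩
  · exact H.mem_of_prf (Γ := [.and φ ψ]) (.andE₁ (ψ := ψ) (.hyp (by simp))) (by simpa using h)
  · exact H.mem_of_prf (Γ := [.and φ ψ]) (.andE₂ (φ := φ) (.hyp (by simp))) (by simpa using h)
  · exact H.mem_of_prf (Γ := [φ, ψ]) (.andI (.hyp (by simp)) (.hyp (by simp))) (by simpa using h)

theorem or_mem_iff {φ ψ : Fm} : Fm.or φ ψ ∈ Δ ↔ φ ∈ Δ ∨ ψ ∈ Δ := by
  refine ⟨fun h => ?_, fun h => ?_⟩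
  · by_contra! h'
    refine H.bot_notMem (H.mem_of_prf (Γ := [.or φ ψ, φ.neg, ψ.neg]) (.orE (φ := φ) (ψ := ψ)
      (.hyp (by simp)) (.negE (φ := φ) (.hyp ?_) (.hyp ?_))
      (.negE (φ := ψ) (.hyp ?_) (.hyp ?_))) ?_) <;>
    simp [h, H.neg_mem_iff, h']
  · rcases h with h | h
    · exact H.mem_of_prf (Γ := [φ]) (.orI₁ (.hyp (by simp))) (by simpa using h)
    · exact H.mem_of_prf (Γ := [ψ]) (.orI₂ (.hyp (by simp))) (by simpa using h)

theorem ex_mem_iff {σ : Ty} {φ : Fm} : Fm.ex σ φ ∈ Δ ↔ ∃ t : Tm σ, φ.inst t ∈ Δ := by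
  refine ⟨H.witness σ φ, fun ⟨t, h⟩ => ?_⟩
  exact H.mem_of_prf (Γ := [φ.inst t]) (.exI t (.hyp (by simp))) (by simpa using h)

theorem all_mem_iff {σ : Ty} {φ : Fm} : Fm.all σ φ ∈ Δ ↔ ∀ t : Tm σ, φ.inst t ∈ Δ := by
  refine ⟨fun h t => ?_, fun h => ?_⟩
  · exact H.mem_of_prf (Γ := [.all σ φ]) (.allE t (.hyp (by simp))) (by simpa using h)
  · by_contra h'
    have h1 : Prf T [(Fm.all σ φ).neg] (.ex σ φ.neg) := by
      refine .raa (.negE (φ := .all σ φ) (.hyp (by simp)) (.allI (.raa ?_)))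
      refine .impE (φ := (Fm.ex σ φ.neg).wk σ) (.hyp (by simp [Fm.neg, Fm.wk, Fm.rename])) ?_
      refine .exI (.var σ 0) (.hyp ?_)
      have : (φ.neg.rename (upRen σ (shift σ))).inst (.var σ 0) = φ.neg := by
        rw [Fm.rename_eq_subst, upRen_eq_upSubst, Fm.subst_upSubst_inst]
        conv_rhs => rw [← Fm.subst_var φ.neg]
        congr 1
        funext τ n
        by_cases hτ : τ = σ
        · subst hτ
          cases n <;> simp
        · simp [Sub.cons_of_ne hτ, shift_of_ne hτ]
      rw [this]
      simp
    obtain ⟨t, ht⟩ := H.witness σ _ (H.mem_of_prf h1 (by simpa using H.neg_mem_iff.2 h'))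
    exact H.neg_mem_iff.1 ht (h t)

theorem ax_subst_mem {φ : Fm} (h : φ ∈ T) (s : Sub) : φ.subst s ∈ Δ :=
  H.mem_of_prf (Γ := []) (Prf.subst_of_forall (fun _ => .ax h) s []) (by simp)

theorem eq_refl_mem (t : Tm nat) : Fm.eq t t ∈ Δ :=
  H.mem_of_prf (Γ := []) (.eqRefl t) (by simp)

theorem inst_mem_of_eq_mem {φ : Fm} {t u : Tm nat} (h : Fm.eq t u ∈ Δ) (h' : φ.inst t ∈ Δ) :
    φ.inst u ∈ Δ :=
  H.mem_of_prf (Γ := [.eq t u, φ.inst t]) (.eqSubst (s := t) (.hyp (by simp)) (.hyp (by simp)))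
    (by simp [h, h'])

end IsHenkin

/-! ### Extensional structures -/

/-- An extensional structure for the language, in which equality of type `0` is true equality. -/
structure Interp where
  /-- The objects of type `σ`. -/
  M : Ty → Type
  /-- Application. -/
  app : {σ τ : Ty} → M (σ ⇒ τ) → M σ → M τ
  /-- The interpretation of the constants. -/
  const : {σ : Ty} → Const σ → M σ
  /-- The order of the objects of type `0`. -/
  lt : M nat → M nat → Prop
  ext : ∀ {σ τ : Ty} {f g : M (σ ⇒ τ)}, (∀ x, app f x = app g x) → f = g

namespace Interp

variable (I : Interp)

/-- The valuations of the variables. -/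
abbrev Env : Type := (σ : Ty) → ℕ → I.M σ

variable {I}

/-- The valuation with `a` for `var σ 0`, and with `ρ` for what the remaining variables denote
outside a binder of type `σ`. -/
def push {σ : Ty} (a : I.M σ) (ρ : I.Env) : I.Env := fun τ n =>
  if h : τ = σ then
    match n with
    | 0 => h ▸ a
    | m + 1 => ρ τ m
  else ρ τ n

@[simp] theorem push_zero {σ : Ty} (a : I.M σ) (ρ : I.Env) : push a ρ σ 0 = a := by simp [push]

@[simp] theorem push_succ {σ : Ty} (a : I.M σ) (ρ : I.Env) (n : ℕ) :
    push a ρ σ (n + 1) = ρ σ n := by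
  simp [push]

@[simp] theorem push_one {σ : Ty} (a : I.M σ) (ρ : I.Env) : push a ρ σ 1 = ρ σ 0 := push_succ a ρ 0

theorem push_of_ne {σ τ : Ty} (h : τ ≠ σ) (a : I.M σ) (ρ : I.Env) (n : ℕ) :
    push a ρ τ n = ρ τ n := by
  simp [push, h]

/-- The value of a term. -/
def eval (ρ : I.Env) : {σ : Ty} → Tm σ → I.M σ
  | _, .var σ n => ρ σ n
  | _, .const c => I.const c
  | _, .app f t => I.app (eval ρ f) (eval ρ t)

/-- Truth of a formula. -/
def Sat : I.Env → Fm → Prop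
  | ρ, .eq s t => eval ρ s = eval ρ t
  | ρ, .lt s t => I.lt (eval ρ s) (eval ρ t)
  | _, .bot => False
  | ρ, .imp φ ψ => Sat ρ φ → Sat ρ ψ
  | ρ, .and φ ψ => Sat ρ φ ∧ Sat ρ ψ
  | ρ, .or φ ψ => Sat ρ φ ∨ Sat ρ ψ
  | ρ, .all σ φ => ∀ a : I.M σ, Sat (push a ρ) φ
  | ρ, .ex σ φ => ∃ a : I.M σ, Sat (push a ρ) φ

end Interp

/-! ### The completeness theorem -/

namespace IsHenkin

variable {T Δ : Set Fm}

/-- Extensional equality of terms, according to a set `Δ` of formulas. -/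
def Rel (Δ : Set Fm) : (σ : Ty) → Tm σ → Tm σ → Prop
  | .nat, t, u => Fm.eq t u ∈ Δ
  | .arr σ τ, t, u => ∀ x : Tm σ, Rel Δ τ (t ⬝ x) (u ⬝ x)

variable (H : IsHenkin T Δ)

include H

theorem eqAt_mem_iff {σ : Ty} {t u : Tm σ} : eqAt σ t u ∈ Δ ↔ Rel Δ σ t u := by
  induction σ with
  | nat => rfl
  | arr σ τ _ ih =>
    rw [eqAt, H.all_mem_iff]
    refine forall_congr' fun x => ?_
    rw [Fm.inst_eq_subst, eqAt_subst, ← ih]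
    simp [Tm.subst, Tm.wk_subst_cons]

theorem eq_symm_mem {t u : Tm nat} (h : Fm.eq t u ∈ Δ) : Fm.eq u t ∈ Δ := by
  have := H.inst_mem_of_eq_mem (φ := .eq (.var nat 0) (t.wk nat)) h
  simp only [Fm.inst_eq_subst, Fm.subst, Tm.subst, Sub.cons_zero, Tm.wk_subst_cons,
    Tm.subst_var] at this
  exact this (H.eq_refl_mem t)

theorem eq_trans_mem {t u w : Tm nat} (h : Fm.eq t u ∈ Δ) (h' : Fm.eq u w ∈ Δ) :
    Fm.eq t w ∈ Δ := by
  have := H.inst_mem_of_eq_mem (φ := .eq (t.wk nat) (.var nat 0)) h'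
  simp only [Fm.inst_eq_subst, Fm.subst, Tm.subst, Sub.cons_zero, Tm.wk_subst_cons,
    Tm.subst_var] at this
  exact this h

theorem lt_mem_congr {t t' u u' : Tm nat} (h : Fm.eq t t' ∈ Δ) (h' : Fm.eq u u' ∈ Δ)
    (hlt : Fm.lt t u ∈ Δ) : Fm.lt t' u' ∈ Δ := by
  have h1 := H.inst_mem_of_eq_mem (φ := .lt (.var nat 0) (u.wk nat)) h
  have h2 := H.inst_mem_of_eq_mem (φ := .lt (t'.wk nat) (.var nat 0)) h'
  simp only [Fm.inst_eq_subst, Fm.subst, Tm.subst, Sub.cons_zero, Tm.wk_subst_cons,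
    Tm.subst_var] at h1 h2
  exact h2 (h1 hlt)

theorem rel_equivalence (σ : Ty) : Equivalence (Rel Δ σ) := by
  induction σ with
  | nat => exact ⟨H.eq_refl_mem, H.eq_symm_mem, H.eq_trans_mem⟩
  | arr σ τ _ ih =>
    exact ⟨fun t x => ih.refl _, fun h x => ih.symm (h x), fun h h' x => ih.trans (h x) (h' x)⟩

theorem rel_app (hT : ∀ A, ExtAx A → A ∈ T) {σ τ : Ty} {f g : Tm (σ ⇒ τ)} {t u : Tm σ}
    (h : Rel Δ (σ ⇒ τ) f g) (h' : Rel Δ σ t u) : Rel Δ τ (f ⬝ t) (g ⬝ u) := by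
  refine (H.rel_equivalence τ).trans (h t) ?_
  have hax := H.ax_subst_mem (hT _ (.ext σ τ)) (Sub.cons t (Sub.cons u (Sub.cons g Tm.var)))
  have h1 : σ ⇒ τ ≠ σ := fun h => by
    have := congrArg sizeOf h
    simp at this
    omega
  have hg : Sub.cons t (Sub.cons u (Sub.cons g Tm.var)) (σ ⇒ τ) 0 = g := by
    rw [Sub.cons_of_ne h1, Sub.cons_of_ne h1, Sub.cons_zero]
  have hu : Sub.cons t (Sub.cons u (Sub.cons g Tm.var)) σ 1 = u := by
    rw [Sub.cons_succ, Sub.cons_zero]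
  simp only [Fm.subst, eqAt_subst, Tm.subst, Sub.cons_zero, hg, hu] at hax
  exact H.eqAt_mem_iff.1 (H.imp_mem_iff.1 hax (H.eqAt_mem_iff.2 h'))

/-- The terms modulo extensional equality. -/
def termSetoid (σ : Ty) : Setoid (Tm σ) := ⟨Rel Δ σ, H.rel_equivalence σ⟩

/-- The term model of a Henkin set. -/
def termModel (hT : ∀ A, ExtAx A → A ∈ T) : Interp where
  M σ := Quotient (H.termSetoid σ)
  app := Quotient.map₂ Tm.app fun _ _ h _ _ h' => H.rel_app hT h h'
  const c := Quotient.mk _ (.const c)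
  lt := Quotient.lift₂ (fun t u => Fm.lt t u ∈ Δ) fun _ _ _ _ h h' =>
    propext ⟨H.lt_mem_congr h h', H.lt_mem_congr (H.eq_symm_mem h) (H.eq_symm_mem h')⟩
  ext {σ τ f g} h := by
    induction f, g using Quotient.inductionOn₂ with | _ f g
    exact Quotient.sound fun x => Quotient.exact (h (Quotient.mk _ x))

variable {hT : ∀ A, ExtAx A → A ∈ T}

/-- The valuation in the term model which is given by a substitution. -/
def envOf (s : Sub) : (H.termModel hT).Env := fun σ n => Quotient.mk (H.termSetoid σ) (s σ n)

theorem exists_eq_envOf (ρ : (H.termModel hT).Env) : ∃ s, ρ = H.envOf s :=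
  ⟨fun σ n => (ρ σ n).out, by funext σ n; exact (Quotient.out_eq _).symm⟩

theorem push_envOf {σ : Ty} (t : Tm σ) (s : Sub) :
    Interp.push (I := H.termModel hT) (Quotient.mk (H.termSetoid σ) t) (H.envOf s) =
      H.envOf (Sub.cons t s) := by
  funext τ n
  by_cases h : τ = σ
  · subst h
    cases n with
    | zero =>
      rw [envOf, Sub.cons_zero]
      exact Interp.push_zero _ _
    | succ n =>
      rw [envOf, Sub.cons_succ]
      exact Interp.push_succ _ _ _
  · rw [envOf, Sub.cons_of_ne h]
    exact Interp.push_of_ne h _ _ _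

theorem eval_envOf (s : Sub) {σ : Ty} (t : Tm σ) :
    Interp.eval (I := H.termModel hT) (H.envOf s) t =
      Quotient.mk (H.termSetoid σ) (t.subst s) := by
  induction t with
  | var | const => rfl
  | app f t hf ht => rw [Interp.eval, hf, ht]; rfl

/-- In the term model of a Henkin set precisely its members are true. -/
theorem sat_envOf_iff (φ : Fm) (s : Sub) :
    Interp.Sat (I := H.termModel hT) (H.envOf s) φ ↔ φ.subst s ∈ Δ := by
  induction φ generalizing s with
  | eq t u =>
    simp only [Interp.Sat, eval_envOf]
    exact ⟨fun h => Quotient.exact h, fun h => Quotient.sound h⟩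
  | lt t u => simp only [Interp.Sat, eval_envOf]; rfl
  | bot => exact ⟨False.elim, H.bot_notMem⟩
  | imp φ ψ h h' => simp [Interp.Sat, Fm.subst, H.imp_mem_iff, h, h']
  | and φ ψ h h' => simp [Interp.Sat, Fm.subst, H.and_mem_iff, h, h']
  | or φ ψ h h' => simp [Interp.Sat, Fm.subst, H.or_mem_iff, h, h']
  | all σ φ h =>
    simp only [Interp.Sat, Fm.subst, H.all_mem_iff, Fm.subst_upSubst_inst, ← h, ← push_envOf]
    exact ⟨fun h t => h _, fun h a => Quotient.inductionOn a h⟩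
  | ex σ φ h =>
    simp only [Interp.Sat, Fm.subst, H.ex_mem_iff, Fm.subst_upSubst_inst, ← h, ← push_envOf]
    exact ⟨fun ⟨a, h⟩ => by induction a using Quotient.inductionOn; exact ⟨_, h⟩,
      fun ⟨t, h⟩ => ⟨_, h⟩⟩

end IsHenkin

/-- Completeness: what holds in all extensional models of a theory with the axiom of extensionality
is provable in it. -/
theorem prf_of_forall_sat {T : Set Fm} (hT : ∀ A, ExtAx A → A ∈ T) {φ : Fm}
    (h : ∀ I : Interp, (∀ A ∈ T, ∀ ρ : I.Env, I.Sat ρ A) → ∀ ρ : I.Env, I.Sat ρ φ) :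
    Prf T [] φ := by
  by_contra hφ
  have hc : Consistent T [φ.neg] := fun h' => hφ (.raa h')
  obtain ⟨Δ, H, hΔ⟩ := hc.exists_isHenkin
  have hsat := h (H.termModel hT) (fun A hA ρ => by
    obtain ⟨s, rfl⟩ := H.exists_eq_envOf ρ
    exact (H.sat_envOf_iff A s).2 (H.ax_subst_mem hA s)) (H.envOf Tm.var)
  rw [H.sat_envOf_iff, Fm.subst_var] at hsat
  exact H.neg_mem_iff.1 (hΔ _ (by simp)) hsat

/-! ### The axioms in a structure -/

namespace Interp

variable {I : Interp}

instance {σ τ : Ty} : CoeFun (I.M (σ ⇒ τ)) fun _ => I.M σ → I.M τ := ⟨I.app⟩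

instance : Zero (I.M nat) := ⟨I.const .zero⟩

instance : One (I.M nat) := ⟨I.const .one⟩

instance : Add (I.M nat) := ⟨fun a b => I.app (I.app (I.const .add) a) b⟩

instance : Mul (I.M nat) := ⟨fun a b => I.app (I.app (I.const .mul) a) b⟩

instance : LT (I.M nat) := ⟨I.lt⟩

theorem zero_def : I.const .zero = 0 := rfl

theorem one_def : I.const .one = 1 := rfl

theorem add_def (a b : I.M nat) : I.app (I.app (I.const .add) a) b = a + b := rfl

theorem mul_def (a b : I.M nat) : I.app (I.app (I.const .mul) a) b = a * b := rfl

variable (I)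

/-- The axioms of `ACA0omega` and `QFAC11`, with quantifier-free formulas represented by objects of
the structure. -/
class IsACA : Prop where
  add_assoc (a b c : I.M nat) : a + b + c = a + (b + c)
  add_comm (a b : I.M nat) : a + b = b + a
  add_zero (a : I.M nat) : a + 0 = a
  mul_assoc (a b c : I.M nat) : a * b * c = a * (b * c)
  mul_comm (a b : I.M nat) : a * b = b * a
  mul_one (a : I.M nat) : a * 1 = a
  mul_zero (a : I.M nat) : a * 0 = 0
  mul_add (a b c : I.M nat) : a * (b + c) = a * b + a * c
  lt_irrefl (a : I.M nat) : ¬ a < a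
  lt_trans (a b c : I.M nat) : a < b → b < c → a < c
  lt_total (a b : I.M nat) : a < b ∨ a = b ∨ b < a
  add_lt_add (a b c : I.M nat) : a < b → a + c < b + c
  mul_lt_mul (a b c : I.M nat) : 0 < c → a < b → a * c < b * c
  zero_lt_one : (0 : I.M nat) < 1
  zero_le (a : I.M nat) : 0 < a ∨ 0 = a
  lt_succ (a b : I.M nat) : a < b + 1 → a < b ∨ a = b
  K_app {σ τ : Ty} (a : I.M σ) (b : I.M τ) : I.const (.K σ τ) a b = a
  S_app {ρ σ τ : Ty} (f : I.M (ρ ⇒ σ ⇒ τ)) (g : I.M (ρ ⇒ σ)) (a : I.M ρ) :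
    I.const (.S ρ σ τ) f g a = f a (g a)
  R_zero (f : I.M (nat ⇒ nat ⇒ nat)) (a : I.M nat) : I.const (.R nat) f a 0 = a
  R_succ (f : I.M (nat ⇒ nat ⇒ nat)) (a n : I.M nat) :
    I.const (.R nat) f a (n + 1) = f n (I.const (.R nat) f a n)
  ind (f : I.M (nat ⇒ nat)) : f 0 = 0 → (∀ n, f n = 0 → f (n + 1) = 0) → ∀ n, f n = 0
  choice (f : I.M (Ty.one ⇒ Ty.one ⇒ nat)) : (∀ x, ∃ y, f x y = 0) →
    ∃ g : I.M (Ty.one ⇒ Ty.one), ∀ x, f x (g x) = 0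
  /-- Equality of type `0` has a characteristic function. -/
  eqChar : ∃ g : I.M (Ty.one ⇒ Ty.one), ∀ x, g x 0 = 0 ↔ x 0 = x 1
  /-- The order of type `0` has a characteristic function. -/
  ltChar : ∃ g : I.M (Ty.one ⇒ Ty.one), ∀ x, g x 0 = 0 ↔ x 0 < x 1
  existsTwo : ∃ e : I.M Ty.two, ∀ f, (∃ n, f n = 0) ↔ e f = 0

variable {I}

/-- The valuation `ρ`, modified so that `var σ n` has the value `a`. -/
def upd (ρ : I.Env) (σ : Ty) (n : ℕ) (a : I.M σ) : I.Env := fun τ m =>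
  if h : τ = σ then (if m = n then h ▸ a else ρ τ m) else ρ τ m

@[simp] theorem upd_self (ρ : I.Env) (σ : Ty) (n : ℕ) (a : I.M σ) : upd ρ σ n a σ n = a := by
  simp [upd]

theorem upd_of_ne (ρ : I.Env) {σ τ : Ty} {n m : ℕ} (h : m ≠ n) (a : I.M σ) :
    upd ρ σ n a τ m = ρ τ m := by
  simp [upd, h]

theorem eval_rename (r : Ty → ℕ → ℕ) (ρ : I.Env) {σ : Ty} (t : Tm σ) :
    eval ρ (t.rename r) = eval (fun τ n => ρ τ (r τ n)) t := by
  induction t with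
  | var | const => rfl
  | app f t hf ht => simp [Tm.rename, eval, hf, ht]

@[simp] theorem eval_wk {σ τ : Ty} (a : I.M σ) (ρ : I.Env) (t : Tm τ) :
    eval (push a ρ) (t.wk σ) = eval ρ t := by
  rw [Tm.wk, eval_rename]
  congr 1
  funext τ n
  by_cases h : τ = σ
  · subst h; simp
  · simp [shift_of_ne h, push_of_ne h]

@[simp] theorem sat_eqAt {σ : Ty} (ρ : I.Env) (t u : Tm σ) :
    Sat ρ (eqAt σ t u) ↔ eval ρ t = eval ρ u := by
  induction σ generalizing ρ with
  | nat => rfl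
  | arr σ τ _ ih =>
    simp only [eqAt, Sat, ih, eval, eval_wk, push_zero]
    exact ⟨I.ext, fun h a => by rw [h]⟩

/-- A model of the axioms satisfies their semantic versions. -/
theorem isACA_of_sat {T : Set Fm} (hT : ACA0omega ∪ QFAC11 ⊆ T)
    (h : ∀ A ∈ T, ∀ ρ : I.Env, I.Sat ρ A) (ρ : I.Env) : I.IsACA := by
  have hR : ∀ A ∈ RCA0omega, ∀ ρ : I.Env, I.Sat ρ A := fun A hA => h A (hT (.inl (.inl hA)))
  have basic : ∀ A, BasicAx A → ∀ a b c : I.M nat, I.Sat (push a (push b (push c ρ))) A :=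
    fun A hA _ _ _ => hR A (.inl hA) _
  have comb : ∀ A, CombinatorAx A → ∀ ρ, I.Sat ρ A := fun A hA => hR A (.inr (.inl hA))
  have recu : ∀ A, RecursorAx A → ∀ ρ, I.Sat ρ A := fun A hA => hR A (.inr (.inr (.inl hA)))
  have K_app : ∀ {σ τ : Ty} (a : I.M σ) (b : I.M τ), I.const (.K σ τ) a b = a := by
    intro σ τ a b
    have := comb _ (.K σ τ) (upd (upd ρ τ 1 b) σ 0 a)
    simpa [eval, upd_of_ne] using this
  have h01 : (1 : I.M nat) ≠ 0 := by
    intro h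
    have h1 : (0 : I.M nat) < 1 := basic _ .zero_lt_one 0 0 0
    rw [h] at h1
    exact basic _ .lt_irrefl 0 0 0 h1
  -- a set of objects of type 1 which is given by a quantifier-free formula has a characteristic
  -- functional, by the axiom of choice
  have char : ∀ P : Fm, P.QF → (∀ x : I.M Ty.one, ∃ y : I.M Ty.one,
      Sat (push y (push x ρ)) (.iff (.eq (v Ty.one 0 ⬝ zero) zero) P)) →
      Sat ρ (.ex (Ty.one ⇒ Ty.one) (.all Ty.one
          (((Fm.iff (.eq (v Ty.one 0 ⬝ zero) zero) P).rename
              (upRen Ty.one (upRen Ty.one (shift (Ty.one ⇒ Ty.one))))).inst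
            (v (Ty.one ⇒ Ty.one) 0 ⬝ v Ty.one 0)))) := fun P hP hP' =>
    h _ (hT (.inr (.choice _ (by simp [Fm.QF, Fm.iff, hP])))) ρ hP'
  have hchar : ∀ p : Prop, ∃ y : I.M Ty.one, y 0 = 0 ↔ p := by
    intro p
    by_cases hp : p
    · exact ⟨I.const (.K nat nat) 0, by simp [K_app, hp]⟩
    · exact ⟨I.const (.K nat nat) 1, by simp [K_app, hp, h01]⟩
  have indu : ∀ A, QFInd A → ∀ ρ, I.Sat ρ A :=
    fun A hA => hR A (.inr (.inr (.inr (.inr (.inl hA)))))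
  exact
  { add_assoc := basic _ .add_assoc
    add_comm := fun a b => basic _ .add_comm a b b
    add_zero := fun a => basic _ .add_zero a a a
    mul_assoc := basic _ .mul_assoc
    mul_comm := fun a b => basic _ .mul_comm a b b
    mul_one := fun a => basic _ .mul_one a a a
    mul_zero := fun a => basic _ .mul_zero a a a
    mul_add := basic _ .mul_add
    lt_irrefl := fun a => basic _ .lt_irrefl a a a
    lt_trans := fun a b c => basic _ .lt_trans a b c
    lt_total := fun a b => basic _ .lt_total a b b
    add_lt_add := fun a b c => basic _ .add_lt_add a b c
    mul_lt_mul := fun a b c => basic _ .mul_lt_mul a b c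
    zero_lt_one := basic _ .zero_lt_one 0 0 0
    zero_le := fun a => basic _ .zero_le a a a
    lt_succ := fun a b => basic _ .lt_succ a b b
    K_app := K_app
    S_app := fun {ρ' σ τ} f g a => by
      have := comb _ (.S ρ' σ τ)
        (upd (upd (upd ρ ρ' 2 a) (ρ' ⇒ σ) 1 g) (ρ' ⇒ σ ⇒ τ) 0 f)
      simpa [eval, upd_of_ne] using this
    R_zero := fun f a => by
      have := recu _ .zero (push a (push f ρ))
      simp [Sat, eval, push_of_ne, zero] at this
      exact this
    R_succ := fun f a n => by
      have := recu _ .succ (push a (push n (push f ρ)))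
      simp [Sat, eval, push_of_ne, add, one] at this
      exact this
    ind := fun f h0 hs => by
      have := indu _ (.ind (.eq (v Ty.one 0 ⬝ v nat 0) zero) trivial) (push f ρ)
      simp [Sat, eval, push_of_ne, add, one, zero, Fm.inst, Fm.rename, Fm.subst, Tm.rename,
        Tm.subst, upRen, shift, single] at this
      exact this h0 hs
    choice := fun f hf => by
      have := h _ (hT (.inr (.choice
        (.eq (v (Ty.one ⇒ Ty.one ⇒ nat) 0 ⬝ v Ty.one 1 ⬝ v Ty.one 0) zero) trivial))) (push f ρ)
      simp [Sat, eval, push_of_ne, zero, Fm.inst, Fm.rename, Fm.subst, Tm.rename,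
        Tm.subst, upRen, shift, single] at this
      exact this hf
    eqChar := by
      obtain ⟨g, hg⟩ := char (.eq (v Ty.one 1 ⬝ zero) (v Ty.one 1 ⬝ one)) trivial fun x => by
        obtain ⟨y, hy⟩ := hchar (x 0 = x 1)
        refine ⟨y, ?_⟩
        simp only [Sat, Fm.iff, eval, zero, one, push_zero, push_one]
        exact ⟨hy.1, hy.2⟩
      refine ⟨g, fun x => ?_⟩
      have := hg x
      simp [Sat, eval, push_of_ne, zero, one, Fm.inst, Fm.rename, Fm.subst, Tm.rename,
        Tm.subst, upRen, single, Fm.iff] at this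
      exact ⟨this.1, this.2⟩
    ltChar := by
      obtain ⟨g, hg⟩ := char (.lt (v Ty.one 1 ⬝ zero) (v Ty.one 1 ⬝ one)) trivial fun x => by
        obtain ⟨y, hy⟩ := hchar (x 0 < x 1)
        refine ⟨y, ?_⟩
        simp only [Sat, Fm.iff, eval, zero, one, push_zero, push_one]
        exact ⟨hy.1, hy.2⟩
      refine ⟨g, fun x => ?_⟩
      have := hg x
      simp [Sat, eval, push_of_ne, zero, one, Fm.inst, Fm.rename, Fm.subst, Tm.rename,
        Tm.subst, upRen, single, Fm.iff] at this
      exact ⟨this.1, this.2⟩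
    existsTwo := by
      obtain ⟨e, -, he⟩ := h _ (hT (.inl (.inr rfl))) ρ
      refine ⟨e, fun f => ?_⟩
      have := he f
      simp [Sat, eval, push_of_ne, zero, Fm.iff] at this
      exact ⟨fun ⟨n, hn⟩ => this.1 n hn, this.2⟩ }

end Interp

namespace Interp

variable {I : Interp}

/-! ### Representable functions and predicates -/

/-- A product of carriers, with its coordinate functions: the range of a list of parameters. -/
class Params (I : Interp) (X : Type) where
  /-- The coordinates of type `σ`. -/
  coord : (σ : Ty) → Set (X → I.M σ)

instance : Params I Unit := ⟨fun _ => ∅⟩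

instance (X : Type) [Params I X] (σ : Ty) : Params I (X × I.M σ) :=
  ⟨fun τ => {f | (∃ g ∈ Params.coord τ, f = fun z => g z.1) ∨ ∃ h : σ = τ, f = fun z => h ▸ z.2}⟩

/-- The functions of parameters which are built from the coordinates and from objects of the
structure by application. -/
inductive IsPoly {X : Type} [Params I X] : {σ : Ty} → (X → I.M σ) → Prop
  | const {σ : Ty} (a : I.M σ) : IsPoly fun _ => a
  | coord {σ : Ty} {f : X → I.M σ} : f ∈ Params.coord σ → IsPoly f
  | app {σ τ : Ty} {f : X → I.M (σ ⇒ τ)} {g : X → I.M σ} :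
      IsPoly f → IsPoly g → IsPoly fun x => f x (g x)

/-- `IsPoly` as a class, so that it is checked by instance search. -/
class Poly {X : Type} [Params I X] {σ : Ty} (f : X → I.M σ) : Prop where
  isPoly : IsPoly f

/-- The predicate `P` is represented by an object of the structure: it holds where a function built
from the parameters vanishes. The predicates which are arithmetical relative to objects of the
structure are of this kind, and this is checked by instance search. -/
class Dec (I : Interp) {X : Type} [Params I X] (P : X → Prop) : Prop where
  exists_poly : ∃ f : X → I.M nat, IsPoly f ∧ ∀ x, P x ↔ f x = 0

section Poly

variable {X : Type} [Params I X] {σ τ : Ty}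

instance (a : I.M σ) : Poly fun _ : X => a := ⟨.const a⟩

instance Poly.app (f : X → I.M (σ ⇒ τ)) (g : X → I.M σ) [Poly f] [Poly g] :
    Poly fun x => f x (g x) := ⟨.app Poly.isPoly Poly.isPoly⟩

instance Poly.add (f g : X → I.M nat) [Poly f] [Poly g] : Poly fun x => f x + g x :=
  inferInstanceAs (Poly fun x => I.const .add (f x) (g x))

instance Poly.mul (f g : X → I.M nat) [Poly f] [Poly g] : Poly fun x => f x * g x :=
  inferInstanceAs (Poly fun x => I.const .mul (f x) (g x))

theorem IsPoly.comp_fst {f : X → I.M τ} (hf : IsPoly f) :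
    IsPoly fun z : X × I.M σ => f z.1 := by
  induction hf with
  | const a => exact .const a
  | coord h => exact .coord (.inl ⟨_, h, rfl⟩)
  | app _ _ h h' => exact .app h h'

theorem Poly.comp_fst (f : X → I.M τ) [hf : Poly f] (σ : Ty) :
    Poly fun z : X × I.M σ => f z.1 :=
  ⟨hf.isPoly.comp_fst⟩

/-- Projections to an initial segment of the list of parameters. -/
class Proj (I : Interp) {X Y : Type} [Params I X] [Params I Y] (p : X → Y) : Prop where
  isPoly_comp {σ : Ty} {f : Y → I.M σ} : IsPoly f → IsPoly fun x => f (p x)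

variable {Y : Type} [Params I Y]

instance Proj.fst : Proj I (Prod.fst : X × I.M σ → X) := ⟨IsPoly.comp_fst⟩

instance Proj.comp_fst (p : X → Y × I.M σ) [hp : Proj I p] : Proj I fun x => (p x).1 :=
  ⟨fun h => hp.isPoly_comp h.comp_fst⟩

instance Proj.comp_snd (p : X → Y × I.M σ) [hp : Proj I p] : Poly fun x => (p x).2 :=
  ⟨hp.isPoly_comp (.coord (.inr ⟨rfl, rfl⟩))⟩

instance Proj.snd : Poly (Prod.snd : X × I.M σ → I.M σ) := ⟨.coord (.inr ⟨rfl, rfl⟩)⟩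

end Poly

section Abstraction

variable [I.IsACA] {X : Type} [Params I X] {σ τ : Ty}

/-- The combinators provide abstraction over the last parameter. -/
theorem IsPoly.exists_abstraction {f : X × I.M σ → I.M τ} (hf : IsPoly f) :
    ∃ g : X → I.M (σ ⇒ τ), IsPoly g ∧ ∀ x a, g x a = f (x, a) := by
  induction hf with
  | const a => exact ⟨fun _ => I.const (.K _ _) a, .const _, fun _ _ => IsACA.K_app _ _⟩
  | @coord τ f h =>
    rcases h with ⟨g, hg, rfl⟩ | ⟨rfl, rfl⟩
    · exact ⟨fun x => I.const (.K _ _) (g x), .app (.const _) (.coord hg),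
        fun _ _ => IsACA.K_app _ _⟩
    · refine ⟨fun _ => I.const (.S σ (σ ⇒ σ) σ) (I.const (.K σ (σ ⇒ σ))) (I.const (.K σ σ)),
        .const _, fun x a => ?_⟩
      rw [IsACA.S_app, IsACA.K_app]
  | app _ _ h h' =>
    obtain ⟨g, hg, hg'⟩ := h
    obtain ⟨k, hk, hk'⟩ := h'
    refine ⟨fun x => I.const (.S _ _ _) (g x) (k x), .app (.app (.const _) hg) hk, fun x a => ?_⟩
    rw [IsACA.S_app, hg', hk']

/-- A function of one parameter which is built by application is an object of the structure. -/
theorem Poly.exists_app_eq (f : I.M σ → I.M τ) [hf : Poly fun z : Unit × I.M σ => f z.2] :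
    ∃ g : I.M (σ ⇒ τ), ∀ a, g a = f a := by
  obtain ⟨g, -, hg⟩ := hf.isPoly.exists_abstraction
  exact ⟨g (), hg ()⟩

end Abstraction

/-! ### The ordered semiring of the objects of type 0 -/

section Semiring

variable [I.IsACA]

instance : CommSemiring (I.M nat) where
  add_assoc := IsACA.add_assoc
  zero_add a := by rw [IsACA.add_comm, IsACA.add_zero]
  add_zero := IsACA.add_zero
  add_comm := IsACA.add_comm
  nsmul := nsmulRec
  mul_assoc := IsACA.mul_assoc
  mul_comm := IsACA.mul_comm
  one_mul a := by rw [IsACA.mul_comm, IsACA.mul_one]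
  mul_one := IsACA.mul_one
  zero_mul a := by rw [IsACA.mul_comm, IsACA.mul_zero]
  mul_zero := IsACA.mul_zero
  left_distrib := IsACA.mul_add
  right_distrib a b c := by
    rw [IsACA.mul_comm, IsACA.mul_add, IsACA.mul_comm c, IsACA.mul_comm c]

noncomputable instance : LinearOrder (I.M nat) where
  lt a b := a < b
  le a b := a < b ∨ a = b
  le_refl _ := .inr rfl
  le_trans a b c := by
    rintro (h | rfl) (h' | rfl)
    · exact .inl (IsACA.lt_trans _ _ _ h h')
    · exact .inl h
    · exact .inl h'
    · exact .inr rfl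
  le_antisymm a b := by
    rintro (h | rfl) (h' | h')
    · exact absurd (IsACA.lt_trans _ _ _ h h') (IsACA.lt_irrefl _)
    · exact h'.symm
    · rfl
    · rfl
  lt_iff_le_not_ge a b := by
    refine ⟨fun h => ⟨.inl h, ?_⟩, ?_⟩
    · rintro (h' | rfl)
      · exact IsACA.lt_irrefl _ (IsACA.lt_trans _ _ _ h h')
      · exact IsACA.lt_irrefl _ h
    · rintro ⟨h | rfl, h'⟩
      · exact h
      · exact absurd (.inr rfl) h'
  le_total a b := by
    rcases IsACA.lt_total a b with h | rfl | h
    · exact .inl (.inl h)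
    · exact .inl (.inr rfl)
    · exact .inr (.inl h)
  toDecidableLE := Classical.decRel _

instance : IsStrictOrderedRing (I.M nat) where
  add_le_add_left a b h c := by
    rcases h with h | rfl
    · exact .inl (IsACA.add_lt_add _ _ _ h)
    · exact .inr rfl
  le_of_add_le_add_left a b c h := by
    by_contra! h'
    have := IsACA.add_lt_add _ _ a h'
    rw [IsACA.add_comm c, IsACA.add_comm b] at this
    exact absurd h (not_le.2 this)
  zero_le_one := .inl IsACA.zero_lt_one
  exists_pair_ne := ⟨0, 1, (ne_of_lt (IsACA.zero_lt_one (I := I)))⟩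
  mul_lt_mul_of_pos_left a h b c h' := by
    have := IsACA.mul_lt_mul _ _ _ h h'
    rwa [IsACA.mul_comm b, IsACA.mul_comm c] at this
  mul_lt_mul_of_pos_right a h b c h' := IsACA.mul_lt_mul _ _ _ h h'

protected theorem zero_le (a : I.M nat) : 0 ≤ a := IsACA.zero_le a

theorem add_one_le_of_lt {a b : I.M nat} (h : a < b) : a + 1 ≤ b := by
  by_contra! h'
  exact absurd h (not_lt.2 (IsACA.lt_succ b a h'))

theorem lt_add_one_iff {a b : I.M nat} : a < b + 1 ↔ a ≤ b :=
  ⟨IsACA.lt_succ a b, fun h => h.trans_lt (lt_add_one b)⟩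

end Semiring

/-! ### Closure properties of the representable predicates -/

section Dec

variable {X : Type} [Params I X]

theorem Dec.congr {P Q : X → Prop} [hP : Dec I P] (h : ∀ x, Q x ↔ P x) : Dec I Q := by
  obtain ⟨f, hf, hf'⟩ := hP
  exact ⟨f, hf, fun x => (h x).trans (hf' x)⟩

variable [I.IsACA]

/-- The object `(a, b, b, …)` of type `1`. -/
theorem exists_poly_pair (f g : X → I.M nat) [Poly f] [Poly g] :
    ∃ h : X → I.M Ty.one, IsPoly h ∧ ∀ x, h x 0 = f x ∧ h x 1 = g x := by
  refine ⟨fun x => I.const (.R nat) (I.const (.K _ _) (I.const (.K _ _) (g x))) (f x),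
    Poly.isPoly, fun x => ⟨IsACA.R_zero _ _, ?_⟩⟩
  have := IsACA.R_succ (I.const (.K _ nat) (I.const (.K _ nat) (g x))) (f x) 0
  rwa [zero_add, IsACA.K_app, IsACA.K_app] at this

instance Dec.eq (f g : X → I.M nat) [Poly f] [Poly g] : Dec I fun x => f x = g x := by
  obtain ⟨e, he⟩ := IsACA.eqChar (I := I)
  obtain ⟨h, hp, hh⟩ := exists_poly_pair f g
  refine ⟨fun x => e (h x) 0, .app (.app (.const _) hp) (.const _), fun x => ?_⟩
  rw [he, (hh x).1, (hh x).2]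

instance Dec.lt (f g : X → I.M nat) [Poly f] [Poly g] : Dec I fun x => f x < g x := by
  obtain ⟨e, he⟩ := IsACA.ltChar (I := I)
  obtain ⟨h, hp, hh⟩ := exists_poly_pair f g
  refine ⟨fun x => e (h x) 0, .app (.app (.const _) hp) (.const _), fun x => ?_⟩
  rw [he, (hh x).1, (hh x).2]

instance Dec.not (P : X → Prop) [hP : Dec I P] : Dec I fun x => ¬ P x := by
  obtain ⟨f, hf, hf'⟩ := hP
  have : Poly f := ⟨hf⟩
  exact Dec.congr (P := fun x => 0 < f x) fun x => by
    rw [hf', ← ne_eq, (Interp.zero_le (f x)).lt_iff_ne']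

instance Dec.and (P Q : X → Prop) [hP : Dec I P] [hQ : Dec I Q] : Dec I fun x => P x ∧ Q x := by
  obtain ⟨f, hf, hf'⟩ := hP
  obtain ⟨g, hg, hg'⟩ := hQ
  have : Poly f := ⟨hf⟩
  have : Poly g := ⟨hg⟩
  exact Dec.congr (P := fun x => f x + g x = 0) fun x => by
    rw [hf', hg', add_eq_zero_iff_of_nonneg (Interp.zero_le _) (Interp.zero_le _)]

instance Dec.ex (P : X → I.M nat → Prop) [hP : Dec I fun z : X × I.M nat => P z.1 z.2] :
    Dec I fun x => ∃ n, P x n := by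
  obtain ⟨f, hf, hf'⟩ := hP
  obtain ⟨g, hg, hg'⟩ := hf.exists_abstraction
  obtain ⟨e, he⟩ := IsACA.existsTwo (I := I)
  refine ⟨fun x => e (g x), .app (.const _) hg, fun x => ?_⟩
  rw [← he]
  exact exists_congr fun n => by rw [hg', ← hf' (x, n)]

instance Dec.or (P Q : X → Prop) [Dec I P] [Dec I Q] : Dec I fun x => P x ∨ Q x :=
  Dec.congr (P := fun x => ¬ (¬ P x ∧ ¬ Q x)) fun _ => by tauto

instance Dec.imp (P Q : X → Prop) [Dec I P] [Dec I Q] : Dec I fun x => P x → Q x :=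
  Dec.congr (P := fun x => ¬ (P x ∧ ¬ Q x)) fun _ => by tauto

instance Dec.all (P : X → I.M nat → Prop) [Dec I fun z : X × I.M nat => P z.1 z.2] :
    Dec I fun x => ∀ n, P x n :=
  Dec.congr (P := fun x => ¬ ∃ n, ¬ P x n) fun _ => by simp

end Dec

/-! ### Induction and choice for representable predicates -/

section Choice

variable [I.IsACA]

theorem induction (P : I.M nat → Prop) [hP : Dec I fun z : Unit × I.M nat => P z.2] (h0 : P 0)
    (hs : ∀ n, P n → P (n + 1)) (n : I.M nat) : P n := by
  obtain ⟨f, hf, hf'⟩ := hP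
  obtain ⟨g, -, hg⟩ := hf.exists_abstraction
  have key : ∀ n, P n ↔ g () n = 0 := fun n => by rw [hg, ← hf' ((), n)]
  simp only [key] at h0 hs ⊢
  exact IsACA.ind (g ()) h0 hs n

theorem eq_zero_or_eq_add_one (n : I.M nat) : n = 0 ∨ ∃ m, n = m + 1 :=
  induction (fun n : I.M nat => n = 0 ∨ ∃ m, n = m + 1) (.inl rfl) (fun n _ => .inr ⟨n, rfl⟩) n

theorem choice_one_one (P : I.M Ty.one → I.M Ty.one → Prop)
    [hP : Dec I fun z : (Unit × I.M Ty.one) × I.M Ty.one => P z.1.2 z.2] (h : ∀ x, ∃ y, P x y) :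
    ∃ g : I.M (Ty.one ⇒ Ty.one), ∀ x, P x (g x) := by
  obtain ⟨f, hf, hf'⟩ := hP
  obtain ⟨g, hg, hg'⟩ := hf.exists_abstraction
  obtain ⟨k, -, hk⟩ := hg.exists_abstraction
  have key : ∀ x y, P x y ↔ k () x y = 0 := fun x y => by rw [hk, hg', ← hf' (((), x), y)]
  simp only [key] at h ⊢
  exact IsACA.choice (k ()) h

theorem choice_nat_one (P : I.M nat → I.M Ty.one → Prop)
    [Dec I fun z : (Unit × I.M Ty.one) × I.M Ty.one => P (z.1.2 0) z.2] (h : ∀ n, ∃ y, P n y) :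
    ∃ g : I.M (nat ⇒ Ty.one), ∀ n, P n (g n) := by
  obtain ⟨g, hg⟩ := choice_one_one (fun x y => P (x 0) y) fun x => h (x 0)
  obtain ⟨k, hk⟩ := Poly.exists_app_eq fun n : I.M nat => g (I.const (.K nat nat) n)
  refine ⟨k, fun n => ?_⟩
  have := hg (I.const (.K nat nat) n)
  rwa [IsACA.K_app, ← hk] at this

theorem choice_nat_nat (P : I.M nat → I.M nat → Prop)
    [Dec I fun z : (Unit × I.M Ty.one) × I.M Ty.one => P (z.1.2 0) (z.2 0)]
    (h : ∀ n, ∃ m, P n m) : ∃ g : I.M Ty.one, ∀ n, P n (g n) := by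
  obtain ⟨g, hg⟩ := choice_nat_one (fun n y => P n (y 0)) fun n => by
    obtain ⟨m, hm⟩ := h n
    exact ⟨I.const (.K nat nat) m, by rwa [IsACA.K_app]⟩
  obtain ⟨k, hk⟩ := Poly.exists_app_eq fun n : I.M nat => g n 0
  exact ⟨k, fun n => by rw [hk]; exact hg n⟩

end Choice

end Interp

/-! ### The ordered field of fractions of an ordered semiring -/

section Fractions

open Algebra

/-- The ring of differences of a commutative semiring. -/
def DiffRing (N : Type) [CommSemiring N] : Type := GrothendieckAddGroup N

namespace DiffRing

variable {N : Type} [CommSemiring N]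

noncomputable instance : AddCommGroup (DiffRing N) :=
  inferInstanceAs (AddCommGroup (GrothendieckAddGroup N))

/-- The canonical map of a semiring to its ring of differences. -/
noncomputable def of : N →+ DiffRing N := GrothendieckAddGroup.of

/-- The extension of an additive map to the ring of differences. -/
noncomputable def lift {G : Type} [AddCommGroup G] (f : N →+ G) : DiffRing N →+ G :=
  GrothendieckAddGroup.lift f

theorem lift_of {G : Type} [AddCommGroup G] (f : N →+ G) (a : N) : lift f (of a) = f a :=
  DFunLike.congr_fun (GrothendieckAddGroup.lift.symm_apply_apply f) a

theorem exists_of_sub_of (x : DiffRing N) : ∃ a b : N, x = of a - of b := by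
  have key : ∀ x : GrothendieckAddGroup N,
      ∃ a b : N, x = GrothendieckAddGroup.of a - GrothendieckAddGroup.of b := by
    intro x
    induction x using AddLocalization.induction_on with | _ x
    refine ⟨x.1, x.2, ?_⟩
    change _ = AddLocalization.mk x.1 0 - AddLocalization.mk (x.2 : N) 0
    rw [GrothendieckAddGroup.mk_sub_mk]
    congr 1
    · simp
    · ext
      simp
  exact key x

theorem of_injective [IsCancelAdd N] : Function.Injective (of (N := N)) :=
  GrothendieckAddGroup.of_injective

theorem hom_ext {G : Type} [AddCommGroup G] {f g : DiffRing N →+ G}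
    (h : ∀ a, f (of a) = g (of a)) : f = g := by
  ext x
  obtain ⟨a, b, rfl⟩ := exists_of_sub_of x
  rw [map_sub, map_sub, h, h]

/-- The multiplication of the ring of differences. -/
noncomputable def mulHom : DiffRing N →+ DiffRing N →+ DiffRing N :=
  lift
    { toFun := fun a => lift (of.comp (AddMonoidHom.mulLeft a))
      map_zero' := hom_ext fun b => by simp [lift_of]
      map_add' := fun a a' => hom_ext fun b => by simp [lift_of, add_mul] }

noncomputable instance : Mul (DiffRing N) := ⟨fun x y => mulHom x y⟩

noncomputable instance : One (DiffRing N) := ⟨of 1⟩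

theorem one_def : (1 : DiffRing N) = of 1 := rfl

theorem of_mul (a b : N) : of (a * b) = of a * of b := by
  change _ = mulHom (of a) (of b)
  rw [mulHom, lift_of]
  exact (lift_of (of.comp (AddMonoidHom.mulLeft a)) b).symm

theorem add_mul' (x y z : DiffRing N) : (x + y) * z = x * z + y * z := by
  change mulHom (x + y) z = mulHom x z + mulHom y z
  simp

theorem mul_add' (x y z : DiffRing N) : x * (y + z) = x * y + x * z := by
  change mulHom x (y + z) = mulHom x y + mulHom x z
  simp

theorem sub_mul' (x y z : DiffRing N) : (x - y) * z = x * z - y * z := by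
  change mulHom (x - y) z = mulHom x z - mulHom y z
  simp

theorem mul_sub' (x y z : DiffRing N) : x * (y - z) = x * y - x * z := by
  change mulHom x (y - z) = mulHom x y - mulHom x z
  simp

theorem mul_comm' (x y : DiffRing N) : x * y = y * x := by
  obtain ⟨a, b, rfl⟩ := exists_of_sub_of x
  obtain ⟨c, d, rfl⟩ := exists_of_sub_of y
  simp only [sub_mul', mul_sub', ← of_mul, mul_comm]
  abel

theorem one_mul' (x : DiffRing N) : 1 * x = x := by
  obtain ⟨a, b, rfl⟩ := exists_of_sub_of x
  simp only [mul_sub', one_def, ← of_mul, one_mul]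

noncomputable instance : CommRing (DiffRing N) :=
  { (inferInstance : AddCommGroup (DiffRing N)) with
    mul_assoc := fun x y z => by
      obtain ⟨a, b, rfl⟩ := exists_of_sub_of x
      obtain ⟨c, d, rfl⟩ := exists_of_sub_of y
      obtain ⟨e, f, rfl⟩ := exists_of_sub_of z
      simp only [sub_mul', mul_sub', ← of_mul, mul_assoc]
    mul_comm := mul_comm'
    one_mul := one_mul'
    mul_one := fun x => by rw [mul_comm', one_mul']
    left_distrib := mul_add'
    right_distrib := add_mul'
    zero_mul := fun x => by
      change mulHom 0 x = 0
      simp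
    mul_zero := fun x => by
      change mulHom x 0 = 0
      simp }

/-- The canonical map of a semiring to its ring of differences, as a ring homomorphism. -/
noncomputable def ofHom : N →+* DiffRing N :=
  { of with
    map_one' := rfl
    map_mul' := of_mul }

end DiffRing

/-- A linearly ordered semiring in which differences `b - a` with `a ≤ b` exist embeds into a
linearly ordered field, the field of fractions of its differences. -/
theorem exists_ordered_field {N : Type} [CommSemiring N] [LinearOrder N] [IsStrictOrderedRing N]
    (hnonneg : ∀ a : N, 0 ≤ a) (hsub : ∀ a b : N, a ≤ b → ∃ c, b = a + c) :
    ∃ (K : Type) (_ : Field K) (_ : LinearOrder K) (_ : IsStrictOrderedRing K) (ι : N →+* K),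
      StrictMono ι := by
  classical
  have hnzd : NoZeroDivisors N := ⟨by
    intro a b h
    by_contra! h'
    exact (mul_pos ((hnonneg a).lt_of_ne' h'.1) ((hnonneg b).lt_of_ne' h'.2)).ne' h⟩
  have hinj : Function.Injective (DiffRing.ofHom (N := N)) := DiffRing.of_injective
  have hcases : ∀ x : DiffRing N, ∃ c, x = DiffRing.ofHom c ∨ x = -DiffRing.ofHom c := by
    intro x
    obtain ⟨a, b, rfl⟩ := DiffRing.exists_of_sub_of x
    change ∃ c, DiffRing.ofHom a - DiffRing.ofHom b = _ ∨ DiffRing.ofHom a - DiffRing.ofHom b = _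
    rcases le_total a b with h | h
    · obtain ⟨c, rfl⟩ := hsub _ _ h
      exact ⟨c, .inr (by simp)⟩
    · obtain ⟨c, rfl⟩ := hsub _ _ h
      exact ⟨c, .inl (by simp)⟩
  have hntr : Nontrivial (DiffRing N) := hinj.nontrivial
  have hdom : NoZeroDivisors (DiffRing N) := ⟨by
    intro x y hxy
    obtain ⟨a, ha⟩ := hcases x
    obtain ⟨b, hb⟩ := hcases y
    have : DiffRing.ofHom (a * b) = 0 := by
      rcases ha with rfl | rfl <;> rcases hb with rfl | rfl <;> simpa using hxy
    rw [← map_zero DiffRing.ofHom, hinj.eq_iff, mul_eq_zero] at this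
    rcases this with rfl | rfl
    · left; simpa using ha
    · right; simpa using hb⟩
  have hdom' : IsDomain (DiffRing N) := NoZeroDivisors.to_isDomain _
  let K := FractionRing (DiffRing N)
  let ι : N →+* K := (algebraMap (DiffRing N) K).comp DiffRing.ofHom
  have hι : Function.Injective ι := (IsFractionRing.injective (DiffRing N) K).comp hinj
  have hι0 : ∀ a : N, 0 < a → ι a ≠ 0 := fun a ha h =>
    ha.ne' (hι (by rw [h, map_zero]))
  -- the nonnegative elements are the fractions of elements of `N`
  let C : RingCone K :=
    { carrier := {x | ∃ a d : N, 0 < d ∧ x = ι a / ι d}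
      mul_mem' := by
        rintro _ _ ⟨a, d, hd, rfl⟩ ⟨b, e, he, rfl⟩
        exact ⟨a * b, d * e, mul_pos hd he, by rw [map_mul, map_mul, div_mul_div_comm]⟩
      one_mem' := ⟨1, 1, zero_lt_one, by simp⟩
      add_mem' := by
        rintro _ _ ⟨a, d, hd, rfl⟩ ⟨b, e, he, rfl⟩
        exact ⟨a * e + d * b, d * e, mul_pos hd he, by
          rw [div_add_div _ _ (hι0 d hd) (hι0 e he)]; simp⟩
      zero_mem' := ⟨0, 1, zero_lt_one, by simp⟩
      eq_zero_of_mem_of_neg_mem' := by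
        rintro _ ⟨a, d, hd, rfl⟩ ⟨b, e, he, h⟩
        have h' : ι a / ι d + ι b / ι e = 0 := by rw [← h]; ring
        rw [div_add_div _ _ (hι0 d hd) (hι0 e he), div_eq_zero_iff] at h'
        have h2 : a * e + d * b = 0 := by
          rcases h' with h' | h'
          · exact hι (by simpa using h')
          · exact absurd h' (mul_ne_zero (hι0 d hd) (hι0 e he))
        rw [add_eq_zero_iff_of_nonneg (hnonneg _) (hnonneg _), mul_eq_zero] at h2
        rcases h2.1 with rfl | rfl
        · simp
        · exact absurd he (lt_irrefl _) }
  have hrep : ∀ x : K, ∃ c d : N, 0 < d ∧ (x = ι c / ι d ∨ x = -(ι c / ι d)) := by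
    intro x
    obtain ⟨y, z, hz, rfl⟩ := IsFractionRing.div_surjective (A := DiffRing N) x
    have hz' : z ≠ 0 := nonZeroDivisors.ne_zero hz
    obtain ⟨c, hc⟩ := hcases y
    obtain ⟨d, hd⟩ := hcases z
    have hd0 : 0 < d := by
      refine (hnonneg d).lt_of_ne fun h => hz' ?_
      subst h
      simpa using hd
    refine ⟨c, d, hd0, ?_⟩
    rcases hc with rfl | rfl <;> rcases hd with rfl | rfl <;> simp [ι, neg_div, div_neg]
  have hC : HasMemOrNegMem C := ⟨by
    intro x
    obtain ⟨c, d, hd, h | h⟩ := hrep x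
    · exact .inl ⟨c, d, hd, h⟩
    · exact .inr ⟨c, d, hd, by rw [h, neg_neg]⟩⟩
  let ord : LinearOrder K := LinearOrder.mkOfAddGroupCone C
  have hord : IsOrderedRing K := IsOrderedRing.mkOfCone C
  have hmono : Monotone ι := fun a b hab => by
    obtain ⟨c, rfl⟩ := hsub _ _ hab
    change ι (a + c) - ι a ∈ C
    exact ⟨c, 1, zero_lt_one, by simp⟩
  exact ⟨K, inferInstance, ord, IsOrderedRing.toIsStrictOrderedRing K, ι,
    hmono.strictMono_of_injective hι⟩

end Fractions

namespace Interp

/-! ### Codes of rationals -/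

section Defs

variable {I : Interp}

/-- `c` is the Cantor code of the pair `(s, t)`. -/
def IsPair (c s t : I.M nat) : Prop := (1 + 1) * c = (s + t) * ((s + t) + 1) + (1 + 1) * t

/-- `c` codes the rational `(p - n) / d`. -/
def IsCode (c p n d : I.M nat) : Prop :=
  ∃ s t, IsPair c s t ∧ d = t + 1 ∧ ((s = (1 + 1) * p ∧ n = 0) ∨ (s + 1 = (1 + 1) * n ∧ p = 0))

end Defs

variable {I : Interp} [I.IsACA]

theorem exists_add_of_le {a b : I.M nat} (h : a ≤ b) : ∃ c, b = a + c := by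
  refine induction (fun b : I.M nat => a ≤ b → ∃ c, b = a + c) ?_ ?_ b h
  · intro h
    exact ⟨0, by rw [add_zero]; exact le_antisymm (Interp.zero_le _) h⟩
  · intro b ih h
    rcases h.lt_or_eq with h | rfl
    · obtain ⟨c, rfl⟩ := ih (lt_add_one_iff.1 h)
      exact ⟨c + 1, add_assoc _ _ _⟩
    · exact ⟨0, (add_zero _).symm⟩

variable (I) in
theorem exists_embedding :
    ∃ (K : Type) (_ : Field K) (_ : LinearOrder K) (_ : IsStrictOrderedRing K)
      (ι : I.M nat →+* K), StrictMono ι :=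
  exists_ordered_field Interp.zero_le fun _ _ => exists_add_of_le

theorem exists_even_or_odd (n : I.M nat) : ∃ k, n = (1 + 1) * k ∨ n + 1 = (1 + 1) * k := by
  refine induction (fun n : I.M nat => ∃ k, n = (1 + 1) * k ∨ n + 1 = (1 + 1) * k)
    ⟨0, .inl (by simp)⟩ ?_ n
  rintro n ⟨k, rfl | h⟩
  · exact ⟨k + 1, .inr (by ring)⟩
  · exact ⟨k, .inl h⟩

theorem not_even_and_odd {n k l : I.M nat} (h : n = (1 + 1) * k) (h' : n + 1 = (1 + 1) * l) :
    False := by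
  subst h
  have h2 : (0 : I.M nat) < 1 + 1 := by positivity
  rcases le_or_gt l k with h | h
  · have := mul_le_mul_of_nonneg_left h h2.le
    rw [← h'] at this
    exact absurd this (not_le.2 (lt_add_one _))
  · have := mul_le_mul_of_nonneg_left (add_one_le_of_lt h) h2.le
    rw [← h', mul_add, mul_one, ← add_assoc] at this
    exact absurd this (not_le.2 (lt_add_one _))

theorem exists_isPair (s t : I.M nat) : ∃ c, IsPair c s t := by
  obtain ⟨k, hk⟩ : ∃ k, (s + t) * ((s + t) + 1) = (1 + 1) * k := by
    obtain ⟨k, hk | hk⟩ := exists_even_or_odd (s + t)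
    · exact ⟨k * (s + t + 1), by rw [← mul_assoc, ← hk]⟩
    · exact ⟨(s + t) * k, by rw [hk]; ring⟩
  exact ⟨k + t, by rw [IsPair, hk, mul_add]⟩

theorem IsPair.sum_le {c s t s' t' : I.M nat} (h : IsPair c s t) (h' : IsPair c s' t') :
    s' + t' ≤ s + t := by
  by_contra! hlt
  obtain ⟨K, _, _, _, ι, hι⟩ := exists_embedding I
  have h1 := congrArg ι h
  have h2 := congrArg ι h'
  have h3 := hι.monotone (add_one_le_of_lt hlt)
  have h4 := hι.monotone (Interp.zero_le s)
  have h5 := hι.monotone (Interp.zero_le t)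
  have h6 := hι.monotone (Interp.zero_le t')
  simp only [map_add, map_mul, map_one, map_zero] at h1 h2 h3 h4 h5 h6
  nlinarith

theorem IsPair.unique {c s t s' t' : I.M nat} (h : IsPair c s t) (h' : IsPair c s' t') :
    s = s' ∧ t = t' := by
  have hs : s + t = s' + t' := le_antisymm (h'.sum_le h) (h.sum_le h')
  have ht : t = t' := by
    have : (1 + 1) * t = (1 + 1) * t' := by
      have h1 := h.symm.trans h'
      rw [hs] at h1
      exact add_left_cancel h1
    refine le_antisymm ?_ ?_ <;> by_contra! hlt <;>
      have := mul_lt_mul_of_pos_left hlt (show (0 : I.M nat) < 1 + 1 by positivity) <;>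
      simp_all
  subst ht
  exact ⟨add_right_cancel hs, rfl⟩

theorem exists_isPair_of_code (c : I.M nat) : ∃ s t, IsPair c s t := by
  refine induction (fun c : I.M nat => ∃ s t,
    (1 + 1) * c = (s + t) * ((s + t) + 1) + (1 + 1) * t) ⟨0, 0, by simp⟩ ?_ c
  rintro c ⟨s, t, h⟩
  rcases eq_zero_or_eq_add_one s with rfl | ⟨s, rfl⟩
  · exact ⟨t + 1, 0, by rw [mul_add, h]; ring⟩
  · exact ⟨s, t + 1, by rw [mul_add, h]; ring⟩

theorem IsCode.unique {c p n d p' n' d' : I.M nat} (h : IsCode c p n d) (h' : IsCode c p' n' d') :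
    p = p' ∧ n = n' ∧ d = d' := by
  obtain ⟨s, t, h, rfl, h1⟩ := h
  obtain ⟨s', t', h', rfl, h1'⟩ := h'
  obtain ⟨rfl, rfl⟩ := h.unique h'
  have h2 : (1 + 1 : I.M nat) ≠ 0 := by positivity
  have hinj : ∀ {a b : I.M nat}, (1 + 1) * a = (1 + 1) * b → a = b := by
    intro a b hab
    refine le_antisymm ?_ ?_ <;> by_contra! hlt <;>
      have := mul_lt_mul_of_pos_left hlt (show (0 : I.M nat) < 1 + 1 by positivity) <;>
      simp_all
  rcases h1 with ⟨h1, rfl⟩ | ⟨h1, rfl⟩ <;> rcases h1' with ⟨h1', rfl⟩ | ⟨h1', rfl⟩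
  · exact ⟨hinj (h1.symm.trans h1'), rfl, rfl⟩
  · exact (not_even_and_odd h1 h1').elim
  · exact (not_even_and_odd h1' h1).elim
  · exact ⟨rfl, hinj (h1.symm.trans h1'), rfl⟩

theorem exists_isCode (c : I.M nat) : ∃ p n d, IsCode c p n d := by
  obtain ⟨s, t, h⟩ := exists_isPair_of_code c
  obtain ⟨k, hk | hk⟩ := exists_even_or_odd s
  · exact ⟨k, 0, t + 1, s, t, h, rfl, .inl ⟨hk, rfl⟩⟩
  · exact ⟨0, k, t + 1, s, t, h, rfl, .inr ⟨hk, rfl⟩⟩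

instance {X : Type} [Params I X] (f g h : X → I.M nat) [Poly f] [Poly g] [Poly h] :
    Dec I fun x => IsPair (f x) (g x) (h x) :=
  inferInstanceAs (Dec I fun x =>
    (1 + 1) * f x = (g x + h x) * ((g x + h x) + 1) + (1 + 1) * h x)

variable (I) in
/-- The positive part of the numerator, the negative part of the numerator, and the denominator of a
rational are functions in the structure of its code. -/
theorem exists_decoding : ∃ pos neg den : I.M Ty.one, ∀ c, IsCode c (pos c) (neg c) (den c) := by
  have h : ∀ c : I.M nat, ∃ p n d, IsCode c p n d := exists_isCode
  unfold IsCode at h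
  obtain ⟨pos, h⟩ := choice_nat_nat (fun c p : I.M nat => ∃ n d s t, IsPair c s t ∧ d = t + 1 ∧
    ((s = (1 + 1) * p ∧ n = 0) ∨ (s + 1 = (1 + 1) * n ∧ p = 0))) h
  obtain ⟨neg, h⟩ := choice_nat_nat (fun c n : I.M nat => ∃ d s t, IsPair c s t ∧ d = t + 1 ∧
    ((s = (1 + 1) * pos c ∧ n = 0) ∨ (s + 1 = (1 + 1) * n ∧ pos c = 0))) h
  obtain ⟨den, h⟩ := choice_nat_nat (fun c d : I.M nat => ∃ s t, IsPair c s t ∧ d = t + 1 ∧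
    ((s = (1 + 1) * pos c ∧ neg c = 0) ∨ (s + 1 = (1 + 1) * neg c ∧ pos c = 0))) h
  exact ⟨pos, neg, den, h⟩

variable (I) in
/-- The function which decodes the positive part of the numerator of a rational. -/
noncomputable def pos : I.M Ty.one := (exists_decoding I).choose

variable (I) in
/-- The function which decodes the negative part of the numerator of a rational. -/
noncomputable def neg : I.M Ty.one := (exists_decoding I).choose_spec.choose

variable (I) in
/-- The function which decodes the denominator of a rational. -/
noncomputable def den : I.M Ty.one := (exists_decoding I).choose_spec.choose_spec.choose

theorem isCode_decode (c : I.M nat) : IsCode c (pos I c) (neg I c) (den I c) :=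
  (exists_decoding I).choose_spec.choose_spec.choose_spec c

theorem den_pos (c : I.M nat) : 0 < den I c := by
  obtain ⟨s, t, -, h, -⟩ := isCode_decode c
  rw [h]
  exact lt_add_one_iff.2 (Interp.zero_le _)

theorem IsCode.decode {c p n d : I.M nat} (h : IsCode c p n d) :
    p = pos I c ∧ n = neg I c ∧ d = den I c :=
  h.unique (isCode_decode c)

theorem exists_isCode_pos (p : I.M nat) {d : I.M nat} (hd : 0 < d) : ∃ c, IsCode c p 0 d := by
  obtain rfl | ⟨t, rfl⟩ := eq_zero_or_eq_add_one d
  · exact absurd hd (lt_irrefl _)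
  · obtain ⟨c, hc⟩ := exists_isPair ((1 + 1) * p) t
    exact ⟨c, _, t, hc, rfl, .inl ⟨rfl, rfl⟩⟩

theorem exists_isCode_neg (n : I.M nat) {d : I.M nat} (hd : 0 < d) : ∃ c, IsCode c 0 n d := by
  obtain rfl | ⟨t, rfl⟩ := eq_zero_or_eq_add_one d
  · exact absurd hd (lt_irrefl _)
  · obtain rfl | ⟨m, rfl⟩ := eq_zero_or_eq_add_one n
    · exact exists_isCode_pos 0 hd
    · obtain ⟨c, hc⟩ := exists_isPair ((1 + 1) * m + 1) t
      exact ⟨c, _, t, hc, rfl, .inr ⟨by ring, rfl⟩⟩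

/-! ### Powers of two -/

/-- `2 ^ n`, as the term `HORM.twoPow` computes it. -/
def twoPow (n : I.M nat) : I.M nat :=
  I.const (.R nat) (I.const (.K (nat ⇒ nat) nat) (I.const (.S nat nat nat) (I.const .add)
    (I.const (.S nat (nat ⇒ nat) nat) (I.const (.K nat (nat ⇒ nat))) (I.const (.K nat nat))))) 1 n

instance {X : Type} [Params I X] (f : X → I.M nat) [Poly f] : Poly fun x => twoPow (f x) := by
  unfold twoPow
  infer_instance

theorem twoPow_zero : twoPow (0 : I.M nat) = 1 := IsACA.R_zero _ _

theorem twoPow_add_one (n : I.M nat) : twoPow (n + 1) = twoPow n + twoPow n := by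
  rw [twoPow, IsACA.R_succ, IsACA.K_app, IsACA.S_app, IsACA.S_app, IsACA.K_app]
  rfl

theorem twoPow_pos (n : I.M nat) : 0 < twoPow n :=
  induction (fun n : I.M nat => 0 < twoPow n) (by rw [twoPow_zero]; exact zero_lt_one)
    (fun n h => by rw [twoPow_add_one]; exact add_pos h h) n

theorem lt_twoPow (n : I.M nat) : n < twoPow n := by
  refine induction (fun n : I.M nat => n < twoPow n) (twoPow_pos 0) (fun n h => ?_) n
  rw [twoPow_add_one]
  calc n + 1 < twoPow n + 1 := by gcongr
    _ ≤ twoPow n + twoPow n := by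
      gcongr
      simpa using add_one_le_of_lt (twoPow_pos n)

theorem twoPow_add (m n : I.M nat) : twoPow (m + n) = twoPow m * twoPow n := by
  refine induction (fun n : I.M nat => twoPow (m + n) = twoPow m * twoPow n) ?_ (fun n h => ?_) n
  · rw [add_zero, twoPow_zero, mul_one]
  · rw [← add_assoc, twoPow_add_one, h, twoPow_add_one, mul_add]

end Interp

namespace Interp

/-! ### Fractions and real numbers in a structure -/

/-- A fraction `(pos - neg) / den` in a structure. -/
structure Fr (I : Interp) where
  pos : I.M nat
  neg : I.M nat
  den : I.M nat

variable {I : Interp} [I.IsACA]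

namespace Fr

/-- The sum of two fractions. -/
def plus (p q : Fr I) : Fr I :=
  ⟨p.pos * q.den + q.pos * p.den, p.neg * q.den + q.neg * p.den, p.den * q.den⟩

/-- The fraction `k / 2 ^ n`. -/
def dyadic (k : ℕ) (n : I.M nat) : Fr I := ⟨k, 0, twoPow n⟩

/-- The fraction with code `c`. -/
noncomputable def code (c : I.M nat) : Fr I := ⟨I.pos c, I.neg c, I.den c⟩

/-- The order of fractions. -/
def Lt (p q : Fr I) : Prop :=
  p.pos * q.den + q.neg * p.den < q.pos * p.den + p.neg * q.den

/-- The equality of fractions. -/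
def Eqv (p q : Fr I) : Prop :=
  p.pos * q.den + q.neg * p.den = q.pos * p.den + p.neg * q.den

/-- The fraction `p` or its negative. -/
def signed (s : Bool) (p : Fr I) : Fr I := bif s then p else ⟨p.neg, p.pos, p.den⟩

omit [I.IsACA] in
theorem signed_den (s : Bool) (p : Fr I) : (p.signed s).den = p.den := by cases s <;> rfl

/-- A fraction which depends on parameters is represented componentwise. -/
class IsPolyFr {X : Type} [Params I X] (p : X → Fr I) : Prop where
  pos : Poly fun x => (p x).pos
  neg : Poly fun x => (p x).neg
  den : Poly fun x => (p x).den

section Instances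

variable {X : Type} [Params I X] (p q : X → Fr I) [hp : IsPolyFr p] [hq : IsPolyFr q]
  (k : X → I.M nat) [Poly k]

instance : IsPolyFr fun x => code (k x) := by
  constructor <;> unfold code <;> infer_instance

instance (n : ℕ) : IsPolyFr fun x => dyadic n (k x) := by
  constructor <;> unfold dyadic <;> infer_instance

instance : IsPolyFr fun x => (p x).plus (q x) := by
  obtain ⟨_, _, _⟩ := hp
  obtain ⟨_, _, _⟩ := hq
  constructor <;> unfold plus <;> infer_instance

instance (s : Bool) : IsPolyFr fun x => (p x).signed s := by
  obtain ⟨_, _, _⟩ := hp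
  cases s <;> constructor <;> unfold signed <;> simp only [cond_true, cond_false] <;>
    infer_instance

instance : Dec I fun x => (p x).Lt (q x) := by
  obtain ⟨_, _, _⟩ := hp
  obtain ⟨_, _, _⟩ := hq
  unfold Lt
  infer_instance

instance : Dec I fun x => (p x).Eqv (q x) := by
  obtain ⟨_, _, _⟩ := hp
  obtain ⟨_, _, _⟩ := hq
  unfold Eqv
  infer_instance

end Instances

end Fr

/-- `x` is a fast-converging Cauchy sequence of rationals. -/
def IsReal (x : I.M Ty.one) : Prop :=
  ∀ n i, (Fr.code (x n)).Lt ((Fr.code (x (n + i))).plus (.dyadic 1 n)) ∧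
    (Fr.code (x (n + i))).Lt ((Fr.code (x n)).plus (.dyadic 1 n))

/-- The order of the reals. -/
def RealLt (x y : I.M Ty.one) : Prop :=
  ∃ n, ((Fr.code (x n)).plus (.dyadic 2 n)).Lt (Fr.code (y n))

/-- `x < y + z`. -/
def RealLtAdd (x y z : I.M Ty.one) : Prop :=
  ∃ n, ((Fr.code (x n)).plus (.dyadic 3 n)).Lt ((Fr.code (y n)).plus (Fr.code (z n)))

/-- The constant sequence with value the rational with code `c`. -/
def constSeq (c : I.M nat) : I.M Ty.one := I.const (.K nat nat) c

/-- `x ∈ [0, 1]`. -/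
def InUnit (x : I.M Ty.one) : Prop :=
  IsReal x ∧ ¬ RealLt x (constSeq (0 : ℕ)) ∧ ¬ RealLt (constSeq (3 : ℕ)) x

/-- `z` is in the open interval with centre `c` and radius `r`. -/
def InBall (z c r : I.M Ty.one) : Prop := RealLtAdd c z r ∧ RealLtAdd z c r

/-- `z` is in the interval with centre `y` which is given by the function `f`. -/
def InIvl (f : I.M Ty.fn) (y z : I.M Ty.one) : Prop := InBall z y (f y)

section Instances

variable {X : Type} [Params I X] (f g h : X → I.M Ty.one) [Poly f] [Poly g] [Poly h]

instance : Dec I fun x => IsReal (f x) := by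
  have := Poly.comp_fst f nat
  have := Poly.comp_fst (fun z : X × I.M nat => f z.1) nat
  unfold IsReal
  infer_instance

instance : Dec I fun x => RealLt (f x) (g x) := by
  have := Poly.comp_fst f nat
  have := Poly.comp_fst g nat
  unfold RealLt
  infer_instance

instance : Dec I fun x => RealLtAdd (f x) (g x) (h x) := by
  have := Poly.comp_fst f nat
  have := Poly.comp_fst g nat
  have := Poly.comp_fst h nat
  unfold RealLtAdd
  infer_instance

instance (k : X → I.M nat) [Poly k] : Poly fun x => constSeq (k x) := by
  unfold constSeq
  infer_instance

instance : Dec I fun x => InUnit (f x) := by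
  unfold InUnit
  infer_instance

instance (k : X → I.M Ty.fn) [Poly k] : Dec I fun x => InIvl (k x) (f x) (g x) := by
  unfold InIvl InBall
  infer_instance

end Instances

@[simp] theorem constSeq_app (c n : I.M nat) : constSeq c n = c := IsACA.K_app _ _

/-! ### Values of fractions in an ordered field -/

section Values

variable {R : Type} [Field R]

/-- The value of a fraction. -/
def Fr.val (ι : I.M nat →+* R) (p : Fr I) : R := (ι p.pos - ι p.neg) / ι p.den

/-- The value of the rational with code `c`. -/
noncomputable def rat (ι : I.M nat →+* R) (c : I.M nat) : R := (Fr.code c).val ι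

/-- The value of `2 ^ (-n)`. -/
def eps (ι : I.M nat →+* R) (n : I.M nat) : R := (ι (twoPow n))⁻¹

variable {ι : I.M nat →+* R}

theorem eps_add_one (n : I.M nat) : eps ι (n + 1) = eps ι n / 2 := by
  rw [eps, twoPow_add_one, ← two_mul, map_mul, map_ofNat, mul_inv, eps, div_eq_mul_inv, mul_comm]

theorem eps_add (m n : I.M nat) : eps ι (m + n) = eps ι m * eps ι n := by
  rw [eps, twoPow_add, map_mul, mul_inv, eps, eps]

theorem Fr.val_dyadic (k : ℕ) (n : I.M nat) : (Fr.dyadic k n).val ι = k * eps ι n := by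
  simp [val, dyadic, eps, div_eq_mul_inv]

/-- Every quotient of a difference has a code. -/
theorem exists_rat_eq (a b : I.M nat) {d : I.M nat} (hd : 0 < d) :
    ∃ c, rat ι c = (ι a - ι b) / ι d := by
  rcases le_total a b with h | h
  · obtain ⟨n, rfl⟩ := exists_add_of_le h
    obtain ⟨c, hc⟩ := exists_isCode_neg n hd
    obtain ⟨h1, h2, h3⟩ := hc.decode
    exact ⟨c, by simp [rat, Fr.val, Fr.code, ← h1, ← h2, ← h3]⟩
  · obtain ⟨n, rfl⟩ := exists_add_of_le h
    obtain ⟨c, hc⟩ := exists_isCode_pos n hd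
    obtain ⟨h1, h2, h3⟩ := hc.decode
    exact ⟨c, by simp [rat, Fr.val, Fr.code, ← h1, ← h2, ← h3]⟩

theorem exists_rat_eq_val {p : Fr I} (hp : 0 < p.den) : ∃ c, rat ι c = p.val ι :=
  exists_rat_eq _ _ hp

variable [LinearOrder R] (hι : StrictMono ι)

include hι

theorem map_pos_of_pos {a : I.M nat} (h : 0 < a) : 0 < ι a := by simpa using hι h

theorem Fr.val_plus {p q : Fr I} (hp : 0 < p.den) (hq : 0 < q.den) :
    (p.plus q).val ι = p.val ι + q.val ι := by
  have h1 := (map_pos_of_pos hι hp).ne'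
  have h2 := (map_pos_of_pos hι hq).ne'
  simp only [val, plus, map_add, map_mul]
  field_simp
  ring

variable [IsStrictOrderedRing R]

theorem Fr.lt_iff {p q : Fr I} (hp : 0 < p.den) (hq : 0 < q.den) :
    p.Lt q ↔ p.val ι < q.val ι := by
  have h1 := map_pos_of_pos hι hp
  have h2 := map_pos_of_pos hι hq
  rw [Lt, ← hι.lt_iff_lt, val, val, div_lt_div_iff₀ h1 h2]
  simp only [map_add, map_mul]
  constructor <;> intro h <;> linarith

theorem eps_pos (n : I.M nat) : 0 < eps ι n := inv_pos.2 (map_pos_of_pos hι (twoPow_pos n))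

theorem eps_anti {m n : I.M nat} (h : m ≤ n) : eps ι n ≤ eps ι m := by
  obtain ⟨k, rfl⟩ := exists_add_of_le h
  rw [eps_add]
  refine mul_le_of_le_one_right (eps_pos hι m).le (inv_le_one_of_one_le₀ ?_)
  rw [← map_one ι]
  refine hι.monotone ?_
  simpa using add_one_le_of_lt (twoPow_pos k)

/-- A difference of fractions which is positive is bounded below by some `2 ^ (-n)`. -/
theorem exists_eps_le {p q : Fr I} (hp : 0 < p.den) (hq : 0 < q.den) (h : p.val ι < q.val ι) :
    ∃ n, p.val ι + eps ι n ≤ q.val ι := by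
  have hd : 0 < p.den * q.den := mul_pos hp hq
  refine ⟨p.den * q.den, ?_⟩
  have h1 := (Fr.lt_iff hι hp hq).2 h
  have h2 := hι.monotone (add_one_le_of_lt h1)
  have h3 : eps ι (p.den * q.den) ≤ (ι (p.den * q.den))⁻¹ :=
    inv_anti₀ (map_pos_of_pos hι hd) (hι.monotone (lt_twoPow _).le)
  have h4 : p.val ι + (ι (p.den * q.den))⁻¹ ≤ q.val ι := by
    have h5 := map_pos_of_pos hι hp
    have h6 := map_pos_of_pos hι hq
    have h7 : p.val ι + (ι (p.den * q.den))⁻¹ =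
        ((ι p.pos - ι p.neg) * ι q.den + 1) / (ι p.den * ι q.den) := by
      rw [Fr.val, map_mul]
      field_simp
    have h8 : q.val ι = ((ι q.pos - ι q.neg) * ι p.den) / (ι p.den * ι q.den) := by
      rw [Fr.val]
      field_simp
    rw [h7, h8]
    simp only [map_add, map_mul, map_one] at h2
    gcongr
    linarith
  linarith

end Values

end Interp

namespace Interp

variable {I : Interp} [I.IsACA]

/-! ### Limits of the reals of a structure -/

section Limits

variable {R : Type} [Field R] [LinearOrder R] {ι : I.M nat →+* R}

/-- A map `lim` to an ordered field which extends the objects of type `0` sends every real of the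
structure to an element with the correct distance to its approximations. This element is unique only
up to differences which are smaller than `2 ^ (-n)` for all objects `n` of type `0`. -/
structure IsLimitMap (ι : I.M nat →+* R) (lim : I.M Ty.one → R) : Prop where
  strictMono : StrictMono ι
  le_add : ∀ x, IsReal x → ∀ n, lim x ≤ rat ι (x n) + eps ι n
  le_lim : ∀ x, IsReal x → ∀ n, rat ι (x n) ≤ lim x + eps ι n

variable (I) in
/-- A limit map exists: take an ultrapower of the field of fractions of differences of objects of
type `0`, for an ultrafilter which contains all final segments. -/
theorem exists_isLimitMap :
    ∃ (R : Type) (_ : Field R) (_ : LinearOrder R) (_ : IsStrictOrderedRing R)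
      (ι : I.M nat →+* R) (lim : I.M Ty.one → R), IsLimitMap ι lim := by
  obtain ⟨K, _, _, _, κ, hκ⟩ := exists_embedding I
  let U : Ultrafilter (I.M nat) := Ultrafilter.of Filter.atTop
  let ι : I.M nat →+* Filter.Germ (U : Filter (I.M nat)) K :=
    { toFun := fun a => ((κ a : K) : Filter.Germ (U : Filter (I.M nat)) K)
      map_one' := by rw [map_one]; rfl
      map_mul' := fun _ _ => by rw [map_mul]; rfl
      map_zero' := by rw [map_zero]; rfl
      map_add' := fun _ _ => by rw [map_add]; rfl }
  have hrat : ∀ c, rat ι c = ((rat κ c : K) : Filter.Germ (U : Filter (I.M nat)) K) := fun c => by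
    simp only [rat, Fr.val, Filter.Germ.const_div, Filter.Germ.const_sub]
    rfl
  have heps : ∀ n, eps ι n = ((eps κ n : K) : Filter.Germ (U : Filter (I.M nat)) K) := fun n => by
    simp only [eps, Filter.Germ.const_inv]
    rfl
  -- the terms of index at least `n` are within `2 ^ (-n)` of the term of index `n`
  have hev : ∀ x : I.M Ty.one, IsReal x → ∀ n, ∀ m ≥ n,
      rat κ (x m) ≤ rat κ (x n) + eps κ n ∧ rat κ (x n) ≤ rat κ (x m) + eps κ n := by
    intro x hx n m hm
    obtain ⟨i, rfl⟩ := exists_add_of_le hm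
    obtain ⟨h1, h2⟩ := hx n i
    have hd : ∀ c : I.M nat, 0 < ((Fr.code c).plus (.dyadic 1 n)).den := fun c =>
      mul_pos (den_pos c) (twoPow_pos n)
    rw [Fr.lt_iff hκ (den_pos _) (hd _), Fr.val_plus hκ (den_pos _) (twoPow_pos n),
      Fr.val_dyadic, Nat.cast_one, one_mul] at h1 h2
    exact ⟨h2.le, h1.le⟩
  have hU : (U : Filter (I.M nat)) ≤ Filter.atTop := Ultrafilter.of_le _
  refine ⟨Filter.Germ (U : Filter (I.M nat)) K, inferInstance, inferInstance, inferInstance, ι,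
    fun x => ((fun m => rat κ (x m) : I.M nat → K) : Filter.Germ (U : Filter (I.M nat)) K),
    ⟨fun a b h => Filter.Germ.const_lt (hκ h), fun x hx n => ?_, fun x hx n => ?_⟩⟩
  · rw [hrat, heps]
    refine Filter.Germ.coe_le.2 (hU ?_)
    filter_upwards [Filter.eventually_ge_atTop n] with m hm
    exact (hev x hx n m hm).1
  · rw [hrat, heps]
    refine Filter.Germ.coe_le.2 (hU ?_)
    filter_upwards [Filter.eventually_ge_atTop n] with m hm
    exact (hev x hx n m hm).2

/-- `a < b`, with a difference of at least some `2 ^ (-n)`. -/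
def FarLt (ι : I.M nat →+* R) (a b : R) : Prop := ∃ n, a + eps ι n ≤ b

variable [IsStrictOrderedRing R]

theorem exists_eps_mul_le (hι : StrictMono ι) (k : ℕ) (n : I.M nat) :
    ∃ m, ∀ l, m ≤ l → k * eps ι l ≤ eps ι n := by
  have key : ∃ m, k * eps ι m ≤ eps ι n := by
    induction k with
    | zero => exact ⟨n, by simpa using (eps_pos hι n).le⟩
    | succ k ih =>
      obtain ⟨m, hm⟩ := ih
      have h1 : eps ι (max m n + 1) ≤ eps ι m / 2 := by
        rw [eps_add_one]
        linarith [eps_anti hι (le_max_left m n)]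
      have h2 : eps ι (max m n + 1) ≤ eps ι n / 2 := by
        rw [eps_add_one]
        linarith [eps_anti hι (le_max_right m n)]
      refine ⟨max m n + 1, ?_⟩
      have h3 := mul_le_mul_of_nonneg_left h1 (Nat.cast_nonneg (α := R) k)
      push_cast
      linarith
  obtain ⟨m, hm⟩ := key
  exact ⟨m, fun l hl =>
    (mul_le_mul_of_nonneg_left (eps_anti hι hl) (Nat.cast_nonneg k)).trans hm⟩

namespace IsLimitMap

variable {lim : I.M Ty.one → R} (H : IsLimitMap ι lim)

include H

theorem isReal_constSeq (c : I.M nat) : IsReal (constSeq c) := by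
  have key : ∀ n, (Fr.code c).Lt ((Fr.code c).plus (.dyadic 1 n)) := by
    intro n
    have hd : 0 < ((Fr.code c).plus (.dyadic 1 n)).den := mul_pos (den_pos c) (twoPow_pos n)
    rw [Fr.lt_iff H.strictMono (den_pos _) hd, Fr.val_plus H.strictMono (den_pos _) (twoPow_pos n),
      Fr.val_dyadic]
    simpa using eps_pos H.strictMono n
  intro n i
  simp [key]

theorem lim_constSeq (c n : I.M nat) :
    lim (constSeq c) ≤ rat ι c + eps ι n ∧ rat ι c ≤ lim (constSeq c) + eps ι n := by
  have h1 := H.le_add _ (H.isReal_constSeq c) n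
  have h2 := H.le_lim _ (H.isReal_constSeq c) n
  rw [constSeq_app] at h1 h2
  exact ⟨h1, h2⟩

theorem realLt_iff {x y : I.M Ty.one} (hx : IsReal x) (hy : IsReal y) :
    RealLt x y ↔ FarLt ι (lim x) (lim y) := by
  have hι := H.strictMono
  have key : ∀ n, ((Fr.code (x n)).plus (.dyadic 2 n)).Lt (Fr.code (y n)) ↔
      ((Fr.code (x n)).plus (.dyadic 2 n)).val ι < (Fr.code (y n)).val ι :=
    fun n => Fr.lt_iff hι (mul_pos (den_pos _) (twoPow_pos n)) (den_pos _)
  have hval : ∀ n, ((Fr.code (x n)).plus (.dyadic 2 n)).val ι = rat ι (x n) + 2 * eps ι n :=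
    fun n => by rw [Fr.val_plus hι (den_pos _) (twoPow_pos n), Fr.val_dyadic]; rfl
  constructor
  · rintro ⟨n, hn⟩
    rw [key] at hn
    obtain ⟨m, hm⟩ := exists_eps_le hι (mul_pos (den_pos _) (twoPow_pos n)) (den_pos _) hn
    rw [hval] at hm
    have h1 := H.le_add x hx n
    have h2 := H.le_lim y hy n
    exact ⟨m, by change _ ≤ rat ι (y n) at hm; linarith⟩
  · rintro ⟨n, hn⟩
    obtain ⟨m, hm⟩ := exists_eps_mul_le hι 5 n
    have hm := hm m le_rfl
    refine ⟨m, (key m).2 ?_⟩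
    rw [hval]
    change _ < rat ι (y m)
    have h1 := H.le_lim x hx m
    have h2 := H.le_add y hy m
    have h3 := eps_pos hι m
    push_cast at hm
    linarith

theorem realLtAdd_iff {x y z : I.M Ty.one} (hx : IsReal x) (hy : IsReal y) (hz : IsReal z) :
    RealLtAdd x y z ↔ FarLt ι (lim x) (lim y + lim z) := by
  have hι := H.strictMono
  have hd : ∀ n, 0 < ((Fr.code (y n)).plus (Fr.code (z n))).den :=
    fun n => mul_pos (den_pos _) (den_pos _)
  have key : ∀ n, ((Fr.code (x n)).plus (.dyadic 3 n)).Lt ((Fr.code (y n)).plus (Fr.code (z n))) ↔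
      ((Fr.code (x n)).plus (.dyadic 3 n)).val ι < ((Fr.code (y n)).plus (Fr.code (z n))).val ι :=
    fun n => Fr.lt_iff hι (mul_pos (den_pos _) (twoPow_pos n)) (hd n)
  have hval : ∀ n, ((Fr.code (x n)).plus (.dyadic 3 n)).val ι = rat ι (x n) + 3 * eps ι n :=
    fun n => by rw [Fr.val_plus hι (den_pos _) (twoPow_pos n), Fr.val_dyadic]; rfl
  have hval' : ∀ n, ((Fr.code (y n)).plus (Fr.code (z n))).val ι = rat ι (y n) + rat ι (z n) :=
    fun n => Fr.val_plus hι (den_pos _) (den_pos _)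
  constructor
  · rintro ⟨n, hn⟩
    rw [key] at hn
    obtain ⟨m, hm⟩ := exists_eps_le hι (mul_pos (den_pos _) (twoPow_pos n)) (hd n) hn
    rw [hval, hval'] at hm
    have h1 := H.le_add x hx n
    have h2 := H.le_lim y hy n
    have h3 := H.le_lim z hz n
    exact ⟨m, by linarith⟩
  · rintro ⟨n, hn⟩
    obtain ⟨m, hm⟩ := exists_eps_mul_le hι 7 n
    have hm := hm m le_rfl
    refine ⟨m, (key m).2 ?_⟩
    rw [hval, hval']
    have h1 := H.le_lim x hx m
    have h2 := H.le_add y hy m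
    have h3 := H.le_add z hz m
    have h4 := eps_pos hι m
    push_cast at hm
    linarith

end IsLimitMap

end Limits

end Interp

namespace Interp

variable {I : Interp} [I.IsACA]

/-! ### Comparison up to infinitesimals -/

section Compare

variable {R : Type} [Field R] [LinearOrder R] [IsStrictOrderedRing R] {ι : I.M nat →+* R}

/-- `a ≤ b` up to differences which are smaller than all `2 ^ (-n)`. -/
def NearLe (ι : I.M nat →+* R) (a b : R) : Prop := ∀ n, a ≤ b + eps ι n

theorem NearLe.trans {a b c : R} (h : NearLe ι a b) (h' : NearLe ι b c) : NearLe ι a c := by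
  intro n
  have h1 := h (n + 1)
  have h2 := h' (n + 1)
  rw [eps_add_one] at h1 h2
  linarith

theorem NearLe.add {a b c d : R} (h : NearLe ι a b) (h' : NearLe ι c d) :
    NearLe ι (a + c) (b + d) := by
  intro n
  have h1 := h (n + 1)
  have h2 := h' (n + 1)
  rw [eps_add_one] at h1 h2
  linarith

theorem FarLt.trans_nearLe {a b c : R} (h : FarLt ι a b) (h' : NearLe ι b c) : FarLt ι a c := by
  obtain ⟨n, hn⟩ := h
  have h1 := h' (n + 1)
  refine ⟨n + 1, ?_⟩
  rw [eps_add_one] at h1 ⊢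
  linarith

theorem NearLe.trans_farLt {a b c : R} (h : NearLe ι a b) (h' : FarLt ι b c) : FarLt ι a c := by
  obtain ⟨n, hn⟩ := h'
  have h1 := h (n + 1)
  refine ⟨n + 1, ?_⟩
  rw [eps_add_one] at h1 ⊢
  linarith

variable (hι : StrictMono ι)

include hι

theorem not_farLt {a b : R} : ¬ FarLt ι a b ↔ NearLe ι b a := by
  simp only [FarLt, NearLe, not_exists, not_le]
  refine ⟨fun h n => (h n).le, fun h n => ?_⟩
  have h1 := h (n + 1)
  have h2 := eps_pos hι n
  rw [eps_add_one] at h1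
  linarith

theorem NearLe.of_le {a b : R} (h : a ≤ b) : NearLe ι a b := fun n => by
  linarith [eps_pos hι n]

theorem FarLt.lt {a b : R} (h : FarLt ι a b) : a < b := by
  obtain ⟨n, hn⟩ := h
  linarith [eps_pos hι n]

theorem FarLt.trans {a b c : R} (h : FarLt ι a b) (h' : FarLt ι b c) : FarLt ι a c :=
  h.trans_nearLe (.of_le hι (h'.lt hι).le)

end Compare

/-! ### Existence of reals -/

section Existence

/-- The sign `1` or `-1`. -/
def sgn (R : Type) [Field R] (s : Bool) : R := bif s then 1 else -1

/-- The terms of the sequence `z` are the rationals `y(n + 2) + w(n + 2)`, or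
`y(n + 2) - w(n + 2)`. -/
def IsSum (s : Bool) (y w z : I.M Ty.one) : Prop :=
  ∀ n, (Fr.code (z n)).Eqv ((Fr.code (y (n + 1 + 1))).plus ((Fr.code (w (n + 1 + 1))).signed s))

instance {X : Type} [Params I X] (s : Bool) (f g h : X → I.M Ty.one) [Poly f] [Poly g] [Poly h] :
    Dec I fun x => IsSum s (f x) (g x) (h x) := by
  have := Poly.comp_fst f nat
  have := Poly.comp_fst g nat
  have := Poly.comp_fst h nat
  unfold IsSum
  infer_instance

variable {R : Type} [Field R] {ι : I.M nat →+* R}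

theorem Fr.val_signed (s : Bool) (p : Fr I) : (p.signed s).val ι = sgn R s * p.val ι := by
  cases s
  · simp [signed, val, sgn, ← neg_div]
  · simp [signed, val, sgn]

theorem exists_rat_signed (s : Bool) (c : I.M nat) : ∃ e, rat ι e = sgn R s * rat ι c := by
  obtain ⟨e, he⟩ := exists_rat_eq_val (ι := ι) (p := (Fr.code c).signed s)
    (by rw [Fr.signed_den]; exact den_pos _)
  exact ⟨e, he.trans (Fr.val_signed _ _)⟩

theorem exists_rat_dyadic (k : ℕ) (n : I.M nat) : ∃ e, rat ι e = k * eps ι n := by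
  obtain ⟨e, he⟩ := exists_rat_eq_val (ι := ι) (p := Fr.dyadic k n) (twoPow_pos n)
  exact ⟨e, he.trans (Fr.val_dyadic _ _)⟩

section

variable [LinearOrder R] (hι : StrictMono ι)

include hι

theorem Fr.eqv_iff {p q : Fr I} (hp : 0 < p.den) (hq : 0 < q.den) :
    p.Eqv q ↔ p.val ι = q.val ι := by
  have h1 := map_pos_of_pos hι hp
  have h2 := map_pos_of_pos hι hq
  rw [Eqv, ← hι.injective.eq_iff, val, val, div_eq_div_iff h1.ne' h2.ne']
  simp only [map_add, map_mul]
  constructor <;> intro h <;> linear_combination h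

theorem exists_rat_add (c c' : I.M nat) : ∃ e, rat ι e = rat ι c + rat ι c' := by
  obtain ⟨e, he⟩ := exists_rat_eq_val (ι := ι) (p := (Fr.code c).plus (Fr.code c'))
    (mul_pos (den_pos _) (den_pos _))
  exact ⟨e, he.trans (Fr.val_plus hι (den_pos _) (den_pos _))⟩

theorem isReal_iff [IsStrictOrderedRing R] {x : I.M Ty.one} :
    IsReal x ↔ ∀ n i, rat ι (x n) < rat ι (x (n + i)) + eps ι n ∧
      rat ι (x (n + i)) < rat ι (x n) + eps ι n := by
  have hd : ∀ c n : I.M nat, 0 < ((Fr.code c).plus (.dyadic 1 n)).den := fun c n =>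
    mul_pos (den_pos c) (twoPow_pos n)
  refine forall_congr' fun n => forall_congr' fun i => ?_
  rw [Fr.lt_iff hι (den_pos _) (hd _ _), Fr.val_plus hι (den_pos _) (twoPow_pos n),
    Fr.lt_iff hι (den_pos _) (hd _ _), Fr.val_plus hι (den_pos _) (twoPow_pos n),
    Fr.val_dyadic, Nat.cast_one, one_mul]
  rfl

theorem isSum_iff {s : Bool} {y w z : I.M Ty.one} : IsSum s y w z ↔
    ∀ n, rat ι (z n) = rat ι (y (n + 1 + 1)) + sgn R s * rat ι (w (n + 1 + 1)) := by
  refine forall_congr' fun n => ?_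
  have h1 : 0 < ((Fr.code (w (n + 1 + 1))).signed s).den := by
    rw [Fr.signed_den]
    exact den_pos _
  rw [Fr.eqv_iff hι (den_pos _) (mul_pos (den_pos _) h1), Fr.val_plus hι (den_pos _) h1,
    Fr.val_signed]
  rfl

theorem exists_isSum (s : Bool) (y w : I.M Ty.one) : ∃ z, IsSum s y w z := by
  have h : ∀ n, ∃ c, (Fr.code c).Eqv
      ((Fr.code (y (n + 1 + 1))).plus ((Fr.code (w (n + 1 + 1))).signed s)) := by
    intro n
    have h1 : 0 < ((Fr.code (y (n + 1 + 1))).plus ((Fr.code (w (n + 1 + 1))).signed s)).den := by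
      refine mul_pos (den_pos _) ?_
      rw [Fr.signed_den]
      exact den_pos _
    obtain ⟨c, hc⟩ := exists_rat_eq_val (ι := ι) h1
    exact ⟨c, (Fr.eqv_iff hι (den_pos _) h1).2 hc⟩
  exact choice_nat_nat (fun n c => (Fr.code c).Eqv
    ((Fr.code (y (n + 1 + 1))).plus ((Fr.code (w (n + 1 + 1))).signed s))) h

end

variable [LinearOrder R] [IsStrictOrderedRing R] {lim : I.M Ty.one → R} (H : IsLimitMap ι lim)

namespace IsLimitMap

include H

theorem abs_lim_sub_rat_le {x : I.M Ty.one} (hx : IsReal x) (n : I.M nat) :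
    |lim x - rat ι (x n)| ≤ eps ι n :=
  abs_sub_le_iff.2 ⟨by linarith [H.le_add x hx n], by linarith [H.le_lim x hx n]⟩

theorem isReal_of_isSum {s : Bool} {y w z : I.M Ty.one} (hy : IsReal y) (hw : IsReal w)
    (hz : IsSum s y w z) : IsReal z := by
  have hι := H.strictMono
  rw [isSum_iff hι] at hz
  rw [isReal_iff hι]
  intro n i
  have h1 := ((isReal_iff hι).1 hy (n + 1 + 1) i)
  have h2 := ((isReal_iff hι).1 hw (n + 1 + 1) i)
  have h3 : n + 1 + 1 + i = n + i + 1 + 1 := by ring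
  have h4 := eps_pos hι n
  rw [hz, hz]
  rw [h3, eps_add_one, eps_add_one] at h1 h2
  cases s <;> simp only [sgn, cond_true, cond_false] <;> constructor <;> linarith

theorem lim_isSum {s : Bool} {y w z : I.M Ty.one} (hy : IsReal y) (hw : IsReal w)
    (hz : IsSum s y w z) :
    NearLe ι (lim z) (lim y + sgn R s * lim w) ∧ NearLe ι (lim y + sgn R s * lim w) (lim z) := by
  have hι := H.strictMono
  have hz' := H.isReal_of_isSum hy hw hz
  rw [isSum_iff hι] at hz
  have key : ∀ n, |lim z - (lim y + sgn R s * lim w)| ≤ eps ι n := by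
    intro n
    have h1 := abs_le.1 (H.abs_lim_sub_rat_le hz' (n + 1))
    have h2 := abs_le.1 (H.abs_lim_sub_rat_le hy (n + 1 + 1 + 1))
    have h3 := abs_le.1 (H.abs_lim_sub_rat_le hw (n + 1 + 1 + 1))
    rw [hz] at h1
    simp only [eps_add_one] at h1 h2 h3
    rw [abs_le]
    cases s <;> simp only [sgn, cond_true, cond_false] at h1 ⊢ <;> constructor <;> linarith
  exact ⟨fun n => by linarith [(abs_le.1 (key n)).2], fun n => by linarith [(abs_le.1 (key n)).1]⟩

/-- Close to every real there are rationals on both sides. -/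
theorem exists_rat_beside (s : Bool) {x : I.M Ty.one} (hx : IsReal x) (n : I.M nat) :
    ∃ c, eps ι n ≤ sgn R s * (rat ι c - lim x) ∧ sgn R s * (rat ι c - lim x) ≤ 3 * eps ι n := by
  have hι := H.strictMono
  obtain ⟨e, he⟩ := exists_rat_dyadic (ι := ι) 2 n
  obtain ⟨e', he'⟩ := exists_rat_signed (ι := ι) s e
  obtain ⟨c, hc⟩ := exists_rat_add hι (x n) e'
  have h1 := abs_le.1 (H.abs_lim_sub_rat_le hx n)
  refine ⟨c, ?_⟩
  rw [hc, he', he]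
  push_cast
  cases s <;> simp only [sgn, cond_true, cond_false] <;> constructor <;> linarith

end IsLimitMap

end Existence

end Interp

namespace Interp

variable {I : Interp} [I.IsACA]

section Unit

variable {R : Type} [Field R] {ι : I.M nat →+* R}

theorem rat_zero : rat ι ((0 : ℕ) : I.M nat) = 0 := by
  have h : IsCode (((0 : ℕ) : I.M nat)) 0 0 1 := ⟨0, 0, by simp [IsPair], by simp, .inl (by simp)⟩
  obtain ⟨h1, h2, h3⟩ := h.decode
  simp only [rat, Fr.val, Fr.code, ← h1, ← h2, ← h3, map_zero, map_one, sub_zero, div_one]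

theorem rat_three : rat ι ((3 : ℕ) : I.M nat) = 1 := by
  have h : IsCode (((3 : ℕ) : I.M nat)) 1 0 1 :=
    ⟨1 + 1, 0, by simp only [IsPair]; push_cast; ring, by simp, .inl (by simp)⟩
  obtain ⟨h1, h2, h3⟩ := h.decode
  simp only [rat, Fr.val, Fr.code, ← h1, ← h2, ← h3, map_zero, map_one, sub_zero, div_one]

variable [LinearOrder R] [IsStrictOrderedRing R]

variable {lim : I.M Ty.one → R} (H : IsLimitMap ι lim)

namespace IsLimitMap

include H

theorem nearLe_constSeq (c : I.M nat) :
    NearLe ι (lim (constSeq c)) (rat ι c) ∧ NearLe ι (rat ι c) (lim (constSeq c)) :=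
  ⟨fun n => (H.lim_constSeq c n).1, fun n => (H.lim_constSeq c n).2⟩

theorem inUnit_iff {x : I.M Ty.one} :
    InUnit x ↔ IsReal x ∧ NearLe ι 0 (lim x) ∧ NearLe ι (lim x) 1 := by
  have hι := H.strictMono
  have h0 := H.nearLe_constSeq (0 : ℕ)
  have h1 := H.nearLe_constSeq (3 : ℕ)
  rw [rat_zero] at h0
  rw [rat_three] at h1
  refine and_congr_right fun hx => ?_
  rw [H.realLt_iff hx (H.isReal_constSeq _), H.realLt_iff (H.isReal_constSeq _) hx,
    not_farLt hι, not_farLt hι]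
  exact ⟨fun h => ⟨h0.2.trans h.1, h.2.trans h1.1⟩, fun h => ⟨h0.1.trans h.1, h.2.trans h1.2⟩⟩

theorem inBall_iff {z c r : I.M Ty.one} (hz : IsReal z) (hc : IsReal c) (hr : IsReal r) :
    InBall z c r ↔ FarLt ι (lim c) (lim z + lim r) ∧ FarLt ι (lim z) (lim c + lim r) := by
  rw [InBall, H.realLtAdd_iff hc hz hr, H.realLtAdd_iff hz hc hr]

/-! ### Endpoints of intervals -/

/-- An endpoint in `[0, 1]` of an interval with centre in `[0, 1]` is determined by the trace of the
interval on `[0, 1]`, up to infinitesimals. -/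
theorem endpoint_near {f : I.M Ty.fn} {y w p : I.M Ty.one} (s : Bool)
    (hy : InUnit y) (hw : InUnit w) (hfy : IsReal (f y)) (hfw : IsReal (f w))
    (hp : InUnit p) (hpy : InIvl f y p)
    (hset : ∀ z, InUnit z → (InIvl f y z ↔ InIvl f w z))
    (h0 : NearLe ι 0 (lim y + sgn R s * lim (f y))) (h1 : NearLe ι (lim y + sgn R s * lim (f y)) 1) :
    NearLe ι (lim y + sgn R s * lim (f y)) (lim w + sgn R s * lim (f w)) ∧
      NearLe ι (lim w + sgn R s * lim (f w)) (lim y + sgn R s * lim (f y)) := by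
  have hι := H.strictMono
  have hU : ∀ {z : I.M Ty.one}, InUnit z ↔ IsReal z ∧ NearLe ι 0 (lim z) ∧ NearLe ι (lim z) 1 :=
    H.inUnit_iff
  obtain ⟨hyr, hy0, hy1⟩ := hU.1 hy
  obtain ⟨hwr, -, -⟩ := hU.1 hw
  have hpr := (hU.1 hp).1
  have hpw := (hset p hp).1 hpy
  have ivl_y : ∀ z, IsReal z → (InIvl f y z ↔
      FarLt ι (lim y) (lim z + lim (f y)) ∧ FarLt ι (lim z) (lim y + lim (f y))) :=
    fun z hz => H.inBall_iff hz hyr hfy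
  have ivl_w : ∀ z, IsReal z → (InIvl f w z ↔
      FarLt ι (lim w) (lim z + lim (f w)) ∧ FarLt ι (lim z) (lim w + lim (f w))) :=
    fun z hz => H.inBall_iff hz hwr hfw
  obtain ⟨⟨n1, hn1⟩, ⟨n2, hn2⟩⟩ := (ivl_y p hpr).1 hpy
  obtain ⟨⟨n3, hn3⟩, ⟨n4, hn4⟩⟩ := (ivl_w p hpr).1 hpw
  obtain ⟨e, he⟩ := exists_isSum hι s y (f y)
  have her := H.isReal_of_isSum hyr hfy he
  obtain ⟨he1, he2⟩ := H.lim_isSum hyr hfy he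
  have heU : InUnit e := hU.2 ⟨her, h0.trans he2, he1.trans h1⟩
  have hpos := fun n => eps_pos hι n
  -- the endpoint itself is not in the interval with centre `w`
  have hew : ¬ InIvl f w e := by
    rw [← hset e heU, ivl_y e her]
    rintro ⟨⟨n, hn⟩, ⟨m, hm⟩⟩
    have h3 := he1 (n + 1)
    have h4 := he2 (n + 1)
    have h5 := he1 (m + 1)
    have h6 := he2 (m + 1)
    have := hpos n
    have := hpos m
    rw [eps_add_one] at h3 h4 h5 h6
    cases s <;> simp only [sgn, cond_true, cond_false] at h3 h4 h5 h6 <;> linarith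
  have hp0 := (hU.1 hp).2.1
  have hp1 := (hU.1 hp).2.2
  have key1 : ¬ FarLt ι (sgn R s * (lim y + sgn R s * lim (f y)))
      (sgn R s * (lim w + sgn R s * lim (f w))) := by
    rintro ⟨m, hm⟩
    -- the endpoint would be in the interval with centre `w`
    apply hew
    rw [ivl_w e her]
    have h3 := fun n => he1 (n + 1)
    have h4 := fun n => he2 (n + 1)
    simp only [eps_add_one] at h3 h4
    have e1 := hpos n1
    have e2 := hpos n2
    have e3 := hpos n3
    have e4 := hpos n4
    have e5 := hpos m
    cases s <;> simp only [sgn, cond_true, cond_false] at h3 h4 hm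
    · refine ⟨⟨m + 1, ?_⟩, ⟨n1 + 1, ?_⟩⟩
      · rw [eps_add_one]
        linarith [h4 m]
      · rw [eps_add_one]
        linarith [h3 n1]
    · refine ⟨⟨n2 + 1, ?_⟩, ⟨m + 1, ?_⟩⟩
      · rw [eps_add_one]
        linarith [h4 n2]
      · rw [eps_add_one]
        linarith [h3 m]
  have key2 : ¬ FarLt ι (sgn R s * (lim w + sgn R s * lim (f w)))
      (sgn R s * (lim y + sgn R s * lim (f y))) := by
    rintro ⟨m, hm⟩
    -- a point between the two endpoints is only in the interval with centre `y`
    obtain ⟨n, hn⟩ := exists_eps_mul_le hι 8 m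
    have hn := hn n le_rfl
    push_cast at hn
    obtain ⟨c, hc1, hc2⟩ := H.exists_rat_beside (!s) her n
    have hz := H.isReal_constSeq c
    obtain ⟨hz1, hz2⟩ := H.lim_constSeq c (n + 1 + 1)
    have h3 := he1 (n + 1 + 1)
    have h4 := he2 (n + 1 + 1)
    simp only [eps_add_one] at hz1 hz2 h3 h4
    have hn0 := hpos n
    have hzU : InUnit (constSeq c) := by
      refine hU.2 ⟨hz, ?_, ?_⟩ <;> intro k
      · have := h0 k
        have := hp0 k
        cases s <;> simp only [sgn, Bool.not_true, Bool.not_false, cond_true, cond_false] at * <;>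
          linarith [hpos n1, hpos n2, hpos n3, hpos n4]
      · have := h1 k
        have := hp1 k
        cases s <;> simp only [sgn, Bool.not_true, Bool.not_false, cond_true, cond_false] at * <;>
          linarith [hpos n1, hpos n2, hpos n3, hpos n4]
    have hzy : InIvl f y (constSeq c) := by
      rw [ivl_y _ hz]
      cases s <;> simp only [sgn, Bool.not_true, Bool.not_false, cond_true, cond_false] at *
      · refine ⟨⟨n + 1 + 1, ?_⟩, ⟨n2, ?_⟩⟩
        · simp only [eps_add_one]
          linarith
        · linarith [hpos n1, hpos n3, hpos n4]
      · refine ⟨⟨n1, ?_⟩, ⟨n + 1 + 1, ?_⟩⟩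
        · linarith [hpos n2, hpos n3, hpos n4]
        · simp only [eps_add_one]
          linarith
    obtain ⟨⟨k1, hk1⟩, ⟨k2, hk2⟩⟩ := (ivl_w _ hz).1 ((hset _ hzU).1 hzy)
    have := hpos k1
    have := hpos k2
    cases s <;> simp only [sgn, Bool.not_true, Bool.not_false, cond_true, cond_false] at * <;>
      linarith
  rw [not_farLt hι] at key1 key2
  cases s <;> simp only [sgn, cond_true, cond_false] at key1 key2 ⊢
  · exact ⟨fun n => by linarith [key1 n], fun n => by linarith [key2 n]⟩
  · exact ⟨fun n => by linarith [key2 n], fun n => by linarith [key1 n]⟩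

end IsLimitMap

end Unit

end Interp

namespace Interp

variable {I : Interp} [I.IsACA]

/-! ### Cluster points of sequences of grid points -/

/-- The fraction `j / 2 ^ n`. -/
def Fr.grid (j n : I.M nat) : Fr I := ⟨j, 0, twoPow n⟩

instance {X : Type} [Params I X] (j n : X → I.M nat) [Poly j] [Poly n] :
    Fr.IsPolyFr fun x => Fr.grid (j x) (n x) := by
  constructor <;> unfold Fr.grid <;> infer_instance

/-- Infinitely many of the numbers `i(m) / 2 ^ m` are at least `j / 2 ^ n`. -/
def OftenGe (i : I.M Ty.one) (n j : I.M nat) : Prop :=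
  ∀ k, ∃ m, k ≤ m ∧ j * twoPow m ≤ i m * twoPow n

instance {X : Type} [Params I X] (i : X → I.M Ty.one) (n j : X → I.M nat) [Poly i] [Poly j]
    [Poly n] : Dec I fun x => OftenGe (i x) (n x) (j x) := by
  have := Poly.comp_fst i nat
  have := Poly.comp_fst n nat
  have := Poly.comp_fst j nat
  have := Poly.comp_fst (fun z : X × I.M nat => i z.1) nat
  have := Poly.comp_fst (fun z : X × I.M nat => n z.1) nat
  have := Poly.comp_fst (fun z : X × I.M nat => j z.1) nat
  unfold OftenGe
  infer_instance

section Cluster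

variable {R : Type} [Field R] {ι : I.M nat →+* R}

theorem Fr.val_grid (j n : I.M nat) : (Fr.grid j n).val ι = ι j * eps ι n := by
  simp [val, grid, eps, div_eq_mul_inv]

variable [LinearOrder R]

theorem eqv_grid_iff (hι : StrictMono ι) {c j n : I.M nat} :
    (Fr.code c).Eqv (Fr.grid j n) ↔ rat ι c = ι j * eps ι n := by
  rw [Fr.eqv_iff hι (den_pos _) (twoPow_pos n), Fr.val_grid]
  rfl

theorem exists_eqv_grid (hι : StrictMono ι) (j n : I.M nat) :
    ∃ c, (Fr.code c).Eqv (Fr.grid j n) := by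
  obtain ⟨c, hc⟩ := exists_rat_eq_val (ι := ι) (p := Fr.grid j n) (twoPow_pos n)
  exact ⟨c, (Fr.eqv_iff hι (den_pos _) (twoPow_pos n)).2 hc⟩

variable [IsStrictOrderedRing R]

theorem mul_eps_le_iff (hι : StrictMono ι) {j n i m : I.M nat} :
    ι j * eps ι n ≤ ι i * eps ι m ↔ j * twoPow m ≤ i * twoPow n := by
  have h1 := map_pos_of_pos hι (twoPow_pos m)
  have h2 := map_pos_of_pos hι (twoPow_pos n)
  rw [eps, eps, ← div_eq_mul_inv, ← div_eq_mul_inv, div_le_div_iff₀ h2 h1, ← hι.le_iff_le,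
    map_mul, map_mul]

variable {lim : I.M Ty.one → R} (H : IsLimitMap ι lim)

include H

/-- The limit superior of the sequence of the `i(m) / 2 ^ m` is definable with quantifiers of type
`0`: its `n`-th approximation is the largest multiple of `2 ^ (-n-1)` which infinitely many terms
reach. -/
theorem IsLimitMap.exists_cluster (i : I.M Ty.one) (hi : ∀ m, i m < twoPow m) :
    ∃ x, InUnit x ∧ ∀ n k, ∃ m, k ≤ m ∧ |lim x - ι (i m) * eps ι m| ≤ eps ι n := by
  have hι := H.strictMono
  have hex : ∀ n, ∃ j, OftenGe i n j ∧ ¬ OftenGe i n (j + 1) := by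
    intro n
    by_contra h
    push Not at h
    have h1 := induction (fun j => OftenGe i n j) (fun k => ⟨k, le_rfl, by rw [zero_mul]; exact Interp.zero_le _⟩)
      h (twoPow n)
    obtain ⟨m, -, hm⟩ := h1 0
    rw [mul_comm] at hm
    exact absurd (le_of_mul_le_mul_right hm (twoPow_pos n)) (not_le.2 (hi m))
  obtain ⟨x, hx⟩ := choice_nat_nat
    (fun n c => ∃ j, (Fr.code c).Eqv (Fr.grid j (n + 1)) ∧ OftenGe i (n + 1) j ∧ ¬ OftenGe i (n + 1) (j + 1))
    fun n => by
      obtain ⟨j, hj⟩ := hex (n + 1)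
      obtain ⟨c, hc⟩ := exists_eqv_grid hι j (n + 1)
      exact ⟨c, j, hc, hj⟩
  have hlow : ∀ n k, ∃ m, k ≤ m ∧ rat ι (x n) ≤ ι (i m) * eps ι m := by
    intro n k
    obtain ⟨j, hj, hP, -⟩ := hx n
    obtain ⟨m, hm, h⟩ := hP k
    exact ⟨m, hm, by rwa [(eqv_grid_iff hι).1 hj, mul_eps_le_iff hι]⟩
  have hupp : ∀ n, ∃ k, ∀ m, k ≤ m → ι (i m) * eps ι m < rat ι (x n) + eps ι n / 2 := by
    intro n
    obtain ⟨j, hj, -, hP⟩ := hx n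
    simp only [OftenGe, not_forall, not_exists, not_and] at hP
    obtain ⟨k, hk⟩ := hP
    refine ⟨k, fun m hm => ?_⟩
    have := hk m hm
    rw [← mul_eps_le_iff hι, not_le, map_add, map_one, add_mul, one_mul] at this
    rwa [(eqv_grid_iff hι).1 hj, ← eps_add_one]
  have hcomp : ∀ n n', rat ι (x n) < rat ι (x n') + eps ι n' / 2 := by
    intro n n'
    obtain ⟨k, hk⟩ := hupp n'
    obtain ⟨m, hm, h⟩ := hlow n k
    exact h.trans_lt (hk m hm)
  have hxr : IsReal x := by
    rw [isReal_iff hι]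
    intro n l
    have h1 := hcomp n (n + l)
    have h2 := hcomp (n + l) n
    have h3 := eps_pos hι n
    have h4 := eps_anti hι (m := n) (n := n + l) (le_add_of_nonneg_right (Interp.zero_le _))
    constructor <;> linarith
  refine ⟨x, H.inUnit_iff.2 ⟨hxr, fun n => ?_, fun n => ?_⟩, fun n k => ?_⟩
  · have h1 := H.le_lim x hxr n
    obtain ⟨j, hj, -, -⟩ := hx n
    have h2 : 0 ≤ rat ι (x n) := by
      rw [(eqv_grid_iff hι).1 hj]
      have h3 := hι.monotone (Interp.zero_le j)
      rw [map_zero] at h3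
      exact mul_nonneg h3 (eps_pos hι _).le
    linarith
  · have h1 := H.le_add x hxr n
    obtain ⟨m, -, h⟩ := hlow n 0
    have h2 : ι (i m) * eps ι m ≤ 1 := by
      rw [eps, ← div_eq_mul_inv, div_le_one (map_pos_of_pos hι (twoPow_pos m))]
      exact (hι (hi m)).le
    linarith
  · obtain ⟨k', hk'⟩ := hupp (n + 1)
    obtain ⟨m, hm, h⟩ := hlow (n + 1) (max k k')
    have h1 := hk' m ((le_max_right _ _).trans hm)
    have h2 := abs_le.1 (H.abs_lim_sub_rat_le hxr (n + 1))
    have h3 := eps_pos hι n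
    rw [eps_add_one] at h1 h2
    exact ⟨m, (le_max_left _ _).trans hm, abs_le.2 ⟨by linarith, by linarith⟩⟩

end Cluster

end Interp

namespace Interp

variable {I : Interp} [I.IsACA]

/-! ### Uniform gaps between finitely many reals -/

theorem exists_forall_lt_le (g : I.M Ty.one) (k : I.M nat) : ∃ B, ∀ j < k, g j ≤ B := by
  refine induction (fun k => ∃ B, ∀ j, j < k → g j ≤ B)
    ⟨0, fun j hj => absurd hj (not_lt.2 (Interp.zero_le j))⟩ ?_ k
  rintro k ⟨B, hB⟩
  refine ⟨max B (g k), fun j hj => ?_⟩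
  rcases (lt_add_one_iff.1 hj).lt_or_eq with h | rfl
  · exact (hB j h).trans (le_max_left _ _)
  · exact le_max_right _ _

/-- The `n`-th approximations of the reals `x` and `y` witness that `x < y`, with a margin. -/
def Gap (x y : I.M Ty.one) (n : I.M nat) : Prop :=
  ((Fr.code (x n)).plus (.dyadic 3 n)).Lt (Fr.code (y n))

instance {X : Type} [Params I X] (f g : X → I.M Ty.one) (n : X → I.M nat) [Poly f] [Poly g]
    [Poly n] : Dec I fun x => Gap (f x) (g x) (n x) := by
  unfold Gap
  infer_instance

section Gaps

variable {R : Type} [Field R] [LinearOrder R] [IsStrictOrderedRing R] {ι : I.M nat →+* R}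
  {lim : I.M Ty.one → R} (H : IsLimitMap ι lim)

namespace IsLimitMap

include H

theorem gap_iff {x y : I.M Ty.one} {n : I.M nat} :
    Gap x y n ↔ rat ι (x n) + 3 * eps ι n < rat ι (y n) := by
  have hι := H.strictMono
  rw [Gap, Fr.lt_iff hι (mul_pos (den_pos _) (twoPow_pos n)) (den_pos _),
    Fr.val_plus hι (den_pos _) (twoPow_pos n), Fr.val_dyadic]
  rfl

theorem exists_gap {x y : I.M Ty.one} (hx : IsReal x) (hy : IsReal y)
    (h : FarLt ι (lim x) (lim y)) : ∃ n, Gap x y n := by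
  have hι := H.strictMono
  obtain ⟨n, hn⟩ := h
  obtain ⟨m, hm⟩ := exists_eps_mul_le hι 6 n
  have hm := hm m le_rfl
  refine ⟨m, H.gap_iff.2 ?_⟩
  push_cast at hm
  linarith [H.le_lim x hx m, H.le_add y hy m, eps_pos hι m]

theorem add_eps_le_of_gap {x y : I.M Ty.one} (hx : IsReal x) (hy : IsReal y) {n : I.M nat}
    (h : Gap x y n) : lim x + eps ι n ≤ lim y := by
  linarith [H.le_lim y hy n, H.le_add x hx n, H.gap_iff.1 h]

/-- For finitely many reals, the differences which are not infinitesimal are bounded away from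
zero. -/
theorem exists_uniform_gap (u w : I.M (nat ⇒ Ty.one)) (k : I.M nat)
    (hu : ∀ j < k, IsReal (u j)) (hw : ∀ j < k, IsReal (w j)) :
    ∃ N, ∀ j < k, ∀ j' < k, FarLt ι (lim (u j)) (lim (w j')) →
      lim (u j) + eps ι N ≤ lim (w j') := by
  have hrow : ∀ j, ∃ N, ∀ j', j' < k → (∃ n, Gap (u j) (w j') n) →
      ∃ n, n ≤ N ∧ Gap (u j) (w j') n := by
    intro j
    obtain ⟨g, hg⟩ := choice_nat_nat
      (fun j' N => (∃ n, Gap (u j) (w j') n) → Gap (u j) (w j') N) fun j' => by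
        by_cases h : ∃ n, Gap (u j) (w j') n
        · exact h.imp fun n hn _ => hn
        · exact ⟨0, fun h' => absurd h' h⟩
    obtain ⟨B, hB⟩ := exists_forall_lt_le g k
    exact ⟨B, fun j' hj' h => ⟨g j', hB j' hj', hg j' h⟩⟩
  obtain ⟨g, hg⟩ := choice_nat_nat (fun j N => ∀ j', j' < k → (∃ n, Gap (u j) (w j') n) →
      ∃ n, n ≤ N ∧ Gap (u j) (w j') n) hrow
  obtain ⟨B, hB⟩ := exists_forall_lt_le g k
  refine ⟨B, fun j hj j' hj' h => ?_⟩
  obtain ⟨n, hn, h'⟩ := hg j j' hj' (H.exists_gap (hu j hj) (hw j' hj') h)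
  have h1 := H.add_eps_le_of_gap (hu j hj) (hw j' hj') h'
  have h2 := eps_anti H.strictMono (hn.trans (hB j hj))
  linarith

end IsLimitMap

end Gaps

/-! ### Grids -/

/-- `G m i` is a code of `i / 2 ^ m`. -/
def IsGrid (G : I.M (nat ⇒ Ty.one)) : Prop := ∀ m i, (Fr.code (G m i)).Eqv (Fr.grid i m)

variable (I) in
theorem exists_isGrid : ∃ G : I.M (nat ⇒ Ty.one), IsGrid G := by
  obtain ⟨K, _, _, _, κ, hκ⟩ := exists_embedding I
  exact choice_nat_one (fun m y => ∀ i, (Fr.code (y i)).Eqv (Fr.grid i m)) fun m =>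
    choice_nat_nat (fun i c => (Fr.code c).Eqv (Fr.grid i m)) fun i => exists_eqv_grid hκ i m

/-! ### Functions on the unit interval -/

/-- `f` maps elements of `[0, 1]` to reals. -/
def RealValued (f : I.M Ty.fn) : Prop := ∀ x, InUnit x → IsReal (f x)

/-- The intervals given by `f` cover `[0, 1]`. -/
def Covers (f : I.M Ty.fn) : Prop := ∀ x, InUnit x → ∃ y, InUnit y ∧ InIvl f y x

/-- The cover given by `g` is a refinement of the one given by `f`. -/
def Refines (g f : I.M Ty.fn) : Prop :=
  ∀ x, InUnit x → ∃ y, InUnit y ∧ ∀ z, IsReal z → InIvl g x z → InIvl f y z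

/-- The traces on `[0, 1]` of the intervals given by `f` form a locally finite collection. -/
def LocallyFinite (f : I.M Ty.fn) : Prop :=
  ∀ x, InUnit x → ∃ e, (IsReal e ∧ RealLt (constSeq (0 : ℕ)) e) ∧ ∃ (k : I.M nat)
    (Z : I.M (nat ⇒ Ty.one)), (∀ i, i < k → InUnit (Z i)) ∧ ∀ y, InUnit y →
      (∃ z, InUnit z ∧ InBall z x e ∧ InIvl f y z) →
      ∃ i, i < k ∧ ∀ z, InUnit z → (InIvl f y z ↔ InIvl f (Z i) z)

section Endpoints

variable {R : Type} [Field R] [LinearOrder R] [IsStrictOrderedRing R] {ι : I.M nat →+* R}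
  {lim : I.M Ty.one → R} (H : IsLimitMap ι lim) {G : I.M (nat ⇒ Ty.one)} (hG : IsGrid G)

namespace IsLimitMap

include H hG

theorem nearLe_grid (m i : I.M nat) : NearLe ι (lim (constSeq (G m i))) (ι i * eps ι m) ∧
    NearLe ι (ι i * eps ι m) (lim (constSeq (G m i))) := by
  rw [← (eqv_grid_iff H.strictMono).1 (hG m i)]
  exact H.nearLe_constSeq _

theorem inUnit_grid {m i : I.M nat} (hi : i ≤ twoPow m) : InUnit (constSeq (G m i)) := by
  have hι := H.strictMono
  obtain ⟨h1, h2⟩ := H.nearLe_grid hG m i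
  have h3 := hι.monotone (Interp.zero_le i)
  rw [map_zero] at h3
  refine H.inUnit_iff.2 ⟨H.isReal_constSeq _, (NearLe.of_le hι ?_).trans h2,
    h1.trans (NearLe.of_le hι ?_)⟩
  · exact mul_nonneg h3 (eps_pos hι m).le
  · rw [eps, ← div_eq_mul_inv, div_le_one (map_pos_of_pos hι (twoPow_pos m))]
    exact hι.monotone hi

/-- If no single interval of a cover contains two adjacent grid points `p < p'`, then an interval
which contains `p` has its right endpoint in `(p, p']`, and an interval which contains this endpoint
has one of its own endpoints in `[p, p']`. -/
theorem exists_near_endpoints {g : I.M Ty.fn} (hg : RealValued g) {m i : I.M nat}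
    (hi : i < twoPow m) {y₁ y₂ e : I.M Ty.one} (hy₁ : InUnit y₁)
    (hy₂ : InUnit e → InUnit y₂ ∧ InIvl g y₂ e) (he : IsSum true y₁ (g y₁) e)
    (h₁ : InIvl g y₁ (constSeq (G m i))) (h₁' : ¬ InIvl g y₁ (constSeq (G m (i + 1))))
    (h₂ : InUnit y₂ → ¬ (InIvl g y₂ (constSeq (G m i)) ∧ InIvl g y₂ (constSeq (G m (i + 1))))) :
    InUnit e ∧ |lim e - ι i * eps ι m| ≤ 2 * eps ι m ∧
      NearLe ι 0 (lim y₁ + lim (g y₁)) ∧ NearLe ι (lim y₁ + lim (g y₁)) 1 ∧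
      ∃ s, NearLe ι 0 (lim y₂ + sgn R s * lim (g y₂)) ∧
        NearLe ι (lim y₂ + sgn R s * lim (g y₂)) 1 ∧
        |lim y₁ + lim (g y₁) - (lim y₂ + sgn R s * lim (g y₂))| ≤ 2 * eps ι m ∧
        (FarLt ι (lim y₁ + lim (g y₁)) (lim y₂ + sgn R s * lim (g y₂)) ∨
          FarLt ι (lim y₂ + sgn R s * lim (g y₂)) (lim y₁ + lim (g y₁))) := by
  have hι := H.strictMono
  have hpr := H.isReal_constSeq (G m i)
  have hpr' := H.isReal_constSeq (G m (i + 1))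
  obtain ⟨hp1, hp2⟩ := H.nearLe_grid hG m i
  obtain ⟨hp1', hp2'⟩ := H.nearLe_grid hG m (i + 1)
  obtain ⟨-, hp0, -⟩ := H.inUnit_iff.1 (H.inUnit_grid hG hi.le)
  obtain ⟨-, -, hp1U⟩ := H.inUnit_iff.1 (H.inUnit_grid hG (add_one_le_of_lt hi))
  generalize constSeq (G m i) = p at *
  generalize constSeq (G m (i + 1)) = p' at *
  rw [map_add, map_one, add_mul, one_mul] at hp1' hp2'
  have hd := eps_pos hι m
  have hpp : NearLe ι (lim p) (lim p') := hp1.trans ((NearLe.of_le hι (by linarith)).trans hp2')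
  have hy₁r := hy₁.1
  have hr₁ := hg y₁ hy₁
  obtain ⟨h3, h4⟩ := (H.inBall_iff hpr hy₁r hr₁).1 h₁
  have add_right : ∀ {a b : R} (c : R), NearLe ι a b → NearLe ι (a + c) (b + c) := fun c h =>
    h.add (.of_le hι le_rfl)
  have h5 : NearLe ι (lim y₁ + lim (g y₁)) (lim p') := by
    rw [← not_farLt hι]
    exact fun h => h₁' ((H.inBall_iff hpr' hy₁r hr₁).2 ⟨h3.trans_nearLe (add_right _ hpp), h⟩)
  have her := H.isReal_of_isSum hy₁r hr₁ he
  obtain ⟨he1, he2⟩ := H.lim_isSum hy₁r hr₁ he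
  simp only [sgn, cond_true, one_mul] at he1 he2
  have hA0 : NearLe ι 0 (lim y₁ + lim (g y₁)) := hp0.trans (.of_le hι (h4.lt hι).le)
  have hA1 := h5.trans hp1U
  have heU : InUnit e := H.inUnit_iff.2 ⟨her, hA0.trans he2, he1.trans hA1⟩
  obtain ⟨hy₂U, h6⟩ := hy₂ heU
  have h₂ := h₂ hy₂U
  have hy₂r := hy₂U.1
  have hr₂ := hg y₂ hy₂U
  obtain ⟨h6, h7⟩ := (H.inBall_iff her hy₂r hr₂).1 h6
  have hep' := he1.trans h5
  have hA1e : NearLe ι (lim p) (lim y₁ + lim (g y₁)) := .of_le hι (h4.lt hι).le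
  have b1 := hp1 (m + 1 + 1 + 1)
  have b2 := hp2 (m + 1 + 1 + 1)
  have b3 := hp1' (m + 1 + 1 + 1)
  have b4 := hp2' (m + 1 + 1 + 1)
  have b5 := he1 (m + 1 + 1 + 1)
  have b6 := he2 (m + 1 + 1 + 1)
  have b7 := h5 (m + 1 + 1 + 1)
  have b8 := hA1e (m + 1 + 1 + 1)
  simp only [eps_add_one] at b1 b2 b3 b4 b5 b6 b7 b8
  refine ⟨heU, abs_le.2 ⟨by linarith, by linarith⟩, hA0, hA1, ?_⟩
  by_cases hp2 : InIvl g y₂ p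
  · have h8 : NearLe ι (lim y₂ + lim (g y₂)) (lim p') := by
      rw [← not_farLt hι]
      exact fun h => h₂ ⟨hp2, (H.inBall_iff hpr' hy₂r hr₂).2
        ⟨h6.trans_nearLe (add_right _ hep'), h⟩⟩
    have h9 := he2.trans_farLt h7
    have b9 := h8 (m + 1 + 1 + 1)
    have b10 := h9.lt hι
    simp only [eps_add_one] at b9
    refine ⟨true, ?_⟩
    simp only [sgn, cond_true, one_mul]
    exact ⟨hA0.trans (.of_le hι b10.le), h8.trans hp1U, abs_le.2 ⟨by linarith, by linarith⟩,
      .inl h9⟩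
  · have h8 : NearLe ι (lim p + lim (g y₂)) (lim y₂) := by
      rw [← not_farLt hι]
      exact fun h => hp2 ((H.inBall_iff hpr hy₂r hr₂).2
        ⟨h, (h4.trans_nearLe he2).trans hι h7⟩)
    have h8 : NearLe ι (lim p) (lim y₂ - lim (g y₂)) := fun n => by linarith [h8 n]
    obtain ⟨n, hn⟩ := h6
    have h9 : FarLt ι (lim y₂ - lim (g y₂)) (lim e) := ⟨n, by linarith⟩
    have h10 := h9.trans_nearLe he1
    have b9 := h8 (m + 1 + 1 + 1)
    have b10 := h10.lt hι
    simp only [eps_add_one] at b9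
    refine ⟨false, ?_⟩
    simp only [sgn, cond_false, neg_mul, one_mul, ← sub_eq_add_neg]
    exact ⟨hp0.trans h8, (NearLe.of_le hι b10.le).trans hA1, abs_le.2 ⟨by linarith, by linarith⟩,
      .inr h10⟩

end IsLimitMap

end Endpoints

end Interp

namespace Interp

variable {I : Interp} [I.IsACA]

/-! ### Locally finite covers have Lebesgue numbers -/

section Lebesgue

variable {R : Type} [Field R] [LinearOrder R] [IsStrictOrderedRing R] {ι : I.M nat →+* R}
  {lim : I.M Ty.one → R} (H : IsLimitMap ι lim) {G : I.M (nat ⇒ Ty.one)} (hG : IsGrid G)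

namespace IsLimitMap

include H hG

set_option synthInstance.maxSize 1000 in
/-- If a locally finite cover does not have a Lebesgue number, then, around a cluster point, there
are arbitrarily close different endpoints of intervals. -/
theorem exists_close_endpoints {g : I.M Ty.fn} (hg : RealValued g) (hc : Covers g)
    (h : ∀ m, ∃ i < twoPow m, ∀ y, InUnit y →
      ¬ (InIvl g y (constSeq (G m i)) ∧ InIvl g y (constSeq (G m (i + 1))))) :
    ∃ x, InUnit x ∧ ∀ n, ∃ m y₁ y₂ p e, n ≤ m ∧ InUnit y₁ ∧ InUnit y₂ ∧ InUnit p ∧ InUnit e ∧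
      |lim x - lim p| ≤ eps ι n ∧ |lim x - lim e| ≤ eps ι n ∧ InIvl g y₁ p ∧ InIvl g y₂ e ∧
      NearLe ι 0 (lim y₁ + lim (g y₁)) ∧ NearLe ι (lim y₁ + lim (g y₁)) 1 ∧
      ∃ s, NearLe ι 0 (lim y₂ + sgn R s * lim (g y₂)) ∧
        NearLe ι (lim y₂ + sgn R s * lim (g y₂)) 1 ∧
        |lim y₁ + lim (g y₁) - (lim y₂ + sgn R s * lim (g y₂))| ≤ 2 * eps ι m ∧
        (FarLt ι (lim y₁ + lim (g y₁)) (lim y₂ + sgn R s * lim (g y₂)) ∨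
          FarLt ι (lim y₂ + sgn R s * lim (g y₂)) (lim y₁ + lim (g y₁))) := by
  have hι := H.strictMono
  obtain ⟨Y, hY⟩ := choice_one_one (fun x y : I.M Ty.one => InUnit x → InUnit y ∧ InIvl g y x) fun x => by
    by_cases hx : InUnit x
    · exact (hc x hx).imp fun y hy _ => hy
    · exact ⟨x, fun h => absurd h hx⟩
  obtain ⟨E, hE⟩ := choice_one_one (fun y z : I.M Ty.one => IsSum true y (g y) z) fun y =>
    exists_isSum hι true y (g y)
  -- the interval with centre `Y(x)` contains `x`, and has the right endpoint `E(Y(x))`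
  obtain ⟨i, hi⟩ := choice_nat_nat (fun m i : I.M nat => i < twoPow m ∧
      (¬ InIvl g (Y (constSeq (G m i))) (constSeq (G m (i + 1)))) ∧
      (InUnit (Y (E (Y (constSeq (G m i))))) →
        ¬ (InIvl g (Y (E (Y (constSeq (G m i))))) (constSeq (G m i)) ∧
          InIvl g (Y (E (Y (constSeq (G m i))))) (constSeq (G m (i + 1)))))) fun m => by
    obtain ⟨i, hi, h⟩ := h m
    obtain ⟨h1, h2⟩ := hY _ (H.inUnit_grid hG hi.le)
    exact ⟨i, hi, fun h' => h _ h1 ⟨h2, h'⟩, h _⟩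
  obtain ⟨x, hx, hcl⟩ := H.exists_cluster i fun m => (hi m).1
  refine ⟨x, hx, fun n => ?_⟩
  obtain ⟨l, hl⟩ := exists_eps_mul_le hι 8 n
  obtain ⟨m, hm, h1⟩ := hcl (max l n) (max l n)
  obtain ⟨h2, h3, h4⟩ := hi m
  have hp := H.inUnit_grid hG h2.le
  obtain ⟨hy₁, hp₁⟩ := hY _ hp
  obtain ⟨he, he', h5⟩ := H.exists_near_endpoints hG hg h2 hy₁ (hY _) (hE _) hp₁ h3 h4
  obtain ⟨hy₂, he₂⟩ := hY _ he
  obtain ⟨b1, b2⟩ := H.nearLe_grid hG m (i m)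
  refine ⟨m, _, _, _, _, (le_max_right _ _).trans hm, hy₁, hy₂, hp, he, ?_, ?_, hp₁, he₂, h5⟩
  all_goals
    have b3 := b1 m
    have b4 := b2 m
    have b5 := hl (max l n) (le_max_left _ _)
    have b6 := eps_anti hι hm
    have b7 := eps_pos hι n
    obtain ⟨b8, b9⟩ := abs_le.1 h1
    obtain ⟨b10, b11⟩ := abs_le.1 he'
    push_cast at b5
    exact abs_le.2 ⟨by linarith, by linarith⟩

/-- If a locally finite cover does not have a Lebesgue number, then there is a point near which
there are different endpoints at arbitrarily small distances. But near this point there are only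
finitely many endpoints, up to infinitesimals. -/
theorem exists_lebesgue {g : I.M Ty.fn} (hg : RealValued g) (hc : Covers g)
    (hlf : LocallyFinite g) : ∃ m, ∀ i < twoPow m, ∃ y, InUnit y ∧
      InIvl g y (constSeq (G m i)) ∧ InIvl g y (constSeq (G m (i + 1))) := by
  have hι := H.strictMono
  by_contra hcon
  push Not at hcon
  obtain ⟨x, hx, hclose⟩ := H.exists_close_endpoints hG hg hc fun m => by
    obtain ⟨i, hi, h⟩ := hcon m
    exact ⟨i, hi, fun y hy h' => h y hy h'.1 h'.2⟩
  obtain ⟨ε, ⟨hε, hε0⟩, k, Z, hZ, hfin⟩ := hlf x hx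
  obtain ⟨n₀, hn₀⟩ := (H.realLt_iff (H.isReal_constSeq _) hε).1 hε0
  -- the endpoints of the finitely many intervals which meet the neighbourhood of `x`
  have hend : ∀ s, ∃ u : I.M (nat ⇒ Ty.one), ∀ j, IsSum s (Z j) (g (Z j)) (u j) := fun s =>
    choice_nat_one (fun j z => IsSum s (Z j) (g (Z j)) z) fun j => exists_isSum hι s _ _
  choose u hu using hend
  have hur : ∀ s, ∀ j < k, IsReal (u s j) := fun s j hj =>
    H.isReal_of_isSum (hZ j hj).1 (hg _ (hZ j hj)) (hu s j)
  have hgap := fun s s' => H.exists_uniform_gap (u s) (u s') k (hur s) (hur s')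
  choose N hN using hgap
  obtain ⟨M, hM⟩ : ∃ M, ∀ s s', N s s' ≤ M := by
    refine ⟨max (max (N true true) (N true false)) (max (N false true) (N false false)), ?_⟩
    intro s s'
    cases s <;> cases s' <;> simp only [le_max_iff, le_refl, true_or, or_true]
  obtain ⟨l, hl⟩ := exists_eps_mul_le hι 8 n₀
  obtain ⟨l', hl'⟩ := exists_eps_mul_le hι 8 M
  obtain ⟨m, y₁, y₂, p, e, hm, hy₁, hy₂, hp, he, hp', he', hp₁, he₂, h1, h2, s, h3, h4, h5, h6⟩ :=
    hclose (max l l')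
  have hml : 8 * eps ι m ≤ eps ι n₀ := by exact_mod_cast hl m ((le_max_left _ _).trans hm)
  have hml' : 8 * eps ι m ≤ eps ι M := by exact_mod_cast hl' m ((le_max_right _ _).trans hm)
  have hl := hl (max l l') (le_max_left _ _)
  push_cast at hl
  have hball : ∀ z, InUnit z → |lim x - lim z| ≤ eps ι (max l l') → InBall z x ε := by
    intro z hz h
    have h7 := (H.nearLe_constSeq (0 : ℕ)).2 (n₀ + 1)
    rw [rat_zero, eps_add_one] at h7
    generalize lim (constSeq ((0 : ℕ) : I.M nat)) = c at hn₀ h7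
    obtain ⟨h8, h9⟩ := abs_le.1 h
    have := eps_pos hι n₀
    rw [H.inBall_iff hz.1 hx.1 hε]
    constructor <;> refine ⟨n₀ + 1 + 1, ?_⟩ <;> simp only [eps_add_one] <;> linarith
  obtain ⟨j, hj, hset₁⟩ := hfin y₁ hy₁ ⟨p, hp, hball p hp hp', hp₁⟩
  obtain ⟨j', hj', hset₂⟩ := hfin y₂ hy₂ ⟨e, he, hball e he he', he₂⟩
  obtain ⟨a1, a2⟩ := H.endpoint_near true hy₁ (hZ j hj) (hg _ hy₁) (hg _ (hZ j hj)) hp hp₁ hset₁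
    (by simpa only [sgn, cond_true, one_mul] using h1)
    (by simpa only [sgn, cond_true, one_mul] using h2)
  obtain ⟨b1, b2⟩ := H.endpoint_near s hy₂ (hZ j' hj') (hg _ hy₂) (hg _ (hZ j' hj')) he he₂ hset₂
    h3 h4
  obtain ⟨a3, a4⟩ := H.lim_isSum (hZ j hj).1 (hg _ (hZ j hj)) (hu true j)
  obtain ⟨b3, b4⟩ := H.lim_isSum (hZ j' hj').1 (hg _ (hZ j' hj')) (hu s j')
  have a5 := a1.trans a4
  have a6 := a3.trans a2
  have b5 := b1.trans b4
  have b6 := b3.trans b2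
  have a7 := a5 m
  have a8 := a6 m
  have b7 := b5 m
  have b8 := b6 m
  have hm0 := eps_pos hι m
  simp only [sgn, cond_true, one_mul] at a5 a6 a7 a8
  obtain ⟨c1, c2⟩ := abs_le.1 h5
  rcases h6 with h6 | h6
  · have h7 := hN true s j hj j' hj' (a6.trans_farLt (h6.trans_nearLe b5))
    have h8 := eps_anti hι (hM true s)
    linarith
  · have h7 := hN s true j' hj' j hj (b6.trans_farLt (h6.trans_nearLe a5))
    have h8 := eps_anti hι (hM s true)
    linarith

/-- Every element of `[0, 1]` is between two adjacent grid points. -/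
theorem exists_nearLe_grid (m : I.M nat) {x : I.M Ty.one} (hx : InUnit x) :
    ∃ i < twoPow m, NearLe ι (lim (constSeq (G m i))) (lim x) ∧
      NearLe ι (lim x) (lim (constSeq (G m (i + 1)))) := by
  have hι := H.strictMono
  obtain ⟨-, hx0, hx1⟩ := H.inUnit_iff.1 hx
  have hlt : ∀ i, ¬ RealLt x (constSeq (G m i)) ↔ NearLe ι (lim (constSeq (G m i))) (lim x) :=
    fun i => by rw [H.realLt_iff hx.1 (H.isReal_constSeq _), not_farLt hι]
  by_contra! h
  have key := induction (fun i => i ≤ twoPow m → ¬ RealLt x (constSeq (G m i)))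
    (fun _ => by
      rw [hlt]
      refine (H.nearLe_grid hG m 0).1.trans ?_
      rwa [map_zero, zero_mul])
    (fun i hi hi' => by
      have hi'' : i < twoPow m := lt_of_lt_of_le (lt_add_one i) hi'
      rw [H.realLt_iff hx.1 (H.isReal_constSeq _)]
      intro h'
      exact h i hi'' ((hlt i).1 (hi hi''.le)) (.of_le hι (h'.lt hι).le))
  obtain ⟨i, hi⟩ := (eq_zero_or_eq_add_one (twoPow m)).resolve_left (twoPow_pos m).ne'
  refine h i (hi ▸ lt_add_one i) ((hlt i).1 (key i (hi ▸ (lt_add_one i).le))) ?_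
  have h1 := (H.nearLe_grid hG m (i + 1)).2
  rw [← hi, eps, mul_inv_cancel₀ (map_pos_of_pos hι (twoPow_pos m)).ne'] at h1
  rw [← hi]
  exact hx1.trans h1

end IsLimitMap

end Lebesgue

/-! ### The Heine-Borel theorem in a structure -/

/-- Choose, for every two adjacent points of a grid, an interval which contains both. -/
theorem exists_finite_subcover {f g : I.M Ty.fn} (hf : RealValued f) (hg : RealValued g)
    (href : Refines g f) (hc : Covers g) (hlf : LocallyFinite g) :
    ∃ (k : I.M nat) (Z : I.M (nat ⇒ Ty.one)), (∀ i, i < k → InUnit (Z i)) ∧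
      ∀ x, InUnit x → ∃ i, i < k ∧ InIvl f (Z i) x := by
  obtain ⟨R, _, _, _, ι, lim, H⟩ := exists_isLimitMap I
  have hι := H.strictMono
  obtain ⟨G, hG⟩ := exists_isGrid I
  obtain ⟨m, hm⟩ := H.exists_lebesgue hG hg hc hlf
  obtain ⟨Z, hZ⟩ := choice_nat_one (fun (i : I.M nat) (y : I.M Ty.one) => i < twoPow m →
      InUnit y ∧ InIvl f y (constSeq (G m i)) ∧ InIvl f y (constSeq (G m (i + 1)))) fun i => by
    by_cases hi : i < twoPow m
    · obtain ⟨y, hy, h1, h2⟩ := hm i hi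
      obtain ⟨w, hw, h3⟩ := href y hy
      exact ⟨w, fun _ => ⟨hw, h3 _ (H.isReal_constSeq _) h1, h3 _ (H.isReal_constSeq _) h2⟩⟩
    · exact ⟨constSeq 0, fun h => absurd h hi⟩
  refine ⟨twoPow m, Z, fun i hi => (hZ i hi).1, fun x hx => ?_⟩
  obtain ⟨i, hi, h1, h2⟩ := H.exists_nearLe_grid hG m hx
  obtain ⟨h3, h4, h5⟩ := hZ i hi
  have hr := hf _ h3
  obtain ⟨h6, -⟩ := (H.inBall_iff (H.isReal_constSeq _) h3.1 hr).1 h4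
  obtain ⟨-, h7⟩ := (H.inBall_iff (H.isReal_constSeq _) h3.1 hr).1 h5
  exact ⟨i, hi, (H.inBall_iff hx.1 h3.1 hr).2
    ⟨h6.trans_nearLe (h1.add (.of_le hι le_rfl)), h2.trans_farLt h7⟩⟩

end Interp

namespace Interp

variable {I : Interp}

/-! ### The meaning of the formulas about reals -/

@[simp] theorem eval_lift_zero (ρ : I.Env) {σ : Ty} (t : Tm σ) :
    eval ρ (t.lift 0) = eval ρ t := by
  rw [Tm.lift, eval_rename]
  congr 1
  funext τ n
  simp

theorem eval_push_lift (a : I.M nat) (ρ : I.Env) {σ : Ty} (t : Tm σ) (k : ℕ) :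
    eval (push a ρ) (t.lift (k + 1)) = eval ρ (t.lift k) := by
  rw [Tm.lift, eval_rename, Tm.lift, eval_rename]
  congr 1
  funext τ n
  by_cases h : τ = nat
  · subst h
    simp [← add_assoc]
  · simp [h, push_of_ne h]

variable [I.IsACA]

theorem eval_num (ρ : I.Env) (k : ℕ) : eval ρ (num k) = (k : I.M nat) := by
  induction k with
  | zero => exact Nat.cast_zero.symm
  | succ k ih =>
    rw [Nat.cast_succ, ← ih]
    rfl

/-- The value of a fraction of terms. -/
def _root_.HORM.Frac.eval (ρ : I.Env) (p : Frac) : Fr I :=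
  ⟨Interp.eval ρ p.pos, Interp.eval ρ p.neg, Interp.eval ρ p.den⟩

/-- The valuation for the formula under the three quantifiers of `withRat`, when the rational has
the code `c`. -/
noncomputable def pushRat (c : I.M nat) (ρ : I.Env) : I.Env :=
  push (I.den c) (push (I.neg c) (push (I.pos c) ρ))

theorem eval_pushRat_lift (c : I.M nat) (ρ : I.Env) {σ : Ty} (t : Tm σ) (k : ℕ) :
    eval (pushRat c ρ) (t.lift (k + 3)) = eval ρ (t.lift k) := by
  rw [pushRat, eval_push_lift, eval_push_lift, eval_push_lift]

theorem sat_isCode (ρ : I.Env) (c : Tm nat) (p : Frac) :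
    Sat ρ (isCode c p) ↔
      IsCode (eval ρ c) (eval ρ p.pos) (eval ρ p.neg) (eval ρ p.den) := by
  have h2 : ∀ ρ : I.Env, eval ρ (num 2) = 1 + 1 := fun ρ => by
    rw [eval_num, Nat.cast_ofNat, one_add_one_eq_two]
  have hl : ∀ (s t : I.M nat) (u : Tm nat), eval (push t (push s ρ)) (u.lift 2) = eval ρ u :=
    fun s t u => by rw [eval_push_lift, eval_push_lift, eval_lift_zero]
  refine exists_congr fun s => exists_congr fun t => ?_
  simp only [isPair, add, mul, Sat, eval, h2, hl, push_zero, push_one, add_def, mul_def, zero,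
    zero_def, one, one_def]
  rfl

theorem sat_withRat (ρ : I.Env) (c : Tm nat) (F : Frac → Fm) :
    Sat ρ (withRat c F) ↔
      Sat (pushRat (eval ρ c) ρ) (F ⟨v nat 2, v nat 1, v nat 0⟩) := by
  simp only [withRat, Sat, sat_isCode, eval_push_lift, eval_lift_zero]
  constructor
  · rintro ⟨p, n, d, h, h'⟩
    obtain ⟨rfl, rfl, rfl⟩ := h.decode
    exact h'
  · exact fun h => ⟨_, _, _, isCode_decode _, h⟩

omit [I.IsACA] in
theorem frac_eval_plus (ρ : I.Env) (p q : Frac) :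
    (p.plus q).eval ρ = (p.eval ρ).plus (q.eval ρ) := rfl

theorem frac_eval_dyadic (ρ : I.Env) (k : ℕ) (n : Tm nat) :
    (Frac.dyadic k n).eval ρ = Fr.dyadic k (eval ρ n) := by
  rw [Fr.dyadic, ← eval_num ρ]
  rfl

theorem frac_eval_pushRat_lift (c : I.M nat) (ρ : I.Env) (p : Frac) (k : ℕ) :
    (p.lift (k + 3)).eval (pushRat c ρ) = (p.lift k).eval ρ := by
  simp only [Frac.eval, Frac.lift, eval_pushRat_lift]

omit [I.IsACA] in
theorem frac_eval_lift_zero (ρ : I.Env) (p : Frac) : (p.lift 0).eval ρ = p.eval ρ := by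
  simp only [Frac.eval, Frac.lift, eval_lift_zero]

theorem frac_eval_pushRat (c : I.M nat) (ρ : I.Env) :
    Frac.eval (pushRat c ρ) ⟨v nat 2, v nat 1, v nat 0⟩ = Fr.code c := rfl

omit [I.IsACA] in
theorem sat_lt_frac (ρ : I.Env) (p q : Frac) :
    Sat ρ (Frac.lt p q) ↔ (p.eval ρ).Lt (q.eval ρ) := Iff.rfl

theorem sat_isReal (ρ : I.Env) (x : Tm Ty.one) : Sat ρ (isReal x) ↔ IsReal (eval ρ x) := by
  refine forall_congr' fun n => forall_congr' fun i => ?_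
  rw [sat_withRat, sat_withRat, Frac.distLt, Sat, sat_lt_frac, sat_lt_frac]
  simp only [frac_eval_plus, frac_eval_dyadic, frac_eval_pushRat, frac_eval_pushRat_lift _ _ _ 0,
    frac_eval_lift_zero, eval_pushRat_lift _ _ _ 0, eval_pushRat_lift _ _ _ 3, eval_lift_zero,
    eval, eval_push_lift, push_zero, push_one, add, add_def]

theorem sat_realLt (ρ : I.Env) (x y : Tm Ty.one) :
    Sat ρ (realLt x y) ↔ RealLt (eval ρ x) (eval ρ y) := by
  refine exists_congr fun n => ?_
  rw [sat_withRat, sat_withRat, sat_lt_frac]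
  simp only [frac_eval_plus, frac_eval_dyadic, frac_eval_pushRat, frac_eval_pushRat_lift _ _ _ 0,
    frac_eval_lift_zero, eval_pushRat_lift _ _ _ 0, eval_pushRat_lift _ _ _ 3, eval_lift_zero,
    eval, eval_push_lift, push_zero]

theorem sat_realLtAdd (ρ : I.Env) (x y z : Tm Ty.one) :
    Sat ρ (realLtAdd x y z) ↔ RealLtAdd (eval ρ x) (eval ρ y) (eval ρ z) := by
  refine exists_congr fun n => ?_
  rw [sat_withRat, sat_withRat, sat_withRat, sat_lt_frac]
  simp only [frac_eval_plus, frac_eval_dyadic, frac_eval_pushRat, frac_eval_pushRat_lift _ _ _ 0,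
    frac_eval_pushRat_lift _ _ _ 3, frac_eval_lift_zero, eval_pushRat_lift _ _ _ 0,
    eval_pushRat_lift _ _ _ 3, eval_pushRat_lift _ _ _ 6, eval_lift_zero, eval, eval_push_lift,
    push_zero]

theorem eval_constReal (ρ : I.Env) (k : ℕ) : eval ρ (constReal k) = constSeq k := by
  rw [constSeq, ← eval_num ρ]
  rfl

theorem sat_inUnit (ρ : I.Env) (x : Tm Ty.one) : Sat ρ (inUnit x) ↔ InUnit (eval ρ x) := by
  refine and_congr (sat_isReal ρ x) (and_congr (not_congr ?_) (not_congr ?_))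
  · rw [sat_realLt, zeroReal, eval_constReal]
  · rw [sat_realLt, oneReal, eval_constReal]

theorem sat_inBall (ρ : I.Env) (z c r : Tm Ty.one) :
    Sat ρ (inBall z c r) ↔ InBall (eval ρ z) (eval ρ c) (eval ρ r) :=
  and_congr (sat_realLtAdd ρ c z r) (sat_realLtAdd ρ z c r)

theorem sat_inIvl (ρ : I.Env) (f : Tm Ty.fn) (y z : Tm Ty.one) :
    Sat ρ (inIvl f y z) ↔ InIvl (eval ρ f) (eval ρ y) (eval ρ z) :=
  sat_inBall ρ z y (f ⬝ y)

theorem sat_allUnit (ρ : I.Env) (φ : Fm) :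
    Sat ρ (allUnit φ) ↔ ∀ x : I.M Ty.one, InUnit x → Sat (push x ρ) φ :=
  forall_congr' fun _ => imp_congr_left (sat_inUnit _ _)

theorem sat_exUnit (ρ : I.Env) (φ : Fm) :
    Sat ρ (exUnit φ) ↔ ∃ x : I.M Ty.one, InUnit x ∧ Sat (push x ρ) φ :=
  exists_congr fun _ => and_congr_left' (sat_inUnit _ _)

/-! ### The meaning of the formulas about covers -/

theorem realValued_of_sat {ρ : I.Env} {n : ℕ} (h : Sat ρ (isFun (v Ty.fn n))) :
    RealValued (ρ Ty.fn n) := fun x hx =>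
  (sat_isReal _ _).1 ((sat_allUnit _ _).1 h.1 x hx)

theorem sat_covers (ρ : I.Env) (n : ℕ) : Sat ρ (covers (v Ty.fn n)) ↔ Covers (ρ Ty.fn n) := by
  rw [covers, sat_allUnit]
  refine forall₂_congr fun x _ => ?_
  rw [sat_exUnit]
  exact exists_congr fun y => and_congr_right fun _ => sat_inIvl _ _ _ _

theorem sat_refines (ρ : I.Env) (m n : ℕ) :
    Sat ρ (refines (v Ty.fn m) (v Ty.fn n)) ↔ Refines (ρ Ty.fn m) (ρ Ty.fn n) := by
  rw [refines, sat_allUnit]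
  refine forall₂_congr fun x _ => ?_
  rw [sat_exUnit]
  exact exists_congr fun y => and_congr_right fun _ => forall_congr' fun z =>
    imp_congr (sat_isReal _ _) (imp_congr (sat_inIvl _ _ _ _) (sat_inIvl _ _ _ _))

theorem sat_exFinSeq (ρ : I.Env) (φ : Fm) :
    Sat ρ (exFinSeq φ) ↔ ∃ (k : I.M nat) (Z : I.M (nat ⇒ Ty.one)),
      (∀ i, i < k → InUnit (Z i)) ∧ Sat (push Z (push k ρ)) φ :=
  exists_congr fun _ => exists_congr fun _ => and_congr_left' <|
    forall_congr' fun _ => imp_congr Iff.rfl (sat_inUnit _ _)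

theorem sat_locallyFinite (ρ : I.Env) (n : ℕ) :
    Sat ρ (locallyFinite (v Ty.fn n)) ↔ LocallyFinite (ρ Ty.fn n) := by
  rw [locallyFinite, sat_allUnit]
  refine forall₂_congr fun x _ => exists_congr fun e => and_congr ?_ ?_
  · refine and_congr (sat_isReal _ _) ?_
    rw [sat_realLt, zeroReal, eval_constReal]
    rfl
  rw [sat_exFinSeq]
  refine exists_congr fun k => exists_congr fun Z => and_congr_right fun _ => ?_
  rw [sat_allUnit]
  refine forall₂_congr fun y _ => imp_congr ?_ ?_
  · rw [sat_exUnit]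
    exact exists_congr fun z => and_congr_right fun _ =>
      and_congr (sat_inBall _ _ _ _) (sat_inIvl _ _ _ _)
  · refine exists_congr fun i => and_congr Iff.rfl ?_
    rw [sat_allUnit]
    refine forall₂_congr fun z _ => ?_
    have h1 := sat_inIvl (push z (push i (push y (push Z (push k (push e (push x ρ)))))))
      (v Ty.fn n) (v Ty.one 1) (v Ty.one 0)
    have h2 := sat_inIvl (push z (push i (push y (push Z (push k (push e (push x ρ)))))))
      (v Ty.fn n) (v (nat ⇒ Ty.one) 0 ⬝ v nat 0) (v Ty.one 0)
    exact (iff_iff_implies_and_implies).symm.trans (iff_congr h1 h2)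

/-- In a structure, the Heine-Borel theorem follows from the paracompactness of `[0, 1]`. -/
theorem sat_HBT {ρ : I.Env} (h : Sat ρ paracompactUnit) : Sat ρ HBT := by
  intro f hf hc
  obtain ⟨g, hg, href, hgc, hlf⟩ := h f hf hc
  have hf' := realValued_of_sat hf
  have hg' := realValued_of_sat hg
  rw [sat_refines] at href
  rw [sat_covers] at hgc
  rw [sat_locallyFinite] at hlf
  rw [push_zero] at hf' hg' href hgc hlf
  rw [push_one, push_zero] at href
  obtain ⟨k, Z, hZ, hcov⟩ := exists_finite_subcover hf' hg' href hgc hlf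
  rw [sat_exFinSeq]
  refine ⟨k, Z, hZ, ?_⟩
  rw [sat_allUnit]
  intro x hx
  obtain ⟨i, hi, h'⟩ := hcov x hx
  refine ⟨i, hi, ?_⟩
  rw [sat_inIvl]
  exact h'

end Interp
end HORM

theorem theorem3p6 :
    HORM.Proves (HORM.ACA0omega ∪ HORM.QFAC11 ∪ {HORM.paracompactUnit}) HORM.HBT := by
  refine HORM.prf_of_forall_sat
    (fun A hA => .inl (.inl (.inl (.inr (.inr (.inr (.inl hA))))))) fun I hI ρ => ?_
  have : I.IsACA := HORM.Interp.isACA_of_sat Set.subset_union_left hI ρ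
  exact HORM.Interp.sat_HBT (hI _ (.inr rfl) ρ)
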